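/- Let $0\le c<2$. There is exactly one function $\bar u_c:(-\infty,0]\to\mathbb R$ that is strictly decreasing, positive on $(-\infty,0)$, and solves $$u''+cu'+u(1-u)=0\ \text{ on } (-\infty,0],\qquad u'(-\infty)=0,\qquad u(0)=0 .$$ Let $\mathcal L$ be the operator $$\mathcal L p=p''+cp'+(1-2\bar u_c)p$$ in the complex Hilbert space $L^2(\mathbb R^-)$, $\mathbb R^-=(-\infty,0)$, with domain $\{p\in H^2(\mathbb R^-): p(0)=0\}$ (every such $p$ also satisfies $p'(-\infty)=0$). An operator is called Fredholm if its kernel is finite-dimensional and its range is closed and of finite codimension; the index of a densely defined Fredholm operator $T$ is $\dim\ker T-\dim\ker T^*$. The resolvent set of $\mathcal L$ consists of the $\lambda\in\mathbb C$ for which $\mathcal L-\lambda$ has a bounded inverse defined on all of $L^2(\mathbb R^-)$, and the spectrum $\sigma(\mathcal L)$ is its complement. The essential spectrum $\sigma_{\mathrm{ess}}(\mathcal L)$ is the set of $\lambda$ for which $\mathcal L-\lambda$ is not Fredholm or is Fredholm with non-zero index. The point spectrum is the set of $\lambda$ for which $\mathcal L-\lambda$ is Fredholm with index zero but $\lambda$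 is not in the resolvent set. Then: 1. $\sigma(\mathcal L)\subset\{\lambda\in\mathbb C:\operatorname{Re}\lambda<0\}$. 2. $\sigma_{\mathrm{ess}}(\mathcal L)$ is the set of all points of $\mathbb C$ that lie on or to the left of the parabola $$\Gamma_c=\{-k^2-1+ick:\ k\in\mathbb R\},$$ that is, $\sigma_{\mathrm{ess}}(\mathcal L)=\{-k^2-1-s+ick:\ k\in\mathbb R,\ s\ge 0\}$ (for $c=0$ both sets are the half-line $(-\infty,-1]$). Its topological boundary in $\mathbb C$ is $\Gamma_c$, and $\mathcal L-\lambda$ is not Fredholm for $\lambda\in\Gamma_c$. 3. $\mathcal L$ has no point spectrum in $\{\lambda\in\mathbb C:\operatorname{Re}\lambda\ge 0\}$. -/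

import Mathlib

open Set Filter Topology MeasureTheory

noncomputable section

/-! ### Unbounded operators: resolvent set, Fredholm property, spectra -/

namespace UnboundedOp

variable {E : Type*} [NormedAddCommGroup E] [InnerProductSpace ℂ E]

/-- The operator `T - lam`, with the same domain as `T`. -/
def shift (T : E →ₗ.[ℂ] E) (lam : ℂ) : E →ₗ.[ℂ] E where
  domain := T.domain
  toFun := T.toFun - lam • T.domain.subtype

/-- The resolvent set: those `lam` for which `T - lam` maps `dom T` bijectively onto `E`, with a
bounded inverse `R`. -/
def resolventSet (T : E →ₗ.[ℂ] E) : Set ℂ :=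
  {lam | ∃ R : E →L[ℂ] E,
    (∀ x : (shift T lam).domain, R (shift T lam x) = x) ∧
    ∀ y : E, ∃ x : (shift T lam).domain, (x : E) = R y ∧ shift T lam x = y}

/-- The spectrum: the complement of the resolvent set. -/
def spectrum (T : E →ₗ.[ℂ] E) : Set ℂ := (resolventSet T)ᶜ

/-- A (possibly unbounded) operator is Fredholm if its kernel is finite dimensional and its range is
closed and of finite codimension. -/
structure IsFredholm (T : E →ₗ.[ℂ] E) : Prop where
  finite_ker : FiniteDimensional ℂ (LinearMap.ker T.toFun)
  closed_range : IsClosed (LinearMap.range T.toFun : Set E)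
  finite_coker : FiniteDimensional ℂ (E ⧸ LinearMap.range T.toFun)

variable [CompleteSpace E]

/-- The Fredholm index `dim ker T - dim ker T†`, where `T†` is the Hilbert space adjoint
(to be used for densely defined Fredholm operators). -/
def index (T : E →ₗ.[ℂ] E) : ℤ :=
  (Module.finrank ℂ (LinearMap.ker T.toFun) : ℤ) -
    (Module.finrank ℂ (LinearMap.ker T.adjoint.toFun) : ℤ)

/-- The essential spectrum: `T - lam` is not Fredholm, or is Fredholm with non-zero index. -/
def essentialSpectrum (T : E →ₗ.[ℂ] E) : Set ℂ :=
  {lam | ¬ IsFredholm (shift T lam) ∨ (IsFredholm (shift T lam) ∧ index (shift T lam) ≠ 0)}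

/-- The point spectrum: `T - lam` is Fredholm with index zero, but is not (boundedly) invertible. -/
def pointSpectrum (T : E →ₗ.[ℂ] E) : Set ℂ :=
  {lam | IsFredholm (shift T lam) ∧ index (shift T lam) = 0 ∧ lam ∉ resolventSet T}

end UnboundedOp

/-! ### The spreading wave and the linearised operator -/

namespace FisherStefan

/-- `u` is, on `(-∞, 0]`, a positive decreasing solution of `u'' + c u' + u (1 - u) = 0` with
`u'(-∞) = 0` and `u(0) = 0`; here `v` is the derivative of `u` (one-sided at `0`). Values of `u` on
`(0, ∞)` are irrelevant. -/
def IsSpreadingWave (c : ℝ) (u : ℝ → ℝ) : Prop :=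
  (∀ z < 0, 0 < u z) ∧ StrictAntiOn u (Iic 0) ∧ u 0 = 0 ∧
  ∃ v : ℝ → ℝ,
    (∀ z ≤ 0, HasDerivWithinAt u (v z) (Iic 0) z) ∧
    (∀ z ≤ 0, HasDerivWithinAt v (-(c * v z) - u z * (1 - u z)) (Iic 0) z) ∧
    Tendsto v atBot (𝓝 0)

/-- The complex Hilbert space `L²(ℝ⁻)`, `ℝ⁻ = (-∞, 0)`. -/
abbrev L2Neg : Type := Lp ℂ 2 (volume.restrict (Iio (0 : ℝ)))

/-- On `(-∞, 0]` the function `F` is locally absolutely continuous with almost everywhere (hence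
weak) derivative `g ∈ L²(ℝ⁻)`, expressed through the fundamental theorem of calculus. -/
def HasL2Deriv (F : ℝ → ℂ) (g : L2Neg) : Prop :=
  ∀ a ≤ 0, ∀ b ≤ 0, F b - F a = ∫ z in a..b, g z

/-- `p` lies in `H²(ℝ⁻)`, with weak derivatives `p₁ = p'` and `p₂ = p''`, and satisfies the
Dirichlet condition `p(0) = 0`. Here `P` and `P₁` are the (absolutely) continuous representatives
of `p` and `p'`. -/
def IsH2Dirichlet (p p₁ p₂ : L2Neg) : Prop :=
  ∃ P P₁ : ℝ → ℂ,
    p =ᵐ[volume.restrict (Iio 0)] P ∧ HasL2Deriv P p₁ ∧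
    p₁ =ᵐ[volume.restrict (Iio 0)] P₁ ∧ HasL2Deriv P₁ p₂ ∧
    P 0 = 0

lemma HasL2Deriv.intervalIntegrable (g : L2Neg) {a b : ℝ} (ha : a ≤ 0) (hb : b ≤ 0) :
    IntervalIntegrable g volume a b := by
  rw [intervalIntegrable_iff]
  have h1 : MemLp g 2 (volume.restrict (Iio (0 : ℝ))) := Lp.memLp g
  have hs : volume.restrict (uIoc a b) ≤ volume.restrict (Iio (0 : ℝ)) := by
    rw [Measure.restrict_congr_set (Iio_ae_eq_Iic (a := (0 : ℝ)) (μ := volume))]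
    refine Measure.restrict_mono (fun x hx => ?_) le_rfl
    rw [mem_uIoc] at hx
    rcases hx with hx | hx
    · exact hx.2.trans hb
    · exact hx.2.trans ha
  have : IsFiniteMeasure (volume.restrict (uIoc a b)) := by
    rw [uIoc]; infer_instance
  exact (h1.mono_measure hs).integrable (by norm_num)

lemma intervalIntegral_congr_neg {f g : ℝ → ℂ} (h : f =ᵐ[volume.restrict (Iio 0)] g) {a b : ℝ}
    (ha : a ≤ 0) (hb : b ≤ 0) : ∫ z in a..b, f z = ∫ z in a..b, g z := by
  rw [Measure.restrict_congr_set (Iio_ae_eq_Iic (a := (0 : ℝ)) (μ := volume)),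
    Filter.EventuallyEq, ae_restrict_iff' measurableSet_Iic] at h
  apply intervalIntegral.integral_congr_ae'
  · filter_upwards [h] with z hz hz'
    exact hz (hz'.2.trans hb)
  · filter_upwards [h] with z hz hz'
    exact hz (hz'.2.trans ha)

lemma HasL2Deriv.zero : HasL2Deriv (fun _ => 0) 0 := by
  intro a ha b hb
  rw [intervalIntegral_congr_neg (Lp.coeFn_zero ℂ 2 (volume.restrict (Iio (0 : ℝ)))) ha hb]
  simp

lemma HasL2Deriv.add {F G : ℝ → ℂ} {f g : L2Neg} (hF : HasL2Deriv F f) (hG : HasL2Deriv G g) :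
    HasL2Deriv (fun z => F z + G z) (f + g) := by
  intro a ha b hb
  rw [intervalIntegral_congr_neg (Lp.coeFn_add f g) ha hb]
  simp only [Pi.add_apply]
  rw [intervalIntegral.integral_add (HasL2Deriv.intervalIntegrable f ha hb)
    (HasL2Deriv.intervalIntegrable g ha hb), ← hF a ha b hb, ← hG a ha b hb]
  ring

lemma HasL2Deriv.smul {F : ℝ → ℂ} {f : L2Neg} (k : ℂ) (hF : HasL2Deriv F f) :
    HasL2Deriv (fun z => k * F z) (k • f) := by
  intro a ha b hb
  rw [intervalIntegral_congr_neg (Lp.coeFn_smul k f) ha hb]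
  simp only [Pi.smul_apply, smul_eq_mul]
  rw [intervalIntegral.integral_const_mul, ← hF a ha b hb]
  ring

/-- The graph of `𝓛 p = p'' + c p' + (1 - 2 u) p` on `H²(ℝ⁻)` with `p(0) = 0`. (The condition
`p'(-∞) = 0` holds for every `p ∈ H²(ℝ⁻)`.) -/
def linearisationGraph (c : ℝ) (u : ℝ → ℝ) : Submodule ℂ (L2Neg × L2Neg) where
  carrier := {x | ∃ p₁ p₂ : L2Neg, IsH2Dirichlet x.1 p₁ p₂ ∧
    x.2 =ᵐ[volume.restrict (Iio 0)]
      fun z => p₂ z + (c : ℂ) * p₁ z + (1 - 2 * (u z : ℂ)) * x.1 z}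
  add_mem' := by
    rintro x y ⟨p₁, p₂, ⟨P, P₁, h1, h2, h3, h4, h5⟩, h⟩ ⟨q₁, q₂, ⟨Q, Q₁, k1, k2, k3, k4, k5⟩, k⟩
    refine ⟨p₁ + q₁, p₂ + q₂, ⟨_, _, ?_, h2.add k2, ?_, h4.add k4, by simp [h5, k5]⟩, ?_⟩
    · filter_upwards [Lp.coeFn_add x.1 y.1, h1, k1] with z e1 e2 e3
      simp only [Prod.fst_add, e1, e2, e3, Pi.add_apply]
    · filter_upwards [Lp.coeFn_add p₁ q₁, h3, k3] with z e1 e2 e3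
      simp only [e1, e2, e3, Pi.add_apply]
    · filter_upwards [Lp.coeFn_add x.1 y.1, Lp.coeFn_add x.2 y.2, Lp.coeFn_add p₁ q₁,
        Lp.coeFn_add p₂ q₂, h, k] with z e1 e2 e3 e4 e5 e6
      simp only [Prod.fst_add, Prod.snd_add, e1, e2, e3, e4, Pi.add_apply, e5, e6]
      ring
  zero_mem' := by
    have h := Lp.coeFn_zero ℂ 2 (volume.restrict (Iio (0 : ℝ)))
    refine ⟨0, 0, ⟨_, _, h, HasL2Deriv.zero, h, HasL2Deriv.zero, rfl⟩, ?_⟩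
    filter_upwards [h] with z e1
    simp only [Prod.fst_zero, Prod.snd_zero, e1, Pi.zero_apply]
    ring
  smul_mem' := by
    rintro k x ⟨p₁, p₂, ⟨P, P₁, h1, h2, h3, h4, h5⟩, h⟩
    refine ⟨k • p₁, k • p₂, ⟨_, _, ?_, h2.smul k, ?_, h4.smul k, by simp [h5]⟩, ?_⟩
    · filter_upwards [Lp.coeFn_smul k x.1, h1] with z e1 e2
      simp [e1, e2]
    · filter_upwards [Lp.coeFn_smul k p₁, h3] with z e1 e2
      simp [e1, e2]
    · filter_upwards [Lp.coeFn_smul k x.1, Lp.coeFn_smul k x.2, Lp.coeFn_smul k p₁,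
        Lp.coeFn_smul k p₂, h] with z e1 e2 e3 e4 e5
      simp only [Prod.smul_fst, Prod.smul_snd, e1, e2, e3, e4, Pi.smul_apply, e5, smul_eq_mul]
      ring

/-- The linearised operator `𝓛 p = p'' + c p' + (1 - 2 u) p` in `L²(ℝ⁻)` with domain given by
`H²(ℝ⁻)` and `p(0) = 0`. -/
def linearisation (c : ℝ) (u : ℝ → ℝ) : L2Neg →ₗ.[ℂ] L2Neg :=
  (linearisationGraph c u).toLinearPMap

lemma HasL2Deriv.continuousOn {F : ℝ → ℂ} {g : L2Neg} (h : HasL2Deriv F g) :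
    ContinuousOn F (Iic 0) := by
  intro x hx
  have hx' : x ≤ 0 := hx
  have hc : ContinuousOn (fun b => ∫ z in (x - 1)..b, g z) (uIcc (x - 1) 0) :=
    intervalIntegral.continuousOn_primitive_interval'
      (HasL2Deriv.intervalIntegrable g (by linarith) le_rfl) left_mem_uIcc
  have hc' : ContinuousOn F (Icc (x - 1) 0) := by
    rw [uIcc_of_le (by linarith)] at hc
    refine (hc.add (continuousOn_const (c := F (x - 1)))).congr fun b hb => ?_
    simp only [Pi.add_apply]
    rw [← h (x - 1) (by linarith) b hb.2]
    ring
  refine (hc' x ⟨by linarith, hx'⟩).mono_of_mem_nhdsWithin ?_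
  rw [mem_nhdsWithin]
  exact ⟨Ioi (x - 1), isOpen_Ioi, by simp, fun y hy => ⟨le_of_lt hy.1, hy.2⟩⟩

lemma HasL2Deriv.eq_zero {F : ℝ → ℂ} {g : L2Neg} (h : HasL2Deriv F g)
    (h0 : F =ᵐ[volume.restrict (Iio 0)] fun _ => 0) :
    EqOn F (fun _ => 0) (Iic 0) ∧ g = 0 := by
  have hF : EqOn F (fun _ => 0) (Iic 0) := by
    refine Measure.eqOn_of_ae_eq (μ := volume) ?_ h.continuousOn continuousOn_const (by simp)
    rwa [← Measure.restrict_congr_set (Iio_ae_eq_Iic (a := (0 : ℝ)) (μ := volume))]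
  refine ⟨hF, ?_⟩
  have hn : ∀ n : ℕ, ∀ᵐ x, x ∈ Ioo (-(n : ℝ)) 0 → g x = 0 := by
    intro n
    have hneg : -(n : ℝ) ≤ 0 := by simp
    filter_upwards [(HasL2Deriv.intervalIntegrable g hneg le_rfl).ae_hasDerivAt_integral]
      with x hx hxm
    have hd := hx (by rw [uIcc_of_le hneg]; exact ⟨hxm.1.le, hxm.2.le⟩) (-(n : ℝ)) left_mem_uIcc
    have hz : (fun b => ∫ t in (-(n : ℝ))..b, g t) =ᶠ[𝓝 x] fun _ => (0 : ℂ) := by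
      filter_upwards [Iio_mem_nhds hxm.2] with b hb
      have hb' : b ≤ 0 := le_of_lt hb
      rw [← h _ hneg b hb', hF hb', hF hneg]
      simp
    exact hd.unique ((hasDerivAt_const x (0 : ℂ)).congr_of_eventuallyEq hz)
  rw [Lp.eq_zero_iff_ae_eq_zero, Filter.EventuallyEq, ae_restrict_iff' measurableSet_Iio]
  filter_upwards [ae_all_iff.2 hn] with x hx hx0
  obtain ⟨n, hn'⟩ := exists_nat_gt (-x)
  exact hx n ⟨by linarith, hx0⟩

/-- `linearisation c u` is well defined: its graph is `linearisationGraph c u`. -/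
theorem linearisation_graph (c : ℝ) (u : ℝ → ℝ) :
    (linearisation c u).graph = linearisationGraph c u := by
  refine Submodule.toLinearPMap_graph_eq _ ?_
  rintro ⟨p, f⟩ ⟨p₁, p₂, ⟨P, P₁, h1, h2, h3, h4, h5⟩, h⟩ hp
  simp only at hp h1 h ⊢
  subst hp
  have hz := Lp.coeFn_zero ℂ 2 (volume.restrict (Iio (0 : ℝ)))
  obtain ⟨-, rfl⟩ := h2.eq_zero (h1.symm.trans hz)
  obtain ⟨-, rfl⟩ := h4.eq_zero (h3.symm.trans hz)
  rw [Lp.eq_zero_iff_ae_eq_zero]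
  filter_upwards [h, hz] with z e1 e2
  rw [e1, e2]
  simp

/-- The parabola `lam = -k² - 1 + i c k`, `k ∈ ℝ` (the half-line `(-∞, -1]` if `c = 0`). -/
def farFieldParabola (c : ℝ) : Set ℂ :=
  range fun k : ℝ => -(k : ℂ) ^ 2 - 1 + Complex.I * c * k

/-- The points that lie on the parabola or to the left of it. -/
def farFieldRegion (c : ℝ) : Set ℂ :=
  {lam | ∃ w ∈ farFieldParabola c, lam.im = w.im ∧ lam.re ≤ w.re}

end FisherStefan

end

/-!
Spectrum of the linearisation about the spreading wave of the Fisher-Stefan problem, for `0 ≤ c < 2`.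

**The wave.** Existence: with `y = 1 - u`, the orbit leaving the saddle `u = 1` is obtained from a
contraction (`exists_profile_fixedPoint`). It moves monotonically as long as `0 < u < 1`, and it
reaches `u = 0` because for `c < 2` the origin is a focus of the phase plane
(`not_forall_decreasing`). Uniqueness: the nonlinearity divided by `u` is decreasing, so the
Wronskian of two profiles is incompatible with an interval on which they are ordered strictly
(`WaveData.profile_le`).

**Right inverses.** At `-∞` the operator `𝓛 - lam` becomes `p'' + c p' - (1 + lam) p`, with
characteristic roots `ν₁`, `ν₂`, `ν₁ + ν₂ = -c` and `Re ν₁ ≥ Re ν₂`. The point `lam` lies on the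
parabola, to the left or to the right of it, according to whether `Re ν₁` is zero, negative or
positive. If `Re ν₁ ≠ 0`, the limiting operator is a product of two first order operators, each of
which has a bounded right inverse given by an integral kernel. The remaining coefficient
`2 (1 - u)` tends to `0` at `-∞`. It is absorbed by a Neumann series in a weighted norm, so no
compactness argument is needed (`exists_rightInverse`). Without boundary condition, the full operator
thus has a bounded right inverse `R` on `H²`, and its kernel contains a nonzero function if
`Re ν₁ > 0` and is trivial if `Re ν₁ < 0`. By a Wronskian argument the kernel is at most
one-dimensional.

**The Dirichlet condition.** A function `f` is in the range of `𝓛 - lam` if and only if the value at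
`0` of `R f` is the value at `0` of an element of the kernel. To the left of the parabola this means
that it vanishes, so the range is the kernel of a nonzero bounded functional and the index is `-1`
(`WaveData.fredholm_left`). To the right, the index is `0`, and `𝓛 - lam` is invertible as soon as
the `L²` solution of the homogeneous equation does not vanish at `0` (`WaveData.fredholm_right`).
For `Re lam ≥ 0` it does not, by comparison with the solution `u' < 0` for `lam = 0`
(`ClassicalSol.eq_zero_of_re_nonneg`).

**The parabola.** For `Re ν₁ = 0` wave packets of growing width, with disjoint supports moving to
`-∞`, form a singular sequence, which a closed Fredholm operator cannot have
(`WaveData.not_isFredholm`). The operator is closed because its resolvent set is not empty.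
-/

/-! ### Monotonicity on half-lines -/

namespace FisherStefan

lemma hasDerivAt_of_Iic {g : ℝ → ℝ} {g' b z : ℝ} (h : HasDerivWithinAt g g' (Iic b) z)
    (hz : z < b) : HasDerivAt g g' z :=
  h.hasDerivAt (Iic_mem_nhds hz)

lemma monotoneOn_Iic {g g' : ℝ → ℝ} {b : ℝ}
    (h : ∀ z ≤ b, HasDerivWithinAt g (g' z) (Iic b) z) (hn : ∀ z < b, 0 ≤ g' z) :
    MonotoneOn g (Iic b) := by
  refine monotoneOn_of_deriv_nonneg (convex_Iic b) (fun z hz => (h z hz).continuousWithinAt) ?_ ?_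
  · intro z hz
    rw [interior_Iic] at hz
    exact (hasDerivAt_of_Iic (h z (le_of_lt hz)) hz).differentiableAt.differentiableWithinAt
  · intro z hz
    rw [interior_Iic] at hz
    rw [(hasDerivAt_of_Iic (h z (le_of_lt hz)) hz).deriv]
    exact hn z hz

lemma strictMonoOn_Iic {g g' : ℝ → ℝ} {b : ℝ}
    (h : ∀ z ≤ b, HasDerivWithinAt g (g' z) (Iic b) z) (hn : ∀ z < b, 0 < g' z) :
    StrictMonoOn g (Iic b) := by
  refine strictMonoOn_of_deriv_pos (convex_Iic b) (fun z hz => (h z hz).continuousWithinAt) ?_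
  intro z hz
  rw [interior_Iic] at hz
  rw [(hasDerivAt_of_Iic (h z (le_of_lt hz)) hz).deriv]
  exact hn z hz

/-- A function on a left half-line whose slope is at least `κ > 0` is unbounded below. -/
lemma exists_lt_of_deriv_ge {g g' : ℝ → ℝ} {b κ : ℝ} (hκ : 0 < κ)
    (h : ∀ z ≤ b, HasDerivWithinAt g (g' z) (Iic b) z) (hn : ∀ z < b, κ ≤ g' z) (B : ℝ) :
    ∃ z ≤ b, g z < B := by
  have hm : MonotoneOn (fun z => g z - κ * z) (Iic b) := by
    refine monotoneOn_Iic (g' := fun z => g' z - κ * 1) (fun z hz => ?_) (fun z hz => ?_)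
    · exact (h z hz).sub ((hasDerivWithinAt_id z _).const_mul κ)
    · linarith [hn z hz]
  obtain ⟨t, ht⟩ := exists_gt ((g b - B) / κ)
  refine ⟨b - max t 0, by simp, ?_⟩
  have h1 := hm (show b - max t 0 ∈ Iic b by simp) (show b ∈ Iic b by simp) (by simp)
  simp only at h1
  have h2 : (g b - B) < t * κ := (div_lt_iff₀ hκ).1 ht
  have h3 : t * κ ≤ max t 0 * κ := mul_le_mul_of_nonneg_right (le_max_left _ _) hκ.le
  linarith

/-! ### Properties of a spreading wave -/

/-- The profile `u`, its derivative `v` and the differential equation, as a bundle of facts. -/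
structure WaveData (c : ℝ) (u v : ℝ → ℝ) : Prop where
  pos : ∀ z < 0, 0 < u z
  anti : StrictAntiOn u (Iic 0)
  zero : u 0 = 0
  du : ∀ z ≤ 0, HasDerivWithinAt u (v z) (Iic 0) z
  dv : ∀ z ≤ 0, HasDerivWithinAt v (-(c * v z) - u z * (1 - u z)) (Iic 0) z
  lim : Tendsto v atBot (𝓝 0)

lemma IsSpreadingWave.exists_data {c : ℝ} {u : ℝ → ℝ} (h : IsSpreadingWave c u) :
    ∃ v, WaveData c u v := by
  obtain ⟨h1, h2, h3, v, h4, h5, h6⟩ := h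
  exact ⟨v, h1, h2, h3, h4, h5, h6⟩

namespace WaveData

variable {c : ℝ} {u v : ℝ → ℝ}

lemma nonneg (h : WaveData c u v) {z : ℝ} (hz : z ≤ 0) : 0 ≤ u z := by
  rcases hz.lt_or_eq with hz | rfl
  · exact (h.pos z hz).le
  · exact h.zero.ge

lemma continuousOn (h : WaveData c u v) : ContinuousOn u (Iic 0) :=
  fun z hz => (h.du z hz).continuousWithinAt

/-- The equation in the form `(u' + c u)' = -u (1 - u)`. If `u (1 - u)` stayed away from `0` near
`-∞`, then `u' + c u` would be unbounded. -/
lemma hasDeriv_energy (h : WaveData c u v) {b z : ℝ} (hb : b ≤ 0) (hz : z ≤ b) :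
    HasDerivWithinAt (fun z => v z + c * u z) (-(u z * (1 - u z))) (Iic b) z := by
  have := ((h.dv z (hz.trans hb)).add ((h.du z (hz.trans hb)).const_mul c)).mono
    (Iic_subset_Iic.2 hb)
  refine this.congr_deriv ?_
  ring

lemma le_one (h : WaveData c u v) (hc : 0 ≤ c) {z : ℝ} (hz : z < 0) : u z ≤ 1 := by
  by_contra! hlt
  obtain ⟨z1, hz1⟩ :=
    (h.lim.eventually (lt_mem_nhds (show (-1 : ℝ) < 0 by norm_num))).exists_forall_of_atBot
  obtain ⟨y, hy, hy'⟩ := exists_lt_of_deriv_ge (b := min z z1) (κ := u z * (u z - 1))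
    (by nlinarith) (fun y hy => h.hasDeriv_energy ((min_le_left _ _).trans hz.le) hy)
    (fun y hy => by
      have hyz : y < z := hy.trans_le (min_le_left _ _)
      have := h.anti (show y ∈ Iic (0:ℝ) from (hyz.trans hz).le) (show z ∈ Iic (0:ℝ) from hz.le) hyz
      nlinarith) (-1)
  have h1 := hz1 y (hy.trans (min_le_right _ _))
  have h2 := h.nonneg ((hy.trans (min_le_left _ _)).trans hz.le)
  nlinarith [mul_nonneg hc h2]

lemma lt_one (h : WaveData c u v) (hc : 0 ≤ c) {z : ℝ} (hz : z ≤ 0) : u z < 1 :=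
  (h.anti (show z - 1 ∈ Iic (0:ℝ) by simp; linarith) hz (by linarith)).trans_le
    (h.le_one hc (by linarith))

lemma tendsto_one (h : WaveData c u v) (hc : 0 ≤ c) : Tendsto u atBot (𝓝 1) := by
  refine tendsto_order.2 ⟨fun l hl => ?_, fun l hl => ?_⟩
  · have key : ∃ z ≤ 0, l < u z := by
      by_contra! hle
      obtain ⟨z1, hz1⟩ :=
        (h.lim.eventually (gt_mem_nhds (show (0 : ℝ) < 1 by norm_num))).exists_forall_of_atBot
      have hu1 : 0 < u (-1) := h.pos _ (by norm_num)
      obtain ⟨y, hy, hy'⟩ := exists_lt_of_deriv_ge (g := fun z => -(v z + c * u z))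
        (b := min (-1) z1) (κ := u (-1) * (1 - l)) (by nlinarith)
        (fun y hy => (h.hasDeriv_energy ((min_le_left _ _).trans (by norm_num)) hy).neg)
        (fun y hy => by
          have hyz : y < -1 := hy.trans_le (min_le_left _ _)
          have h1 := h.anti (show y ∈ Iic (0:ℝ) by simp; linarith)
            (show (-1:ℝ) ∈ Iic (0:ℝ) by simp) hyz
          have h2 := hle y (by linarith)
          nlinarith) (-(1 + c))
      have h1 := hz1 y (hy.trans (min_le_right _ _))
      have h2 := h.lt_one hc (z := y) ((hy.trans (min_le_left _ _)).trans (by norm_num))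
      nlinarith [mul_nonneg hc (sub_nonneg.2 h2.le)]
    obtain ⟨z, hz, hlz⟩ := key
    filter_upwards [Iic_mem_atBot z] with y hy
    exact hlz.trans_le (h.anti.antitoneOn (show y ∈ Iic (0:ℝ) from le_trans hy hz) hz hy)
  · filter_upwards [Iic_mem_atBot 0] with y hy
    exact (h.lt_one hc hy).trans hl

/-- Multiplication by `e^{az}`, `a ≥ 0`, keeps a limit `0` at `-∞`. -/
lemma _root_.Filter.Tendsto.exp_mul_atBot_zero {g : ℝ → ℝ} (hg : Tendsto g atBot (𝓝 0)) {a : ℝ}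
    (ha : 0 ≤ a) : Tendsto (fun z => Real.exp (a * z) * g z) atBot (𝓝 0) := by
  refine squeeze_zero_norm' ?_ (by simpa using hg.norm)
  filter_upwards [Iic_mem_atBot 0] with z hz
  rw [norm_mul, Real.norm_of_nonneg (Real.exp_pos _).le]
  refine mul_le_of_le_one_left (norm_nonneg _) (Real.exp_le_one_iff.2 ?_)
  exact mul_nonpos_of_nonneg_of_nonpos ha hz

lemma hasDerivWithinAt_exp_mul {g : ℝ → ℝ} {g' a z : ℝ} {s : Set ℝ}
    (hg : HasDerivWithinAt g g' s z) :
    HasDerivWithinAt (fun z => Real.exp (a * z) * g z) (Real.exp (a * z) * (a * g z + g')) s z := by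
  have h1 : HasDerivAt (fun z => Real.exp (a * z)) (Real.exp (a * z) * (a * 1)) z :=
    ((hasDerivAt_id z).const_mul a).exp
  refine (h1.hasDerivWithinAt.mul hg).congr_deriv ?_
  ring

lemma _root_.MonotoneOn.le_of_tendsto_atBot {g : ℝ → ℝ} {b l : ℝ} (hg : MonotoneOn g (Iic b))
    (hl : Tendsto g atBot (𝓝 l)) {z : ℝ} (hz : z ≤ b) : l ≤ g z := by
  refine le_of_tendsto hl ?_
  filter_upwards [Iic_mem_atBot z] with y hy
  exact hg (le_trans hy hz) hz hy

lemma deriv_neg (h : WaveData c u v) (hc : 0 ≤ c) {z : ℝ} (hz : z ≤ 0) : v z < 0 := by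
  have hm : StrictMonoOn (fun z => Real.exp (c * z) * -v z) (Iic 0) :=
    strictMonoOn_Iic (fun z hz => hasDerivWithinAt_exp_mul (h.dv z hz).neg) (fun z hz => by
      have := h.pos z hz
      have := h.lt_one hc hz.le
      have : 0 < u z * (1 - u z) := by nlinarith
      refine mul_pos (Real.exp_pos _) ?_
      linarith)
  have h1 := hm.monotoneOn.le_of_tendsto_atBot
    ((by simpa using h.lim.neg : Tendsto (fun z => -v z) atBot (𝓝 0)).exp_mul_atBot_zero hc)
    (z := z - 1) (by linarith)
  have h2 := h1.trans_lt (hm (show z - 1 ∈ Iic (0:ℝ) by simp; linarith) hz (by linarith))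
  have := pos_of_mul_pos_right h2 (Real.exp_pos _).le
  linarith

/-- Near `-∞` the profile approaches `1` along the unstable direction, not faster than its
derivative tends to `0`. -/
lemma exists_one_sub_le (h : WaveData c u v) (hc : 0 ≤ c) (hc2 : c < 2) :
    ∃ z₀ < 0, ∀ z ≤ z₀, 1 - u z ≤ 5 * -v z := by
  obtain ⟨z1, hz1⟩ := ((h.tendsto_one hc).eventually
    (lt_mem_nhds (show (1 / 2 : ℝ) < 1 by norm_num))).exists_forall_of_atBot
  have hz0 : min z1 (-1) ≤ 0 := (min_le_right _ _).trans (by norm_num)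
  refine ⟨min z1 (-1), (min_le_right _ _).trans_lt (by norm_num), fun z hz => ?_⟩
  have hm : MonotoneOn (fun z => Real.exp ((c + 1 / 5) * z) * (-v z - (1 - u z) / 5))
      (Iic (min z1 (-1))) := by
    refine monotoneOn_Iic (fun z hz => hasDerivWithinAt_exp_mul
      (((h.dv z (hz.trans hz0)).mono (Iic_subset_Iic.2 hz0)).neg.sub
        ((((h.du z (hz.trans hz0)).mono (Iic_subset_Iic.2 hz0)).const_sub 1).div_const 5)))
      (fun z hz => ?_)
    refine mul_nonneg (Real.exp_pos _).le ?_
    have h1 := hz1 z (hz.le.trans (min_le_left _ _))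
    have h2 := h.lt_one hc (hz.le.trans hz0)
    nlinarith
  have hl : Tendsto (fun z => -v z - (1 - u z) / 5) atBot (𝓝 0) := by
    have := h.lim.neg.sub (((h.tendsto_one hc).const_sub 1).div_const 5)
    simpa using this
  have h1 := hm.le_of_tendsto_atBot (hl.exp_mul_atBot_zero (by positivity)) hz
  have h2 := nonneg_of_mul_nonneg_right h1 (Real.exp_pos _)
  linarith

end WaveData

/-! ### Uniqueness of the spreading wave -/

lemma exists_first_zero {d : ℝ → ℝ} {a b : ℝ} (hab : a ≤ b) (hd : ContinuousOn d (Icc a b))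
    (ha : 0 < d a) (hb : d b ≤ 0) : ∃ t ∈ Ioc a b, d t = 0 ∧ ∀ s ∈ Ico a t, 0 < d s := by
  set S := Icc a b ∩ d ⁻¹' Iic 0 with hS
  have hcl : IsClosed S := hd.preimage_isClosed_of_isClosed isClosed_Icc isClosed_Iic
  have hne : S.Nonempty := ⟨b, ⟨hab, le_rfl⟩, hb⟩
  have hbd : BddBelow S := ⟨a, fun x hx => hx.1.1⟩
  have hmem := hcl.csInf_mem hne hbd
  set t := sInf S
  have hpos : ∀ s ∈ Ico a t, 0 < d s := by
    intro s hs
    by_contra! hle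
    exact absurd (csInf_le hbd (show s ∈ S from ⟨⟨hs.1, hs.2.le.trans hmem.1.2⟩, hle⟩))
      (not_le.2 hs.2)
  have hat : a < t := by
    rcases hmem.1.1.lt_or_eq with h | h
    · exact h
    · have := hmem.2; rw [← h] at this; exact absurd this (not_le.2 ha)
  refine ⟨t, ⟨hat, hmem.1.2⟩, le_antisymm hmem.2 ?_, hpos⟩
  have hc : ContinuousWithinAt d (Iio t) t :=
    ((hd t hmem.1).mono (fun x hx => hx) : ContinuousWithinAt d (Icc a b) t).mono_of_mem_nhdsWithin
      (mem_nhdsWithin.2 ⟨Ioi a, isOpen_Ioi, hat,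
        fun x hx => ⟨le_of_lt hx.1, (le_of_lt hx.2).trans hmem.1.2⟩⟩)
  refine ge_of_tendsto hc ?_
  filter_upwards [Ico_mem_nhdsLT hat] with s hs using (hpos s hs).le

lemma derivWithin_nonpos_of_pos_left {d : ℝ → ℝ} {d' a t : ℝ} (hat : a < t)
    (hd : HasDerivWithinAt d d' (Iic t) t) (h0 : d t = 0) (hpos : ∀ s ∈ Ico a t, 0 < d s) :
    d' ≤ 0 := by
  have h1 := hasDerivWithinAt_iff_tendsto_slope.1 hd
  rw [show Iic t \ {t} = Iio t by ext; simp [lt_iff_le_and_ne]] at h1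
  refine le_of_tendsto h1 ?_
  filter_upwards [Ico_mem_nhdsLT hat] with s hs
  rw [slope_def_field, h0]
  exact div_nonpos_of_nonneg_of_nonpos (by linarith [hpos s hs]) (by linarith [hs.2])

namespace WaveData

variable {c : ℝ} {u₁ v₁ u₂ v₂ : ℝ → ℝ}

lemma hasDeriv_wronskian (h₁ : WaveData c u₁ v₁) (h₂ : WaveData c u₂ v₂) {b z : ℝ} (hb : b ≤ 0)
    (hz : z ≤ b) :
    HasDerivWithinAt (fun z => Real.exp (c * z) * (v₁ z * u₂ z - u₁ z * v₂ z))
      (Real.exp (c * z) * (u₁ z * u₂ z * (u₁ z - u₂ z))) (Iic b) z := by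
  have := (hasDerivWithinAt_exp_mul (a := c) (((h₁.dv z (hz.trans hb)).mul
    (h₂.du z (hz.trans hb))).sub ((h₁.du z (hz.trans hb)).mul (h₂.dv z (hz.trans hb))))).mono
    (Iic_subset_Iic.2 hb)
  refine this.congr_deriv ?_
  simp only [Pi.mul_apply, Pi.sub_apply]
  ring

/-- The nonlinearity divided by `u` decreases in `u`. Hence the weighted Wronskian
`e^{cz}(u₁'u₂ - u₁u₂')` increases strictly on a maximal interval where `u₁ > u₂`, while its values
at the end points have the opposite signs; so there is no such interval. -/
lemma profile_le (h₁ : WaveData c u₁ v₁) (h₂ : WaveData c u₂ v₂) (hc : 0 ≤ c) {z₀ : ℝ}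
    (hz₀ : z₀ < 0) : u₁ z₀ ≤ u₂ z₀ := by
  by_contra! hlt
  set W : ℝ → ℝ := fun z => Real.exp (c * z) * (v₁ z * u₂ z - u₁ z * v₂ z) with hW
  have hdcont : ContinuousOn (fun z => u₁ z - u₂ z) (Iic 0) := h₁.continuousOn.sub h₂.continuousOn
  have hneg : W z₀ < 0 := by
    obtain ⟨t, ht, ht0, htpos⟩ := exists_first_zero hz₀.le (hdcont.mono Icc_subset_Iic_self)
      (sub_pos.2 hlt) (by simp [h₁.zero, h₂.zero])
    have hd : v₁ t - v₂ t ≤ 0 := derivWithin_nonpos_of_pos_left ht.1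
      (((h₁.du t ht.2).sub (h₂.du t ht.2)).mono (Iic_subset_Iic.2 ht.2)) ht0 htpos
    have hWt : W t ≤ 0 := by
      have h0 := h₁.nonneg ht.2
      have he : u₁ t = u₂ t := sub_eq_zero.1 ht0
      refine mul_nonpos_of_nonneg_of_nonpos (Real.exp_pos _).le ?_
      rw [← he]
      nlinarith
    have hmono : StrictMonoOn W (Icc z₀ t) := by
      refine strictMonoOn_of_deriv_pos (convex_Icc _ _)
        (fun z hz => ((h₁.hasDeriv_wronskian h₂ le_rfl (hz.2.trans ht.2)).continuousWithinAt).mono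
          (fun x hx => hx.2.trans ht.2)) ?_
      intro z hz
      rw [interior_Icc] at hz
      have hz0 : z < 0 := hz.2.trans_le ht.2
      rw [(hasDerivAt_of_Iic (h₁.hasDeriv_wronskian h₂ le_rfl hz0.le) hz0).deriv]
      have := htpos z ⟨hz.1.le, hz.2⟩
      exact mul_pos (Real.exp_pos _) (mul_pos (mul_pos (h₁.pos z hz0) (h₂.pos z hz0)) this)
    exact (hmono (left_mem_Icc.2 ht.1.le) (right_mem_Icc.2 ht.1.le) ht.1).trans_le hWt
  have hnonneg : 0 ≤ W z₀ := by
    by_cases hex : ∃ s < z₀, u₁ s - u₂ s ≤ 0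
    · obtain ⟨s, hs, hsd⟩ := hex
      obtain ⟨t, ht, ht0, htpos⟩ := exists_first_zero (d := fun x => u₁ (-x) - u₂ (-x))
        (neg_le_neg hs.le) (hdcont.comp continuousOn_neg (fun x hx => by
          have := hx.1; simp only [mem_Iic]; linarith))
        (by simpa using hlt) (by simpa using hsd)
      have htz : -t < z₀ := by linarith [ht.1]
      have hd : -(v₁ (-t) - v₂ (-t)) ≤ 0 := by
        have h3 := (hasDerivAt_of_Iic ((h₁.du (-t) (by linarith)).sub (h₂.du (-t) (by linarith)))
          (by linarith))
        have h4 := h3.scomp_of_eq (x := t) (hasDerivAt_neg t) rfl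
        refine derivWithin_nonpos_of_pos_left ht.1
          (h4.hasDerivWithinAt.congr_deriv (by simp)) ht0 htpos
      have hWt : 0 ≤ W (-t) := by
        have h0 := h₁.nonneg (z := -t) (by linarith)
        have he : u₁ (-t) = u₂ (-t) := sub_eq_zero.1 ht0
        refine mul_nonneg (Real.exp_pos _).le ?_
        rw [← he]
        nlinarith
      have hmono : MonotoneOn W (Icc (-t) z₀) := by
        refine monotoneOn_of_deriv_nonneg (convex_Icc _ _)
          (fun z hz =>
            ((h₁.hasDeriv_wronskian h₂ le_rfl (hz.2.trans hz₀.le)).continuousWithinAt).mono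
            (fun x hx => hx.2.trans hz₀.le)) ?_ ?_
        · intro z hz
          rw [interior_Icc] at hz
          have hz0 : z < 0 := hz.2.trans hz₀
          exact (hasDerivAt_of_Iic (h₁.hasDeriv_wronskian h₂ le_rfl hz0.le)
            hz0).differentiableAt.differentiableWithinAt
        · intro z hz
          rw [interior_Icc] at hz
          have hz0 : z < 0 := hz.2.trans hz₀
          rw [(hasDerivAt_of_Iic (h₁.hasDeriv_wronskian h₂ le_rfl hz0.le) hz0).deriv]
          have := htpos (-z) ⟨by linarith [hz.2], by linarith [hz.1]⟩
          rw [neg_neg] at this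
          exact (mul_pos (Real.exp_pos _)
            (mul_pos (mul_pos (h₁.pos z hz0) (h₂.pos z hz0)) this)).le
      exact hWt.trans (hmono (left_mem_Icc.2 htz.le) (right_mem_Icc.2 htz.le) htz.le)
    · push Not at hex
      have hmono : MonotoneOn W (Iic z₀) :=
        monotoneOn_Iic (fun z hz => h₁.hasDeriv_wronskian h₂ hz₀.le hz) (fun z hz => by
          have hz0 : z < 0 := hz.trans hz₀
          exact (mul_pos (Real.exp_pos _)
            (mul_pos (mul_pos (h₁.pos z hz0) (h₂.pos z hz0)) (hex z hz))).le)
      refine hmono.le_of_tendsto_atBot ?_ (z := z₀) le_rfl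
      have h3 := (h₁.lim.mul (h₂.tendsto_one hc)).sub ((h₁.tendsto_one hc).mul h₂.lim)
      simp only [zero_mul, mul_zero, sub_zero] at h3
      exact h3.exp_mul_atBot_zero hc
  exact absurd hneg (not_lt.2 hnonneg)

end WaveData

theorem IsSpreadingWave.eqOn {c : ℝ} {u₁ u₂ : ℝ → ℝ} (hc : 0 ≤ c) (h₁ : IsSpreadingWave c u₁)
    (h₂ : IsSpreadingWave c u₂) : EqOn u₁ u₂ (Iic 0) := by
  obtain ⟨v₁, h₁⟩ := h₁.exists_data
  obtain ⟨v₂, h₂⟩ := h₂.exists_data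
  intro z hz
  rcases (show z ≤ 0 from hz).lt_or_eq with hz | rfl
  · exact le_antisymm (h₁.profile_le h₂ hc hz) (h₂.profile_le h₁ hc hz)
  · rw [h₁.zero, h₂.zero]

/-! ### Existence of the spreading wave: the orbit leaving `u = 1` reaches `u = 0` -/

/-- For `c < 2` the origin is a focus of the phase plane: a solution with `0 < u < 1` cannot
decrease for all time. Once `u` is small, the slope `ρ = u'/u` satisfies
`ρ' ≤ -(ρ + c/2)² - δ`, which forces `arctan ((ρ + c/2)/√δ)` to decrease without bound. -/
lemma not_forall_decreasing {c : ℝ} (hc : 0 ≤ c) (hc2 : c < 2) {u v : ℝ → ℝ}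
    (hu : ∀ z, HasDerivAt u (v z) z) (hv : ∀ z, HasDerivAt v (-(c * v z) - u z * (1 - u z)) z)
    (hneg : ∀ z, v z < 0) (hpos : ∀ z, 0 < u z) (hlt : ∀ z, u z < 1) : False := by
  have hanti : StrictAnti u := strictAnti_of_deriv_neg (fun z => by rw [(hu z).deriv]; exact hneg z)
  set δ : ℝ := (1 - c ^ 2 / 4) / 2 with hδ
  have hδ0 : 0 < δ := by rw [hδ]; nlinarith
  have hδ1 : δ < 1 := by rw [hδ]; nlinarith [sq_nonneg c]
  -- a function whose slope is at most `-κ < 0` on a right half-line is unbounded below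
  have drop : ∀ (g g' : ℝ → ℝ) (a κ : ℝ), 0 < κ → (∀ z ≥ a, HasDerivAt g (g' z) z) →
      (∀ z ≥ a, g' z ≤ -κ) → ∀ B, ∃ z ≥ a, g z < B := by
    intro g g' a κ hκ hg hg' B
    obtain ⟨z, hz, hz'⟩ := exists_lt_of_deriv_ge (g := fun z => g (-z)) (g' := fun z => -g' (-z))
      (b := -a) hκ (fun z hz => by
        have := (hg (-z) (by linarith)).scomp z (hasDerivAt_neg z)
        exact (this.congr_deriv (by simp)).hasDerivWithinAt)
      (fun z hz => by linarith [hg' (-z) (by linarith)]) B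
    exact ⟨-z, by linarith, hz'⟩
  have hsmall : ∃ z₀, u z₀ < δ := by
    by_contra! hle
    have hκ : 0 < δ * (1 - u 0) := mul_pos hδ0 (by linarith [hlt 0])
    obtain ⟨z1, hz1, hE⟩ := drop (fun z => v z + c * u z) (fun z => -(u z * (1 - u z))) 0
      (δ * (1 - u 0)) hκ
      (fun z _ => ((hv z).add ((hu z).const_mul c)).congr_deriv (by ring))
      (fun z hz => by
        have h1 := hle z
        have h2 := hanti.antitone hz
        have h3 := hlt 0
        nlinarith) (-1)
    have hv1 : ∀ z ≥ z1, v z ≤ -1 := by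
      intro z hz
      have hEm : Antitone (fun z => v z + c * u z) := antitone_of_deriv_nonpos
        (fun z => ((hv z).add ((hu z).const_mul c)).differentiableAt) (fun z => by
          rw [(show HasDerivAt (fun z => v z + c * u z) _ z from
            (hv z).add ((hu z).const_mul c)).deriv]
          nlinarith [mul_pos (hpos z) (sub_pos.2 (hlt z))])
      have := hEm hz
      simp only at this
      nlinarith [mul_nonneg hc (hpos z).le]
    obtain ⟨z2, _, hz2⟩ := drop u v z1 1 one_pos (fun z _ => hu z) hv1 0
    exact absurd (hpos z2) (not_lt.2 hz2.le)
  obtain ⟨z₀, hz₀⟩ := hsmall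
  have hs : 0 < √δ := Real.sqrt_pos.2 hδ0
  have hs2 : √δ ^ 2 = δ := Real.sq_sqrt hδ0.le
  obtain ⟨z, _, hz⟩ := drop (fun z => Real.arctan ((v z / u z + c / 2) / √δ)) _ z₀ (√δ) hs
    (fun z _ => ((((hv z).div (hu z) (hpos z).ne').add_const (c / 2)).div_const (√δ)).arctan)
    (fun z hz => by
      have h1 : u z < δ := (hanti.antitone hz).trans_lt hz₀
      set ρ := v z / u z with hρ
      have hvρ : v z = ρ * u z := by rw [hρ]; field_simp [(hpos z).ne']
      have hup := hpos z
      have hval : ((-(c * v z) - u z * (1 - u z)) * u z - v z * v z) / u z ^ 2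
          = -(ρ + c / 2) ^ 2 - (2 * δ - u z) := by
        rw [hvρ, hδ]; field_simp; ring
      simp only [Pi.div_apply, ← hρ]
      rw [hval, div_pow, hs2, one_div, ← div_eq_inv_mul, div_div, div_le_iff₀ (by positivity)]
      have : √δ * (1 + (ρ + c / 2) ^ 2 / δ) * √δ = δ + (ρ + c / 2) ^ 2 := by
        have : √δ * (1 + (ρ + c / 2) ^ 2 / δ) * √δ = √δ ^ 2 * (1 + (ρ + c / 2) ^ 2 / δ) := by ring
        rw [this, hs2]; field_simp
      nlinarith) (-(Real.pi / 2))
  exact absurd hz (not_lt.2 (Real.neg_pi_div_two_lt_arctan _).le)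

/-! ### Existence of the spreading wave: the unstable manifold of `u = 1` -/

/-- The cut-off `max 0 (min x 1)`. -/
def clip (x : ℝ) : ℝ := max 0 (min x 1)

lemma clip_nonneg (x : ℝ) : 0 ≤ clip x := le_max_left _ _
lemma clip_le_one (x : ℝ) : clip x ≤ 1 := max_le zero_le_one (min_le_right _ _)
lemma clip_eq_self {x : ℝ} (h0 : 0 ≤ x) (h1 : x ≤ 1) : clip x = x := by
  rw [clip, min_eq_left h1, max_eq_right h0]
lemma continuous_clip : Continuous clip := by unfold clip; fun_prop
lemma abs_clip_sub_clip_le (x y : ℝ) : |clip x - clip y| ≤ |x - y| := by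
  have h1 := abs_max_sub_max_le_abs (min x 1) (min y 1) 0
  have h2 := abs_min_sub_min_le_max x 1 y 1
  rw [max_comm, max_comm _ (0:ℝ)] at h1
  simp only [sub_self, abs_zero] at h2
  exact h1.trans (h2.trans (max_le le_rfl (abs_nonneg _)))
lemma abs_clip_sq_sub_le (x y : ℝ) : |clip x ^ 2 - clip y ^ 2| ≤ 2 * |x - y| := by
  rw [sq_sub_sq, abs_mul]
  refine mul_le_mul ?_ (abs_clip_sub_clip_le x y) (abs_nonneg _) zero_le_two
  rw [abs_of_nonneg (add_nonneg (clip_nonneg x) (clip_nonneg y))]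
  linarith [clip_le_one x, clip_le_one y]

/-- `∫_{-∞}^z e^{at} f(t) dt`. -/
noncomputable def expPrimitive (a : ℝ) (f : ℝ → ℝ) (z : ℝ) : ℝ :=
  ∫ t in Iic z, Real.exp (a * t) * f t

section expPrimitive

variable {a : ℝ} {f : ℝ → ℝ}

lemma integrableOn_exp_mul (ha : 0 < a) (hf : Continuous f) (h0 : ∀ t, |f t| ≤ 1) (z : ℝ) :
    IntegrableOn (fun t => Real.exp (a * t) * f t) (Iic z) := by
  refine Integrable.mono' (integrableOn_exp_mul_Iic ha z)
    (by fun_prop) (Eventually.of_forall fun t => ?_)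
  rw [norm_mul, Real.norm_of_nonneg (Real.exp_pos _).le, Real.norm_eq_abs]
  exact mul_le_of_le_one_right (Real.exp_pos _).le (h0 t)

lemma hasDerivAt_expPrimitive (ha : 0 < a) (hf : Continuous f) (h0 : ∀ t, |f t| ≤ 1) (z : ℝ) :
    HasDerivAt (expPrimitive a f) (Real.exp (a * z) * f z) z := by
  have hcont : Continuous (fun t => Real.exp (a * t) * f t) := by fun_prop
  have h1 : HasDerivAt (fun x => ∫ t in (0:ℝ)..x, Real.exp (a * t) * f t)
      (Real.exp (a * z) * f z) z :=
    intervalIntegral.integral_hasDerivAt_right (hcont.intervalIntegrable _ _)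
      (hcont.stronglyMeasurableAtFilter _ _) hcont.continuousAt
  refine (h1.const_add (expPrimitive a f 0)).congr_of_eventuallyEq
    (Eventually.of_forall fun x => ?_)
  have := intervalIntegral.integral_Iic_sub_Iic (integrableOn_exp_mul ha hf h0 0)
    (integrableOn_exp_mul ha hf h0 x)
  simp only [expPrimitive]
  linarith

lemma expPrimitive_nonneg (h0 : ∀ t, 0 ≤ f t) (z : ℝ) : 0 ≤ expPrimitive a f z :=
  integral_nonneg fun t => mul_nonneg (Real.exp_pos _).le (h0 t)

lemma expPrimitive_le (ha : 0 < a) (hf : Continuous f) (h0 : ∀ t, |f t| ≤ 1) (z : ℝ) :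
    expPrimitive a f z ≤ Real.exp (a * z) / a := by
  rw [← integral_exp_mul_Iic ha z]
  refine setIntegral_mono_on (integrableOn_exp_mul ha hf h0 z) (integrableOn_exp_mul_Iic ha z)
    measurableSet_Iic fun t _ => ?_
  exact mul_le_of_le_one_right (Real.exp_pos _).le ((le_abs_self _).trans (h0 t))

lemma exp_mul_expPrimitive_le {κ : ℝ} (ha : 0 < a) (hκ : 0 < κ) (hf : Continuous f)
    (h0 : ∀ t, |f t| ≤ 1) (hn : ∀ t, 0 ≤ f t) (z : ℝ) :
    Real.exp (-(κ * z)) * expPrimitive (κ + a) f z ≤ expPrimitive a f z := by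
  unfold expPrimitive
  rw [← integral_const_mul]
  refine setIntegral_mono_on ((integrableOn_exp_mul (by positivity) hf h0 z).const_mul _)
    (integrableOn_exp_mul ha hf h0 z) measurableSet_Iic fun t ht => ?_
  rw [← mul_assoc, ← Real.exp_add]
  refine mul_le_mul_of_nonneg_right (Real.exp_le_exp.2 ?_) (hn t)
  have : κ * t ≤ κ * z := mul_le_mul_of_nonneg_left ht hκ.le
  linarith

end expPrimitive

/-- The orbit leaving the saddle `u = 1` in the form `1 - u = e^{μz} w(z)`: the integral equation
for `w`, with the nonlinearity cut off outside `0 ≤ w ≤ 1`, has a solution on the whole line. In the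
supremum norm weighted by `exp (-N e^{μz})` the integral operator is a contraction. -/
lemma exists_profile_fixedPoint {μ κ : ℝ} (hμ : 0 < μ) (hκ : 0 < κ) :
    ∃ w : ℝ → ℝ, Continuous w ∧ ∀ z, w z = 1 - (expPrimitive μ (fun t => clip (w t) ^ 2) z
      - Real.exp (-(κ * z)) * expPrimitive (κ + μ) (fun t => clip (w t) ^ 2) z) / κ := by
  set N : ℝ := 4 / (κ * μ) with hN
  have hN0 : 0 < N := by positivity
  set q : ℝ → ℝ := fun z => Real.exp (N * Real.exp (μ * z)) with hq
  have hqc : Continuous q := by rw [hq]; fun_prop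
  have hq0 : ∀ z, 0 < q z := fun z => Real.exp_pos _
  have hqmono : Monotone q := fun x y hxy => Real.exp_le_exp.2
    (mul_le_mul_of_nonneg_left (Real.exp_le_exp.2 (mul_le_mul_of_nonneg_left hxy hμ.le)) hN0.le)
  set F : (BoundedContinuousFunction ℝ ℝ) → ℝ → ℝ := fun ω t => clip (q t * ω t) ^ 2 with hF
  have hFc : ∀ ω, Continuous (F ω) := fun ω => by
    have := continuous_clip
    rw [hF]; fun_prop
  have hFn : ∀ ω t, 0 ≤ F ω t := fun ω t => sq_nonneg _
  have hF1 : ∀ ω t, |F ω t| ≤ 1 := fun ω t => by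
    rw [abs_of_nonneg (hFn ω t)]
    exact pow_le_one₀ (clip_nonneg _) (clip_le_one _)
  have hκμ : 0 < κ + μ := by positivity
  set J : (BoundedContinuousFunction ℝ ℝ) → ℝ → ℝ := fun ω z =>
    expPrimitive μ (F ω) z - Real.exp (-(κ * z)) * expPrimitive (κ + μ) (F ω) z with hJ
  have hJc : ∀ ω, Continuous (J ω) := fun ω => by
    have h1 : Continuous (expPrimitive μ (F ω)) := continuous_iff_continuousAt.2 fun z =>
      (hasDerivAt_expPrimitive hμ (hFc ω) (hF1 ω) z).continuousAt
    have h2 : Continuous (expPrimitive (κ + μ) (F ω)) := continuous_iff_continuousAt.2 fun z =>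
      (hasDerivAt_expPrimitive hκμ (hFc ω) (hF1 ω) z).continuousAt
    rw [hJ]; fun_prop
  have hJ0 : ∀ ω z, 0 ≤ J ω z := fun ω z =>
    sub_nonneg.2 (exp_mul_expPrimitive_le hμ hκ (hFc ω) (hF1 ω) (hFn ω) z)
  have hJ1 : ∀ ω z, J ω z ≤ Real.exp (μ * z) / μ := fun ω z =>
    (sub_le_self _ (mul_nonneg (Real.exp_pos _).le (expPrimitive_nonneg (hFn ω) z))).trans
      (expPrimitive_le hμ (hFc ω) (hF1 ω) z)
  have hbound : ∀ ω z, ‖(q z)⁻¹ * (1 - J ω z / κ)‖ ≤ 1 := by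
    intro ω z
    rw [norm_mul, norm_inv, Real.norm_of_nonneg (hq0 z).le, ← div_eq_inv_mul,
      div_le_one (hq0 z), Real.norm_eq_abs]
    have h1 : 1 + N * Real.exp (μ * z) ≤ q z := by
      have := Real.add_one_le_exp (N * Real.exp (μ * z))
      simp only [hq]; linarith
    have h2 : J ω z / κ ≤ N * Real.exp (μ * z) := by
      rw [div_le_iff₀ hκ]
      refine (hJ1 ω z).trans ?_
      rw [hN, div_le_iff₀ hμ]
      have : 4 / (κ * μ) * Real.exp (μ * z) * κ * μ = 4 * Real.exp (μ * z) := by field_simp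
      rw [this]
      linarith [Real.exp_pos (μ * z)]
    have h3 : 0 ≤ J ω z / κ := div_nonneg (hJ0 ω z) hκ.le
    rw [abs_le]
    constructor <;> linarith [Real.exp_pos (μ * z)]
  set Φ : (BoundedContinuousFunction ℝ ℝ) → (BoundedContinuousFunction ℝ ℝ) := fun ω =>
    BoundedContinuousFunction.ofNormedAddCommGroup (fun z => (q z)⁻¹ * (1 - J ω z / κ))
      ((hqc.inv₀ fun z => (hq0 z).ne').mul (continuous_const.sub ((hJc ω).div_const κ))) 1
      (hbound ω) with hΦ
  have hint : ∀ z, IntegrableOn (fun t => Real.exp (μ * t) * q t) (Iic z) := by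
    intro z
    refine Integrable.mono' ((integrableOn_exp_mul_Iic hμ z).mul_const (q z))
      (by fun_prop) ((ae_restrict_iff' measurableSet_Iic).2 (Eventually.of_forall fun t ht => ?_))
    rw [norm_mul, Real.norm_of_nonneg (Real.exp_pos _).le, Real.norm_of_nonneg (hq0 t).le]
    exact mul_le_mul_of_nonneg_left (hqmono ht) (Real.exp_pos _).le
  have hintval : ∀ z, ∫ t in Iic z, Real.exp (μ * t) * q t = (q z - 1) / (N * μ) := by
    intro z
    have hd : ∀ t, HasDerivAt (fun t => q t / (N * μ)) (Real.exp (μ * t) * q t) t := by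
      intro t
      have h1 : HasDerivAt (fun t => Real.exp (μ * t)) (Real.exp (μ * t) * (μ * 1)) t :=
        ((hasDerivAt_id t).const_mul μ).exp
      refine ((h1.const_mul N).exp.div_const (N * μ)).congr_deriv ?_
      simp only [hq]; field_simp
    have hl : Tendsto (fun t => q t / (N * μ)) atBot (𝓝 (1 / (N * μ))) := by
      have h1 : Tendsto (fun t => Real.exp (μ * t)) atBot (𝓝 0) :=
        Real.tendsto_exp_atBot.comp (tendsto_id.const_mul_atBot hμ)
      have h2 := ((h1.const_mul N).rexp).div_const (N * μ)
      simpa using h2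
    rw [integral_Iic_of_hasDerivAt_of_tendsto' (fun t _ => hd t) (hint z) hl, sub_div]
  have hcontr : ContractingWith (1 / 2) Φ := by
    refine ⟨by norm_num, LipschitzWith.of_dist_le_mul fun ω₁ ω₂ => ?_⟩
    refine (BoundedContinuousFunction.dist_le (by positivity)).2 fun z => ?_
    have hJd : |J ω₁ z - J ω₂ z| ≤ 2 * dist ω₁ ω₂ * ((q z - 1) / (N * μ)) := by
      have e1 : J ω₁ z - J ω₂ z = ∫ t in Iic z,
          (Real.exp (μ * t) - Real.exp (-(κ * z)) * Real.exp ((κ + μ) * t)) *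
            (F ω₁ t - F ω₂ t) := by
        have i1 := fun ω => integrableOn_exp_mul hμ (hFc ω) (hF1 ω) z
        have i2 := fun ω => (integrableOn_exp_mul hκμ (hFc ω) (hF1 ω) z).const_mul
          (Real.exp (-(κ * z)))
        have i3 : ∀ ω, Integrable (fun t => Real.exp (μ * t) * F ω t
            - Real.exp (-(κ * z)) * (Real.exp ((κ + μ) * t) * F ω t)) (volume.restrict (Iic z)) :=
          fun ω => (i1 ω).sub (i2 ω)
        simp only [hJ, expPrimitive, ← integral_const_mul]
        rw [← integral_sub (i1 _) (i2 _), ← integral_sub (i1 _) (i2 _),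
          ← integral_sub (i3 _) (i3 _)]
        congr 1; ext t; ring
      rw [e1, ← hintval, ← integral_const_mul, ← Real.norm_eq_abs]
      refine norm_integral_le_of_norm_le ((hint z).const_mul _)
        ((ae_restrict_iff' measurableSet_Iic).2 (Eventually.of_forall fun t ht => ?_))
      have hk0 : 0 ≤ Real.exp (μ * t) - Real.exp (-(κ * z)) * Real.exp ((κ + μ) * t) := by
        rw [← Real.exp_add, sub_nonneg, Real.exp_le_exp]
        have : κ * t ≤ κ * z := mul_le_mul_of_nonneg_left ht hκ.le
        linarith
      have hk1 : Real.exp (μ * t) - Real.exp (-(κ * z)) * Real.exp ((κ + μ) * t)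
          ≤ Real.exp (μ * t) := sub_le_self _ (by positivity)
      have hFd : |F ω₁ t - F ω₂ t| ≤ 2 * (q t * dist ω₁ ω₂) := by
        refine (abs_clip_sq_sub_le _ _).trans ?_
        rw [← mul_sub, abs_mul, abs_of_pos (hq0 t), ← Real.dist_eq]
        have := BoundedContinuousFunction.dist_coe_le_dist (f := ω₁) (g := ω₂) t
        have := mul_le_mul_of_nonneg_left this (hq0 t).le
        linarith
      rw [norm_mul, Real.norm_of_nonneg hk0, Real.norm_eq_abs]
      calc _ ≤ Real.exp (μ * t) * (2 * (q t * dist ω₁ ω₂)) :=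
            mul_le_mul hk1 hFd (abs_nonneg _) (Real.exp_pos _).le
        _ = _ := by ring
    have hdz : dist (Φ ω₁ z) (Φ ω₂ z) = (q z)⁻¹ * (|J ω₁ z - J ω₂ z| / κ) := by
      have : Φ ω₁ z - Φ ω₂ z = -((q z)⁻¹ * ((J ω₁ z - J ω₂ z) / κ)) := by
        simp only [hΦ, BoundedContinuousFunction.coe_ofNormedAddCommGroup]; ring
      rw [Real.dist_eq, this, abs_neg, abs_mul, abs_inv, abs_of_pos (hq0 z), abs_div,
        abs_of_pos hκ]
    rw [hdz, ← div_eq_inv_mul, div_le_iff₀ (hq0 z), div_le_iff₀ hκ]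
    refine hJd.trans ?_
    have : N * μ = 4 / κ := by rw [hN]; field_simp
    rw [this]
    have hd0 : 0 ≤ dist ω₁ ω₂ := dist_nonneg
    have : 2 * dist ω₁ ω₂ * ((q z - 1) / (4 / κ)) = dist ω₁ ω₂ * (q z - 1) * κ / 2 := by
      field_simp; ring
    rw [this]
    push_cast
    nlinarith [mul_nonneg hd0 hκ.le]
  have hfix := hcontr.fixedPoint_isFixedPt
  set ω := hcontr.fixedPoint Φ with hω
  refine ⟨fun z => q z * ω z, hqc.mul ω.continuous, fun z => ?_⟩
  have h1 : ω z = (q z)⁻¹ * (1 - J ω z / κ) := by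
    conv_lhs => rw [← hfix.eq]
    rfl
  have h2 : q z * ω z = 1 - J ω z / κ := by
    rw [h1, ← mul_assoc, mul_inv_cancel₀ (hq0 z).ne', one_mul]
  exact h2

/-- The orbit leaving the saddle `u = 1` downwards, in terms of `y = 1 - u` and `x = y'`. The
nonlinearity `y²` is cut off outside `0 ≤ y ≤ e^{μz}`. Here `μ` and `-ν = -(μ + c)` are the
eigenvalues of the saddle, and `y` is given by variation of constants. -/
lemma exists_unstable_orbit (c : ℝ) (hc : 0 ≤ c) :
    ∃ y x g : ℝ → ℝ, (∀ z, HasDerivAt y (x z) z) ∧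
      (∀ z, HasDerivAt x (-(c * x z) + y z - g z) z) ∧ (∀ z, 0 ≤ y z → g z = y z ^ 2) ∧
      Tendsto y atBot (𝓝 0) ∧ Tendsto x atBot (𝓝 0) ∧ ∀ᶠ z in atBot, 0 < x z := by
  obtain ⟨μ, hμ0, hμ⟩ : ∃ μ : ℝ, 0 < μ ∧ μ ^ 2 + c * μ = 1 := by
    have hs := Real.sq_sqrt (show 0 ≤ c ^ 2 + 4 by positivity)
    have hs0 := Real.sqrt_nonneg (c ^ 2 + 4)
    refine ⟨(√(c ^ 2 + 4) - c) / 2, ?_, by nlinarith⟩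
    have : c < √(c ^ 2 + 4) := Real.lt_sqrt_of_sq_lt (by linarith)
    linarith
  obtain ⟨ν, hν⟩ : ∃ ν : ℝ, ν = μ + c := ⟨_, rfl⟩
  have hν0 : 0 < ν := by linarith
  have hν2 : ν ^ 2 - c * ν = 1 := by
    rw [hν]
    linear_combination hμ
  obtain ⟨κ, hκ⟩ : ∃ κ : ℝ, κ = μ + ν := ⟨_, rfl⟩
  have hκ0 : 0 < κ := by linarith
  obtain ⟨w, hwc, hw⟩ := exists_profile_fixedPoint hμ0 hκ0
  set f : ℝ → ℝ := fun t => clip (w t) ^ 2 with hf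
  have hfc : Continuous f := by have := continuous_clip; rw [hf]; fun_prop
  have hfn : ∀ t, 0 ≤ f t := fun t => sq_nonneg _
  have hf1 : ∀ t, |f t| ≤ 1 := fun t => by
    rw [abs_of_nonneg (hfn t)]; exact pow_le_one₀ (clip_nonneg _) (clip_le_one _)
  have hκμ : 0 < κ + μ := by positivity
  set I₁ := expPrimitive μ f with hI1
  set I₂ := expPrimitive (κ + μ) f with hI2
  have d1 := hasDerivAt_expPrimitive hμ0 hfc hf1
  have d2 := hasDerivAt_expPrimitive hκμ hfc hf1
  have dE : ∀ z, HasDerivAt (fun z => Real.exp (μ * z)) (Real.exp (μ * z) * (μ * 1)) z :=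
    fun z => ((hasDerivAt_id z).const_mul μ).exp
  have dB : ∀ z, HasDerivAt (fun z => Real.exp (-ν * z)) (Real.exp (-ν * z) * (-ν * 1)) z :=
    fun z => ((hasDerivAt_id z).const_mul (-ν)).exp
  have hEB : ∀ z, Real.exp (-ν * z) * Real.exp ((κ + μ) * z) =
      Real.exp (μ * z) * Real.exp (μ * z) := by
    intro z; rw [← Real.exp_add, ← Real.exp_add, hκ]; congr 1; ring
  have hBE : ∀ z, Real.exp (-ν * z) = Real.exp (μ * z) * Real.exp (-(κ * z)) := by
    intro z; rw [← Real.exp_add, hκ]; congr 1; ring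
  have hIle : ∀ z, Real.exp (-(κ * z)) * I₂ z ≤ I₁ z :=
    exp_mul_expPrimitive_le hμ0 hκ0 hfc hf1 hfn
  have hI1n : ∀ z, 0 ≤ I₁ z := expPrimitive_nonneg hfn
  have hI2n : ∀ z, 0 ≤ Real.exp (-(κ * z)) * I₂ z := fun z =>
    mul_nonneg (Real.exp_pos _).le (expPrimitive_nonneg hfn z)
  have hElim : Tendsto (fun t => Real.exp (μ * t)) atBot (𝓝 0) :=
    Real.tendsto_exp_atBot.comp (tendsto_id.const_mul_atBot hμ0)
  have hI1lim : Tendsto I₁ atBot (𝓝 0) :=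
    squeeze_zero hI1n (expPrimitive_le hμ0 hfc hf1) (by simpa using hElim.div_const μ)
  have hI2lim : Tendsto (fun z => Real.exp (-(κ * z)) * I₂ z) atBot (𝓝 0) :=
    squeeze_zero hI2n hIle hI1lim
  have hyw : ∀ z, Real.exp (μ * z) - (Real.exp (μ * z) * I₁ z - Real.exp (-ν * z) * I₂ z) / κ
      = Real.exp (μ * z) * w z := by
    intro z; rw [hw z, hBE]; ring
  have hxw : ∀ z, μ * Real.exp (μ * z) -
      (μ * (Real.exp (μ * z) * I₁ z) + ν * (Real.exp (-ν * z) * I₂ z)) / κ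
      = Real.exp (μ * z) * (μ - (μ * I₁ z + ν * (Real.exp (-(κ * z)) * I₂ z)) / κ) := by
    intro z; rw [hBE]; ring
  have hwlim : Tendsto w atBot (𝓝 1) := by
    have := ((hI1lim.sub hI2lim).div_const κ).const_sub 1
    simp only [sub_zero, zero_div] at this
    exact this.congr fun z => (hw z).symm
  have hxlim : Tendsto (fun z => μ - (μ * I₁ z + ν * (Real.exp (-(κ * z)) * I₂ z)) / κ) atBot
      (𝓝 μ) := by
    have := (((hI1lim.const_mul μ).add (hI2lim.const_mul ν)).div_const κ).const_sub μ
    simpa using this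
  refine ⟨fun z => Real.exp (μ * z) - (Real.exp (μ * z) * I₁ z - Real.exp (-ν * z) * I₂ z) / κ,
    fun z => μ * Real.exp (μ * z) -
      (μ * (Real.exp (μ * z) * I₁ z) + ν * (Real.exp (-ν * z) * I₂ z)) / κ,
    fun z => Real.exp (μ * z) * Real.exp (μ * z) * f z, fun z => ?_, fun z => ?_, fun z hz => ?_,
    ?_, ?_, ?_⟩
  · refine ((dE z).sub ((((dE z).mul (d1 z)).sub ((dB z).mul (d2 z))).div_const κ)).congr_deriv ?_
    have h1 := hEB z
    beta_reduce
    generalize Real.exp (-ν * z) = B at h1 ⊢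
    generalize Real.exp ((κ + μ) * z) = D at h1 ⊢
    generalize Real.exp (μ * z) = E at h1 ⊢
    field_simp
    linear_combination f z * h1
  · refine (((dE z).const_mul μ).sub (((((dE z).mul (d1 z)).const_mul μ).add
      (((dB z).mul (d2 z)).const_mul ν)).div_const κ)).congr_deriv ?_
    have h1 := hEB z
    beta_reduce
    generalize Real.exp (-ν * z) = B at h1 ⊢
    generalize Real.exp ((κ + μ) * z) = D at h1 ⊢
    generalize Real.exp (μ * z) = E at h1 ⊢
    field_simp
    rw [← hI1, ← hI2]
    linear_combination (E * κ - E * I₁ z) * hμ + (B * I₂ z) * hν2 - ν * f z * h1 + E ^ 2 * f z * hκ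
  · simp only [hyw] at hz ⊢
    have hw0 : 0 ≤ w z := nonneg_of_mul_nonneg_right hz (Real.exp_pos _)
    have hw1 : w z ≤ 1 := by
      rw [hw z]
      have := div_nonneg (sub_nonneg.2 (hIle z)) hκ0.le
      linarith
    rw [hf]
    simp only [clip_eq_self hw0 hw1]
    ring
  · simp only [hyw]
    simpa using hElim.mul hwlim
  · simp only [hxw]
    simpa using hElim.mul hxlim
  · simp only [hxw]
    filter_upwards [hxlim.eventually (lt_mem_nhds hμ0)] with z hz
    exact mul_pos (Real.exp_pos _) hz

theorem exists_isSpreadingWave {c : ℝ} (hc : 0 ≤ c) (hc2 : c < 2) : ∃ u, IsSpreadingWave c u := by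
  obtain ⟨y, x, g, hy, hx, hg, hyl, hxl, hxpos⟩ := exists_unstable_orbit c hc
  have hyc : Continuous y := continuous_iff_continuousAt.2 fun z => (hy z).continuousAt
  have hxc : Continuous x := continuous_iff_continuousAt.2 fun z => (hx z).continuousAt
  -- as long as `x > 0` the orbit stays in `y > 0`, where the cut-off is not active
  have hypos : ∀ b, (∀ z < b, 0 < x z) → ∀ z ≤ b, 0 < y z := by
    intro b hb z hz
    have hm : StrictMonoOn y (Iic b) := strictMonoOn_Iic (fun z _ => (hy z).hasDerivWithinAt) hb
    have h1 := hm.monotoneOn.le_of_tendsto_atBot hyl (z := z - 1) (by linarith)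
    exact h1.trans_lt (hm (show z - 1 ∈ Iic b by simp; linarith) hz (by linarith))
  set S : Set ℝ := {z | x z ≤ 0} ∪ {z | 1 ≤ y z} with hS
  have hScl : IsClosed S :=
    (isClosed_le hxc continuous_const).union (isClosed_le continuous_const hyc)
  obtain ⟨z₀, hz₀⟩ := (hxpos.and (hyl.eventually (gt_mem_nhds one_pos))).exists_forall_of_atBot
  have hSb : BddBelow S := by
    refine ⟨z₀, fun s hs => ?_⟩
    by_contra! hlt
    have := hz₀ s hlt.le
    rcases hs with hs | hs
    · exact absurd this.1 (not_lt.2 hs)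
    · exact absurd this.2 (not_lt.2 hs)
  rcases S.eq_empty_or_nonempty with hemp | hne
  · have hall : ∀ z, 0 < x z ∧ y z < 1 := by
      intro z
      have : z ∉ S := by rw [hemp]; exact fun h => h
      simp only [hS, mem_union, mem_ofPred_eq, not_or, not_le] at this
      exact this
    have hy0 : ∀ z, 0 < y z := fun z => hypos z (fun z _ => (hall z).1) z le_rfl
    refine (not_forall_decreasing hc hc2 (u := fun z => 1 - y z) (v := fun z => -x z)
      (fun z => (hy z).const_sub 1) (fun z => (hx z).neg.congr_deriv ?_)
      (fun z => by linarith [(hall z).1]) (fun z => by linarith [(hall z).2])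
      (fun z => by linarith [hy0 z])).elim
    rw [hg z (hy0 z).le]; ring
  · have hmem := hScl.csInf_mem hne hSb
    set b := sInf S with hb
    have hbef : ∀ z < b, 0 < x z ∧ y z < 1 := by
      intro z hz
      have : z ∉ S := fun h => absurd (csInf_le hSb h) (not_le.2 hz)
      simp only [hS, mem_union, mem_ofPred_eq, not_or, not_le] at this
      exact this
    have hy0 := hypos b (fun z hz => (hbef z hz).1)
    have hxb : 0 < x b := by
      have hm : StrictMonoOn (fun z => Real.exp (c * z) * x z) (Iic b) :=
        strictMonoOn_Iic (fun z _ => WaveData.hasDerivWithinAt_exp_mul (hx z).hasDerivWithinAt)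
          (fun z hz => by
            have h1 := hy0 z hz.le
            have h2 := (hbef z hz).2
            rw [hg z h1.le]
            refine mul_pos (Real.exp_pos _) ?_
            nlinarith)
      have h1 := hm (show b - 1 ∈ Iic b by simp) (show b ∈ Iic b by simp) (by linarith)
      have h2 : 0 < Real.exp (c * (b - 1)) * x (b - 1) :=
        mul_pos (Real.exp_pos _) (hbef _ (by linarith)).1
      exact pos_of_mul_pos_right (h2.trans h1) (Real.exp_pos _).le
    have hyb : y b = 1 := by
      refine le_antisymm ?_ ?_
      · refine le_of_tendsto (hyc.continuousAt.continuousWithinAt (s := Iio b)) ?_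
        filter_upwards [self_mem_nhdsWithin] with z hz using (hbef z hz).2.le
      · rcases hmem with h | h
        · exact absurd hxb (not_lt.2 h)
        · exact h
    have hshift : Tendsto (fun z => z + b) atBot atBot :=
      tendsto_atBot_add_const_right _ _ tendsto_id
    have hdy : ∀ z, HasDerivAt (fun z => y (z + b)) (x (z + b)) z := fun z =>
      (hy (z + b)).comp_add_const z b
    refine ⟨fun z => 1 - y (z + b), fun z hz => ?_, ?_, by simp [hyb], fun z => -x (z + b),
      fun z hz => ((hdy z).const_sub 1).hasDerivWithinAt, fun z hz => ?_, ?_⟩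
    · linarith [(hbef (z + b) (by linarith)).2]
    · have hm : StrictMonoOn (fun z => y (z + b)) (Iic 0) :=
        strictMonoOn_Iic (fun z _ => (hdy z).hasDerivWithinAt)
          (fun z hz => (hbef (z + b) (by linarith)).1)
      intro p hp q hq hpq
      have := hm hp hq hpq
      simp only at this ⊢
      linarith
    · refine (((hx (z + b)).comp_add_const z b).neg.congr_deriv ?_).hasDerivWithinAt
      rw [hg _ (hy0 (z + b) (by linarith)).le]; ring
    · simpa using (hxl.comp hshift).neg

/-! ### Products of absolutely continuous functions -/

lemma absolutelyContinuousOnInterval_integral {f : ℝ → ℂ} {a b : ℝ}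
    (hf : IntervalIntegrable f volume a b) :
    AbsolutelyContinuousOnInterval (fun x => ∫ t in a..x, f t) a b := by
  have hn := hf.norm.absolutelyContinuousOnInterval_intervalIntegral (c := a) left_mem_uIcc
  rw [absolutelyContinuousOnInterval_iff] at hn ⊢
  intro ε hε
  obtain ⟨δ, hδ, h⟩ := hn ε hε
  refine ⟨δ, hδ, fun E hE hlen => (Finset.sum_le_sum fun i hi => ?_).trans_lt (h E hE hlen)⟩
  obtain ⟨h1, h2⟩ := hE.1 i hi
  have i1 := hf.mono_set (uIcc_subset_uIcc left_mem_uIcc h1)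
  have i2 := hf.mono_set (uIcc_subset_uIcc left_mem_uIcc h2)
  rw [dist_eq_norm, Real.dist_eq, intervalIntegral.integral_interval_sub_left i1 i2,
    intervalIntegral.integral_interval_sub_left i1.norm i2.norm]
  exact intervalIntegral.norm_integral_le_abs_integral_norm

/-- The product rule for functions that are integrals of their derivatives. -/
lemma mul_sub_mul_eq_integral {F G f g : ℝ → ℂ} {a b : ℝ}
    (hf : IntervalIntegrable f volume a b) (hg : IntervalIntegrable g volume a b)
    (hF : ∀ x ∈ uIcc a b, F x - F a = ∫ t in a..x, f t)
    (hG : ∀ x ∈ uIcc a b, G x - G a = ∫ t in a..x, g t) :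
    F b * G b - F a * G a = ∫ z in a..b, (f z * G z + F z * g z) := by
  have hFac := absolutelyContinuousOnInterval_integral hf
  have hGac := absolutelyContinuousOnInterval_integral hg
  have hconst : ∀ k : ℂ, AbsolutelyContinuousOnInterval (fun _ : ℝ => k) a b := fun k =>
    (LipschitzWith.const k (α := ℝ)).lipschitzOnWith.absolutelyContinuousOnInterval
  have hF' := (hconst (F a)).add hFac
  have hG' := (hconst (G a)).add hGac
  have hFc : ContinuousOn F (uIcc a b) := hF'.continuousOn.congr fun x hx => by
    simp only [Pi.add_apply]; rw [← hF x hx]; ring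
  have hGc : ContinuousOn G (uIcc a b) := hG'.continuousOn.congr fun x hx => by
    simp only [Pi.add_apply]; rw [← hG x hx]; ring
  have hint : IntervalIntegrable (fun z => f z * G z + F z * g z) volume a b :=
    (hf.mul_continuousOn hGc).add (hg.continuousOn_mul hFc)
  have hD := (hF'.smul hG').sub (absolutelyContinuousOnInterval_integral hint)
  obtain ⟨C, hC⟩ := hD.const_of_ae_hasDerivAt_zero (by
    filter_upwards [hf.ae_hasDerivAt_integral, hg.ae_hasDerivAt_integral,
      hint.ae_hasDerivAt_integral] with x h1 h2 h3 hx
    have e1 := (h1 hx a left_mem_uIcc).const_add (F a)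
    have e2 := (h2 hx a left_mem_uIcc).const_add (G a)
    refine ((e1.mul e2).sub (h3 hx a left_mem_uIcc)).congr_deriv ?_
    rw [← hF x hx, ← hG x hx]
    ring)
  have ha := hC a left_mem_uIcc
  have hb := hC b right_mem_uIcc
  simp only [Pi.sub_apply, smul_eq_mul, Pi.mul_apply, Pi.add_apply, intervalIntegral.integral_same,
    add_zero, sub_zero] at ha hb
  rw [← hF b right_mem_uIcc, ← hG b right_mem_uIcc] at hb
  linear_combination hb - ha

lemma hasDerivAt_cexp_mul (ν : ℂ) (z : ℝ) :
    HasDerivAt (fun z : ℝ => Complex.exp (ν * z)) (ν * Complex.exp (ν * z)) z := by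
  have h1 : HasDerivAt (fun z : ℝ => ν * (z : ℂ)) (ν * 1) z :=
    (Complex.ofRealCLM.hasDerivAt (x := z)).const_mul ν
  exact (h1.cexp).congr_deriv (by ring)

lemma HasL2Deriv.mul_sub_mul {F e e' : ℝ → ℂ} {f : L2Neg} (hF : HasL2Deriv F f)
    (he : ∀ z, HasDerivAt e (e' z) z) (hc : Continuous e') {a b : ℝ} (ha : a ≤ 0) (hb : b ≤ 0) :
    e b * F b - e a * F a = ∫ z in a..b, (e' z * F z + e z * f z) := by
  refine mul_sub_mul_eq_integral (hc.intervalIntegrable _ _)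
    (HasL2Deriv.intervalIntegrable f ha hb) (fun x _ => ?_) (fun x hx => hF a ha x ?_)
  · rw [intervalIntegral.integral_eq_sub_of_hasDerivAt (fun z _ => he z)
      (hc.intervalIntegrable _ _)]
  · rw [mem_uIcc] at hx
    rcases hx with hx | hx <;> linarith [hx.1, hx.2]

/-! ### Bounded operators on `L²` -/

/-- Lebesgue measure on `(-∞, 0)`. -/
noncomputable abbrev volNeg : Measure ℝ := volume.restrict (Iio (0 : ℝ))

lemma eLpNorm_two_sq {α : Type*} {m : MeasurableSpace α} (μ : Measure α) (f : α → ℂ) :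
    eLpNorm f 2 μ ^ 2 = ∫⁻ z, ‖f z‖ₑ ^ 2 ∂μ := by
  have := eLpNorm_nnreal_pow_eq_lintegral (μ := μ) (f := f) (p := 2) (by norm_num)
  norm_cast at this ⊢
  simpa using this

/-- A pointwise formula that is linear and bounded in `L²` up to null sets defines a bounded
operator. -/
lemma exists_clm (Φ : L2Neg → ℝ → ℂ) {C : ℝ} (hC : 0 ≤ C)
    (hmeas : ∀ f, AEStronglyMeasurable (Φ f) volNeg)
    (hbd : ∀ f, ∫⁻ z, ‖Φ f z‖ₑ ^ 2 ∂volNeg ≤ ENNReal.ofReal C ^ 2 * ∫⁻ z, ‖f z‖ₑ ^ 2 ∂volNeg)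
    (hadd : ∀ f g, Φ (f + g) =ᵐ[volNeg] fun z => Φ f z + Φ g z)
    (hsmul : ∀ (a : ℂ) f, Φ (a • f) =ᵐ[volNeg] fun z => a * Φ f z) :
    ∃ K : L2Neg →L[ℂ] L2Neg, ‖K‖ ≤ C ∧ ∀ f, K f =ᵐ[volNeg] Φ f := by
  have hle : ∀ f, eLpNorm (Φ f) 2 volNeg ≤ ENNReal.ofReal C * eLpNorm f 2 volNeg := by
    intro f
    have := hbd f
    rw [← eLpNorm_two_sq, ← eLpNorm_two_sq, ← mul_pow] at this
    exact (ENNReal.pow_le_pow_left_iff two_ne_zero).1 this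
  have hmem : ∀ f, MemLp (Φ f) 2 volNeg := fun f =>
    ⟨hmeas f, (hle f).trans_lt (ENNReal.mul_lt_top ENNReal.ofReal_lt_top (Lp.eLpNorm_lt_top f))⟩
  let L : L2Neg →ₗ[ℂ] L2Neg :=
    { toFun := fun f => (hmem f).toLp
      map_add' := fun f g => by
        rw [← MemLp.toLp_add]
        exact MemLp.toLp_congr _ _ (hadd f g)
      map_smul' := fun a f => by
        rw [RingHom.id_apply, ← MemLp.toLp_const_smul]
        exact MemLp.toLp_congr _ _ (hsmul a f) }
  refine ⟨L.mkContinuous C fun f => ?_, L.mkContinuous_norm_le hC _, fun f => (hmem f).coeFn_toLp⟩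
  change ‖(hmem f).toLp‖ ≤ C * ‖f‖
  rw [Lp.norm_toLp, Lp.norm_def]
  have := ENNReal.toReal_mono (ENNReal.mul_ne_top ENNReal.ofReal_ne_top
    (Lp.eLpNorm_ne_top f)) (hle f)
  rwa [ENNReal.toReal_mul, ENNReal.toReal_ofReal hC] at this

/-- Multiplication by a bounded function. -/
lemma exists_mulOp {m : ℝ → ℂ} (hm : AEStronglyMeasurable m volNeg) {C : ℝ} (hC : 0 ≤ C)
    (hmC : ∀ z < 0, ‖m z‖ ≤ C) :
    ∃ K : L2Neg →L[ℂ] L2Neg, ‖K‖ ≤ C ∧ ∀ f : L2Neg, K f =ᵐ[volNeg] fun z => m z * f z := by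
  refine exists_clm (fun f z => m z * f z) hC (fun f => hm.mul (Lp.aestronglyMeasurable f))
    (fun f => ?_) (fun f g => ?_) (fun a f => ?_)
  · rw [← lintegral_const_mul' _ _ (by finiteness)]
    refine lintegral_mono_ae ((ae_restrict_iff' measurableSet_Iio).2
      (Eventually.of_forall fun z hz => ?_))
    rw [enorm_mul, mul_pow]
    gcongr
    rw [← ofReal_norm]
    exact ENNReal.ofReal_le_ofReal (hmC z hz)
  · filter_upwards [Lp.coeFn_add f g] with z hz
    rw [hz, Pi.add_apply]; ring
  · filter_upwards [Lp.coeFn_smul a f] with z hz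
    rw [hz, Pi.smul_apply, smul_eq_mul]; ring

lemma integrable_exp_neg_abs {δ : ℝ} (hδ : 0 < δ) (z : ℝ) :
    Integrable (fun t => Real.exp (-δ * |z - t|)) := by
  have h0 : Integrable (fun t => Real.exp (-δ * |t|)) := by
    rw [← integrableOn_univ, ← Iic_union_Ioi (a := (0 : ℝ))]
    refine IntegrableOn.union ?_ ?_
    · refine (integrableOn_exp_mul_Iic hδ 0).congr_fun (fun t ht => ?_) measurableSet_Iic
      simp only [abs_of_nonpos (show t ≤ 0 from ht)]; ring_nf
    · refine (integrableOn_exp_mul_Ioi (neg_lt_zero.2 hδ) 0).congr_fun (fun t ht => ?_)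
        measurableSet_Ioi
      simp only [abs_of_pos (show 0 < t from ht)]
  exact h0.comp_sub_left z

lemma lintegral_exp_neg_abs {δ : ℝ} (hδ : 0 < δ) (z : ℝ) :
    ∫⁻ t, ENNReal.ofReal (Real.exp (-δ * |z - t|)) = ENNReal.ofReal (2 / δ) := by
  rw [← ofReal_integral_eq_lintegral_ofReal (integrable_exp_neg_abs hδ z)
    (Eventually.of_forall fun t => (Real.exp_pos _).le),
    integral_sub_left_eq_self (fun t => Real.exp (-δ * |t|)) volume z,
    integral_comp_abs (f := fun t => Real.exp (-δ * t)), integral_exp_mul_Ioi (neg_lt_zero.2 hδ)]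
  congr 1
  field_simp
  simp

/-- Schur's test for kernels dominated by `e^{-δ|z-t|}`. -/
lemma exists_kernelOp {k : ℝ → ℝ → ℂ} (hk : Measurable (Function.uncurry k)) {δ : ℝ} (hδ : 0 < δ)
    (hkδ : ∀ z t, ‖k z t‖ ≤ Real.exp (-δ * |z - t|)) :
    ∃ K : L2Neg →L[ℂ] L2Neg, ‖K‖ ≤ 2 / δ ∧
      ∀ f : L2Neg, K f =ᵐ[volNeg] fun z => ∫ t, k z t * f t ∂volNeg := by
  have hkz : ∀ z, Measurable (k z) := fun z => hk.comp (measurable_const.prodMk measurable_id)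
  have hint : ∀ (f : L2Neg) z, Integrable (fun t => k z t * f t) volNeg := by
    intro f z
    have h2 : MemLp (k z) 2 volNeg := by
      rw [memLp_two_iff_integrable_sq_norm (hkz z).aestronglyMeasurable]
      refine Integrable.mono' (integrable_exp_neg_abs hδ z).integrableOn
        ((hkz z).norm.pow_const 2).aestronglyMeasurable (Eventually.of_forall fun t => ?_)
      rw [norm_pow, norm_norm]
      have h1 : Real.exp (-δ * |z - t|) ≤ 1 := Real.exp_le_one_iff.2 (by
        have := abs_nonneg (z - t); nlinarith)
      have h3 := hkδ z t
      nlinarith [norm_nonneg (k z t)]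
    exact h2.integrable_mul (Lp.memLp f)
  have hprod : ∀ f : L2Neg, AEStronglyMeasurable (fun p : ℝ × ℝ => k p.1 p.2 * f p.2)
      (volNeg.prod volNeg) := fun f =>
    hk.aestronglyMeasurable.mul (Lp.aestronglyMeasurable f).comp_snd
  refine exists_clm (fun f z => ∫ t, k z t * f t ∂volNeg) (by positivity)
    (fun f => (hprod f).integral_prod_right') (fun f => ?_) (fun f g => ?_) (fun a f => ?_)
  · set E : ℝ → ℝ → ENNReal := fun z t => ENNReal.ofReal (Real.exp (-δ * |z - t|)) with hE
    have hEm : Measurable (Function.uncurry E) := by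
      rw [hE]; simp only [Function.uncurry_def]; fun_prop
    have hEz : ∀ z, Measurable (E z) := fun z => hEm.comp (measurable_const.prodMk measurable_id)
    have hfm : AEMeasurable (fun t => ‖f t‖ₑ) volNeg := (Lp.aestronglyMeasurable f).enorm
    have hpt : ∀ z, ‖∫ t, k z t * f t ∂volNeg‖ₑ ^ 2 ≤
        ENNReal.ofReal (2 / δ) * ∫⁻ t, E z t * ‖f t‖ₑ ^ 2 ∂volNeg := by
      intro z
      have h1 : ‖∫ t, k z t * f t ∂volNeg‖ₑ ≤
          ∫⁻ t, ((fun t => E z t ^ (1 / 2 : ℝ)) *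
            fun t => E z t ^ (1 / 2 : ℝ) * ‖f t‖ₑ) t ∂volNeg := by
        refine (enorm_integral_le_lintegral_enorm _).trans (lintegral_mono fun t => ?_)
        simp only [Pi.mul_apply]
        rw [← mul_assoc, ← ENNReal.rpow_add_of_nonneg _ _ (by norm_num) (by norm_num), enorm_mul]
        norm_num
        gcongr
        rw [← ofReal_norm]
        exact ENNReal.ofReal_le_ofReal (hkδ z t)
      have h2 := ENNReal.lintegral_mul_le_Lp_mul_Lq volNeg Real.HolderConjugate.two_two
        ((hEz z).pow_const (1 / 2 : ℝ)).aemeasurable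
        (((hEz z).pow_const (1 / 2 : ℝ)).aemeasurable.mul hfm)
      have hsq : ∀ x : ENNReal, (x ^ (1 / 2 : ℝ)) ^ 2 = x := fun x => by
        rw [← ENNReal.rpow_two, ← ENNReal.rpow_mul]; norm_num
      have h3 := pow_le_pow_left₀ zero_le (h1.trans h2) 2
      rw [mul_pow, hsq, hsq] at h3
      simp only [Pi.mul_apply, ENNReal.rpow_two, mul_pow, hsq] at h3
      refine h3.trans ?_
      gcongr
      refine (setLIntegral_le_lintegral _ _).trans (lintegral_exp_neg_abs hδ z).le
    calc ∫⁻ z, ‖∫ t, k z t * f t ∂volNeg‖ₑ ^ 2 ∂volNeg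
        ≤ ∫⁻ z, ENNReal.ofReal (2 / δ) * ∫⁻ t, E z t * ‖f t‖ₑ ^ 2 ∂volNeg ∂volNeg :=
          lintegral_mono hpt
      _ = ENNReal.ofReal (2 / δ) * ∫⁻ z, ∫⁻ t, E z t * ‖f t‖ₑ ^ 2 ∂volNeg ∂volNeg :=
          lintegral_const_mul' _ _ ENNReal.ofReal_ne_top
      _ = ENNReal.ofReal (2 / δ) * ∫⁻ t, ∫⁻ z, E z t * ‖f t‖ₑ ^ 2 ∂volNeg ∂volNeg := by
          rw [lintegral_lintegral_swap]
          exact hEm.aemeasurable.mul (hfm.comp_snd.pow_const 2)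
      _ ≤ ENNReal.ofReal (2 / δ) * ∫⁻ t, ENNReal.ofReal (2 / δ) * ‖f t‖ₑ ^ 2 ∂volNeg := by
          gcongr with t
          rw [lintegral_mul_const' _ _ (by finiteness)]
          gcongr
          refine (setLIntegral_le_lintegral _ _).trans ?_
          rw [← lintegral_exp_neg_abs hδ t]
          refine lintegral_mono fun z => ?_
          simp only [hE, abs_sub_comm z t, le_refl]
      _ = _ := by rw [lintegral_const_mul' _ _ ENNReal.ofReal_ne_top]; ring
  · refine Eventually.of_forall fun z => ?_
    beta_reduce
    rw [← integral_add (hint f z) (hint g z)]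
    refine integral_congr_ae ?_
    filter_upwards [Lp.coeFn_add f g] with t ht
    rw [ht, Pi.add_apply]; ring
  · refine Eventually.of_forall fun z => ?_
    beta_reduce
    rw [← integral_const_mul]
    refine integral_congr_ae ?_
    filter_upwards [Lp.coeFn_smul a f] with t ht
    rw [ht, Pi.smul_apply, smul_eq_mul]; ring

/-! ### First order equations -/

/-- `P` is the continuous representative of `p`, and `p₁` is the weak derivative of `p`. -/
def HasWeakDeriv (p p₁ : L2Neg) (P : ℝ → ℂ) : Prop :=
  p =ᵐ[volNeg] P ∧ HasL2Deriv P p₁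

lemma HasWeakDeriv.add {p p₁ q q₁ : L2Neg} {P Q : ℝ → ℂ} (h : HasWeakDeriv p p₁ P)
    (k : HasWeakDeriv q q₁ Q) : HasWeakDeriv (p + q) (p₁ + q₁) (fun z => P z + Q z) := by
  refine ⟨?_, h.2.add k.2⟩
  filter_upwards [Lp.coeFn_add p q, h.1, k.1] with z e1 e2 e3
  rw [e1, Pi.add_apply, e2, e3]

lemma HasWeakDeriv.smul {p p₁ : L2Neg} {P : ℝ → ℂ} (a : ℂ) (h : HasWeakDeriv p p₁ P) :
    HasWeakDeriv (a • p) (a • p₁) (fun z => a * P z) := by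
  refine ⟨?_, h.2.smul a⟩
  filter_upwards [Lp.coeFn_smul a p, h.1] with z e1 e2
  rw [e1, Pi.smul_apply, e2, smul_eq_mul]

lemma ae_volNeg_of_forall {p : ℝ → Prop} (h : ∀ z < 0, p z) : ∀ᵐ z ∂volNeg, p z :=
  (ae_restrict_iff' measurableSet_Iio).2 (Eventually.of_forall h)

/-- Variation of constants: `e^{νz} G` with `G' = e^{-νz} f` solves `s' = ν s + f`. -/
lemma hasWeakDeriv_of_primitive {ν : ℂ} {f s : L2Neg} {G : ℝ → ℂ}
    (hG : ∀ a ≤ 0, ∀ b ≤ 0, G b - G a = ∫ t in a..b, Complex.exp (-(ν * t)) * f t)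
    (hs : s =ᵐ[volNeg] fun z => Complex.exp (ν * z) * G z) :
    HasWeakDeriv s (ν • s + f) (fun z => Complex.exp (ν * z) * G z) := by
  refine ⟨hs, fun a ha b hb => ?_⟩
  have hd := hasDerivAt_cexp_mul (ν)
  have hsub : ∀ x ∈ uIcc a b, x ≤ 0 := fun x hx => by
    rw [mem_uIcc] at hx
    rcases hx with hx | hx <;> linarith [hx.1, hx.2]
  have hc1 : Continuous (fun z : ℝ => ν * Complex.exp (ν * z)) := by fun_prop
  have hc2 : Continuous (fun z : ℝ => Complex.exp (-(ν * z))) := by fun_prop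
  rw [mul_sub_mul_eq_integral (F := fun z : ℝ => Complex.exp (ν * z)) (G := G)
    (hc1.intervalIntegrable a b)
    ((HasL2Deriv.intervalIntegrable f ha hb).continuousOn_mul hc2.continuousOn) (fun x _ => by
      rw [intervalIntegral.integral_eq_sub_of_hasDerivAt (fun z _ => hd z)
        (hc1.intervalIntegrable _ _)]) (fun x hx => hG a ha x (hsub x hx))]
  refine intervalIntegral_congr_neg ?_ ha hb
  filter_upwards [Lp.coeFn_add (ν • s) f, Lp.coeFn_smul ν s, hs] with z e1 e2 e3
  rw [e1, Pi.add_apply, e2, Pi.smul_apply, e3, smul_eq_mul, ← mul_assoc (Complex.exp _),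
    ← Complex.exp_add]
  simp [mul_assoc]

/-- The weight `e^{-N max(z, z₀)}`. It turns a Volterra operator on `(z₀, 0)` into an operator of
norm `O(1/N)` and leaves everything to the left of `z₀` unchanged. -/
noncomputable def weight (N z₀ z : ℝ) : ℝ := Real.exp (-N * max z z₀)

lemma weight_pos (N z₀ z : ℝ) : 0 < weight N z₀ z := Real.exp_pos _

lemma continuous_weight (N z₀ : ℝ) : Continuous (weight N z₀) := by
  unfold weight; fun_prop

lemma weight_div (N z₀ z t : ℝ) :
    weight N z₀ z / weight N z₀ t = Real.exp (-N * (max z z₀ - max t z₀)) := by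
  unfold weight; rw [← Real.exp_sub]; congr 1; ring

lemma norm_cexp_mul_sub (ν : ℂ) (z t : ℝ) :
    ‖Complex.exp (ν * (z - t))‖ = Real.exp (ν.re * (z - t)) := by
  rw [Complex.norm_exp]; simp

lemma continuous_kernel (ν : ℂ) (N z₀ : ℝ) : Continuous (fun p : ℝ × ℝ =>
    Complex.exp (ν * (p.1 - p.2)) * ((weight N z₀ p.1 / weight N z₀ p.2 : ℝ) : ℂ)) := by
  simp only [weight_div]; fun_prop

/-- The equation `s' = ν s + f` with `Re ν < 0`, solved from `-∞`. The solver is conjugated with the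
weight. On functions supported in `(z₀, 0)` its norm is `O(1/N)`. -/
lemma exists_solver_neg {ν : ℂ} (hν : ν.re < 0) {z₀ N : ℝ} (hN : 0 < N)
    {M Mi : L2Neg →L[ℂ] L2Neg}
    (hM : ∀ f, M f =ᵐ[volNeg] fun z => (weight N z₀ z : ℂ) * f z)
    (hMi : ∀ f, Mi f =ᵐ[volNeg] fun z => (weight N z₀ z : ℂ)⁻¹ * f z) :
    ∃ S : L2Neg →L[ℂ] L2Neg, ‖S‖ ≤ 2 / |ν.re| ∧
      (∀ f, ∃ F, HasWeakDeriv (Mi (S (M f))) (ν • Mi (S (M f)) + f) F) ∧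
      ∀ g : L2Neg, (∀ᵐ t ∂volNeg, t ≤ z₀ → g t = 0) → ‖S g‖ ≤ 2 / N * ‖g‖ := by
  set k : ℝ → ℝ → ℂ := fun z t => if t < z then
    Complex.exp (ν * (z - t)) * ((weight N z₀ z / weight N z₀ t : ℝ) : ℂ) else 0 with hk
  have hkm : Measurable (Function.uncurry k) :=
    Measurable.ite (measurableSet_lt measurable_snd measurable_fst)
      (continuous_kernel ν N z₀).measurable measurable_const
  have hknorm : ∀ z t, t < z → ‖k z t‖ = Real.exp (ν.re * (z - t) - N * (max z z₀ - max t z₀)) := by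
    intro z t h
    simp only [hk, if_pos h]
    rw [norm_mul, norm_cexp_mul_sub, weight_div, Complex.norm_real,
      Real.norm_of_nonneg (Real.exp_pos _).le, ← Real.exp_add]
    congr 1; ring
  obtain ⟨S, hS, hSf⟩ := exists_kernelOp hkm (δ := |ν.re|) (abs_pos.2 hν.ne) (fun z t => by
    by_cases h : t < z
    · rw [hknorm z t h, abs_of_neg hν, abs_of_pos (sub_pos.2 h), Real.exp_le_exp]
      have : max t z₀ ≤ max z z₀ := max_le_max_right _ h.le
      nlinarith
    · simp only [hk, if_neg h, norm_zero]; positivity)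
  obtain ⟨K, hK, hKf⟩ := exists_kernelOp (k := fun z t => if z₀ < t then k z t else 0)
    (Measurable.ite (measurableSet_lt measurable_const measurable_snd) hkm measurable_const)
    (δ := N) hN (fun z t => by
    by_cases h0 : z₀ < t
    · by_cases h : t < z
      · rw [if_pos h0, hknorm z t h, abs_of_pos (sub_pos.2 h), Real.exp_le_exp,
          max_eq_left h0.le, max_eq_left (h0.trans h).le]
        nlinarith
      · simp only [hk, if_neg h, ite_self, norm_zero]; positivity
    · simp only [if_neg h0, norm_zero]; positivity)
  refine ⟨S, hS, fun f => ?_, fun g hg => ?_⟩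
  · have hI : IntegrableOn (fun t : ℝ => Complex.exp (-(ν * t)) * f t) (Iic 0) := by
      rw [integrableOn_Iic_iff_integrableOn_Iio]
      have h2 : MemLp (fun t : ℝ => Complex.exp (-(ν * t))) 2 volNeg := by
        have hc : Continuous (fun t : ℝ => Complex.exp (-(ν * t))) := by fun_prop
        rw [memLp_two_iff_integrable_sq_norm hc.aestronglyMeasurable]
        refine ((integrableOn_exp_mul_Iic (a := -2 * ν.re) (by linarith) 0).mono_set
          Iio_subset_Iic_self).congr (Eventually.of_forall fun t => ?_)
        simp only [Complex.norm_exp, Complex.neg_re, Complex.mul_re, Complex.ofReal_re,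
          Complex.ofReal_im, mul_zero, sub_zero]
        rw [← Real.exp_nat_mul]
        congr 1; push_cast; ring
      exact h2.integrable_mul (Lp.memLp f)
    refine ⟨_, hasWeakDeriv_of_primitive
      (G := fun z => ∫ t in Iic z, Complex.exp (-(ν * t)) * f t)
      (fun a ha b hb => intervalIntegral.integral_Iic_sub_Iic (hI.mono_set (Iic_subset_Iic.2 ha))
        (hI.mono_set (Iic_subset_Iic.2 hb))) ?_⟩
    filter_upwards [hMi (S (M f)), hSf (M f), ae_volNeg_of_forall (fun z hz => hz)] with z e1 e2 hz
    rw [e1, e2, ← integral_const_mul, ← integral_const_mul, integral_Iic_eq_integral_Iio,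
      ← integral_indicator measurableSet_Iio, ← integral_indicator measurableSet_Iio]
    refine integral_congr_ae ?_
    have hMf := hM f
    rw [Filter.EventuallyEq, ae_restrict_iff' measurableSet_Iio] at hMf
    filter_upwards [hMf] with t ht
    by_cases h : t < z
    · have ht0 : t < 0 := h.trans hz
      rw [indicator_of_mem (show t ∈ Iio (0:ℝ) from ht0), indicator_of_mem (show t ∈ Iio z from h),
        ht ht0]
      simp only [hk, if_pos h]
      have h1 : (weight N z₀ z : ℂ) ≠ 0 := by exact_mod_cast (weight_pos N z₀ z).ne'
      have h2 : (weight N z₀ t : ℂ) ≠ 0 := by exact_mod_cast (weight_pos N z₀ t).ne'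
      rw [mul_sub, sub_eq_add_neg, Complex.exp_add]
      push_cast
      field_simp
    · rw [indicator_of_notMem (show t ∉ Iio z from h)]
      by_cases ht0 : t < 0
      · rw [indicator_of_mem (show t ∈ Iio (0:ℝ) from ht0)]
        simp [hk, if_neg h]
      · rw [indicator_of_notMem (show t ∉ Iio (0:ℝ) from ht0)]
  · have : S g = K g := by
      refine Lp.ext ?_
      filter_upwards [hSf g, hKf g] with z e1 e2
      rw [e1, e2]
      refine integral_congr_ae ?_
      filter_upwards [hg] with t ht
      by_cases h : z₀ < t
      · rw [if_pos h]
      · rw [ht (not_lt.1 h)]; simp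
    rw [this]
    exact K.le_of_opNorm_le hK g

/-- The equation `s' = ν s + f` with `Re ν > 0`, solved from `z₀` in both directions. To the left of
`z₀` the kernel decays; to the right, its growth is compensated by the weight, since
`N ≥ 2 Re ν`. -/
lemma exists_solver_pos {ν : ℂ} (hν : 0 < ν.re) {z₀ N : ℝ} (hz₀ : z₀ ≤ 0) (hN : 2 * ν.re ≤ N)
    {M Mi : L2Neg →L[ℂ] L2Neg}
    (hM : ∀ f, M f =ᵐ[volNeg] fun z => (weight N z₀ z : ℂ) * f z)
    (hMi : ∀ f, Mi f =ᵐ[volNeg] fun z => (weight N z₀ z : ℂ)⁻¹ * f z) :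
    ∃ S : L2Neg →L[ℂ] L2Neg, ‖S‖ ≤ 2 / |ν.re| ∧
      ∀ f, ∃ F, HasWeakDeriv (Mi (S (M f))) (ν • Mi (S (M f)) + f) F := by
  set k : ℝ → ℝ → ℂ := fun z t => if z₀ < t ∧ t ≤ z then
    Complex.exp (ν * (z - t)) * ((weight N z₀ z / weight N z₀ t : ℝ) : ℂ) else
    if z < t ∧ t ≤ z₀ then
    -(Complex.exp (ν * (z - t)) * ((weight N z₀ z / weight N z₀ t : ℝ) : ℂ)) else 0 with hk
  have hkm : Measurable (Function.uncurry k) :=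
    Measurable.ite ((measurableSet_lt measurable_const measurable_snd).inter
        (measurableSet_le measurable_snd measurable_fst))
      (continuous_kernel ν N z₀).measurable
      (Measurable.ite ((measurableSet_lt measurable_fst measurable_snd).inter
        (measurableSet_le measurable_snd measurable_const))
        (continuous_kernel ν N z₀).measurable.neg measurable_const)
  have hnorm : ∀ z t : ℝ,
      ‖Complex.exp (ν * (z - t)) * ((weight N z₀ z / weight N z₀ t : ℝ) : ℂ)‖
      = Real.exp (ν.re * (z - t) - N * (max z z₀ - max t z₀)) := by
    intro z t
    rw [norm_mul, norm_cexp_mul_sub, weight_div, Complex.norm_real,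
      Real.norm_of_nonneg (Real.exp_pos _).le, ← Real.exp_add]
    congr 1; ring
  obtain ⟨S, hS, hSf⟩ := exists_kernelOp hkm (δ := |ν.re|) (abs_pos.2 hν.ne') (fun z t => by
    by_cases h : z₀ < t ∧ t ≤ z
    · simp only [hk, if_pos h]
      rw [hnorm, abs_of_pos hν, abs_of_nonneg (sub_nonneg.2 h.2), Real.exp_le_exp,
        max_eq_left h.1.le, max_eq_left (h.1.trans_le h.2).le]
      nlinarith [h.2]
    · by_cases h' : z < t ∧ t ≤ z₀
      · simp only [hk, if_neg h, if_pos h']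
        rw [norm_neg, hnorm, abs_of_pos hν, abs_of_neg (sub_neg.2 h'.1), Real.exp_le_exp,
          max_eq_right h'.2, max_eq_right (h'.1.le.trans h'.2)]
        nlinarith [h'.1]
      · simp only [hk, if_neg h, if_neg h', norm_zero]; positivity)
  refine ⟨S, hS, fun f => ?_⟩
  have hc : Continuous (fun t : ℝ => Complex.exp (-(ν * t))) := by fun_prop
  have hI : ∀ a ≤ 0, ∀ b ≤ 0, IntervalIntegrable (fun t : ℝ => Complex.exp (-(ν * t)) * f t)
      volume a b := fun a ha b hb =>
    (HasL2Deriv.intervalIntegrable f ha hb).continuousOn_mul hc.continuousOn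
  refine ⟨_, hasWeakDeriv_of_primitive
    (G := fun z => ∫ t in z₀..z, Complex.exp (-(ν * t)) * f t)
    (fun a ha b hb => intervalIntegral.integral_interval_sub_left (hI _ hz₀ _ hb)
      (hI _ hz₀ _ ha)) ?_⟩
  filter_upwards [hMi (S (M f)), hSf (M f), ae_volNeg_of_forall (fun z hz => hz)] with z e1 e2 hz
  have hMf := hM f
  rw [Filter.EventuallyEq, ae_restrict_iff' measurableSet_Iio] at hMf
  have h1 : (weight N z₀ z : ℂ) ≠ 0 := by exact_mod_cast (weight_pos N z₀ z).ne'
  have h2 : ∀ t, (weight N z₀ t : ℂ) ≠ 0 := fun t => by exact_mod_cast (weight_pos N z₀ t).ne'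
  rw [e1, e2, ← integral_const_mul, ← intervalIntegral.integral_const_mul,
    ← integral_indicator measurableSet_Iio]
  rcases le_total z₀ z with hzz | hzz
  · rw [intervalIntegral.integral_of_le hzz, ← integral_indicator measurableSet_Ioc]
    refine integral_congr_ae ?_
    filter_upwards [hMf] with t ht
    by_cases h : t ∈ Ioc z₀ z
    · have ht0 : t < 0 := h.2.trans_lt hz
      rw [indicator_of_mem (show t ∈ Iio (0:ℝ) from ht0), indicator_of_mem h, ht ht0]
      simp only [hk, if_pos (show z₀ < t ∧ t ≤ z from h)]
      have := h2 t
      rw [mul_sub, sub_eq_add_neg, Complex.exp_add]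
      push_cast
      field_simp
    · rw [indicator_of_notMem h]
      by_cases ht0 : t < 0
      · rw [indicator_of_mem (show t ∈ Iio (0:ℝ) from ht0)]
        simp only [hk, if_neg (show ¬(z₀ < t ∧ t ≤ z) from h)]
        rw [if_neg (fun h' => by linarith [h'.1, h'.2])]
        simp
      · rw [indicator_of_notMem (show t ∉ Iio (0:ℝ) from ht0)]
  · rw [intervalIntegral.integral_of_ge hzz, ← integral_indicator measurableSet_Ioc, ← integral_neg]
    refine integral_congr_ae ?_
    have h0 : ∀ᵐ t : ℝ, t ≠ 0 := by simp [ae_iff]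
    filter_upwards [hMf, h0] with t ht hne
    by_cases h : t ∈ Ioc z z₀
    · have ht0 : t < 0 := lt_of_le_of_ne (h.2.trans hz₀) hne
      rw [indicator_of_mem (show t ∈ Iio (0:ℝ) from ht0), indicator_of_mem h, ht ht0]
      simp only [hk, if_neg (show ¬(z₀ < t ∧ t ≤ z) from fun h' => by linarith [h.1, h'.2]),
        if_pos (show z < t ∧ t ≤ z₀ from h)]
      have := h2 t
      rw [mul_sub, sub_eq_add_neg, Complex.exp_add]
      push_cast
      field_simp
    · rw [indicator_of_notMem h]
      by_cases ht0 : t < 0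
      · rw [indicator_of_mem (show t ∈ Iio (0:ℝ) from ht0)]
        simp only [hk, if_neg (show ¬(z < t ∧ t ≤ z₀) from h)]
        rw [if_neg (fun h' => by linarith [h'.1, h'.2])]
        simp
      · rw [indicator_of_notMem (show t ∉ Iio (0:ℝ) from ht0)]
        simp

/-! ### The second order equation on `H²`, without boundary condition -/

/-- `p ∈ H²(ℝ⁻)` solves `p'' + c p' - (1 + lam) p + 2 Q p = f`. Here `p₁ = p'`, and `P`, `P₁` are
the continuous representatives of `p` and `p'`. -/
def IsSolution (c : ℝ) (lam : ℂ) (Q : L2Neg →L[ℂ] L2Neg) (p p₁ f : L2Neg) (P P₁ : ℝ → ℂ) : Prop :=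
  HasWeakDeriv p p₁ P ∧ ∃ p₂, HasWeakDeriv p₁ p₂ P₁ ∧
    f = p₂ + (c : ℂ) • p₁ - (1 + lam) • p + (2 : ℂ) • Q p

lemma IsSolution.add {c : ℝ} {lam : ℂ} {Q : L2Neg →L[ℂ] L2Neg} {p p₁ f q q₁ g : L2Neg}
    {P P₁ R R₁ : ℝ → ℂ} (h : IsSolution c lam Q p p₁ f P P₁) (k : IsSolution c lam Q q q₁ g R R₁) :
    IsSolution c lam Q (p + q) (p₁ + q₁) (f + g) (fun z => P z + R z) (fun z => P₁ z + R₁ z) := by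
  obtain ⟨h1, p₂, h2, h3⟩ := h
  obtain ⟨k1, q₂, k2, k3⟩ := k
  refine ⟨h1.add k1, _, h2.add k2, ?_⟩
  rw [h3, k3, map_add]; module

lemma IsSolution.smul {c : ℝ} {lam : ℂ} {Q : L2Neg →L[ℂ] L2Neg} {p p₁ f : L2Neg}
    {P P₁ : ℝ → ℂ} (a : ℂ) (h : IsSolution c lam Q p p₁ f P P₁) :
    IsSolution c lam Q (a • p) (a • p₁) (a • f) (fun z => a * P z) (fun z => a * P₁ z) := by
  obtain ⟨h1, p₂, h2, h3⟩ := h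
  refine ⟨h1.smul a, _, h2.smul a, ?_⟩
  rw [h3, map_smul]; module

/-- For `Re ν ≤ 0` the homogeneous equation `h' = ν h` has no solution in `L²(ℝ⁻)`. -/
lemma eq_zero_of_deriv_eq_smul {ν : ℂ} (hν : ν.re ≤ 0) {h : L2Neg} {H : ℝ → ℂ}
    (hh : HasWeakDeriv h (ν • h) H) : h = 0 := by
  have hd := hasDerivAt_cexp_mul (-ν)
  have hconst : ∀ z : ℝ, z ≤ 0 → Complex.exp (-ν * z) * H z = H 0 := by
    intro z hz
    have h1 := hh.2.mul_sub_mul hd (by fun_prop) hz le_rfl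
    have h2 : ∫ t in z..0, (-ν * Complex.exp (-ν * t) * H t + Complex.exp (-ν * t) * (ν • h) t)
        = ∫ t in z..0, (fun _ => (0:ℂ)) t := by
      refine intervalIntegral_congr_neg ?_ hz le_rfl
      filter_upwards [Lp.coeFn_smul ν h, hh.1] with t e1 e2
      rw [e1, Pi.smul_apply, e2, smul_eq_mul]; ring
    rw [h2] at h1
    simp only [Complex.ofReal_zero, mul_zero, Complex.exp_zero, one_mul,
      intervalIntegral.integral_zero] at h1
    exact (sub_eq_zero.1 h1).symm
  have hge : ∀ z : ℝ, z ≤ 0 → ‖H 0‖ ≤ ‖H z‖ := by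
    intro z hz
    rw [← hconst z hz, norm_mul, Complex.norm_exp]
    refine mul_le_of_le_one_left (norm_nonneg _) (Real.exp_le_one_iff.2 ?_)
    simp only [Complex.mul_re, Complex.neg_re, Complex.ofReal_re, Complex.ofReal_im,
      mul_zero, sub_zero]
    nlinarith
  have hH0 : H 0 = 0 := by
    by_contra hne
    have h1 : MemLp (fun _ : ℝ => H 0) 2 volNeg := by
      refine ((Lp.memLp h).ae_eq hh.1).mono aestronglyMeasurable_const ?_
      exact ae_volNeg_of_forall fun z hz => hge z hz.le
    rw [memLp_const_iff two_ne_zero (by simp)] at h1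
    rcases h1 with h1 | h1
    · exact hne h1
    · simp at h1
  rw [Lp.eq_zero_iff_ae_eq_zero]
  filter_upwards [hh.1, ae_volNeg_of_forall (fun z hz => hz)] with z e1 hz
  rw [e1, Pi.zero_apply]
  have := hconst z hz.le
  rw [hH0] at this
  exact (mul_eq_zero.1 this).resolve_left (Complex.exp_ne_zero _)

/-- The first order solvers, composed with the weight, for both signs of `Re ν`. -/
lemma exists_solver {ν : ℂ} (hν : ν.re ≠ 0) {z₀ N : ℝ} (hz₀ : z₀ ≤ 0) (hN0 : 0 < N)
    (hN : 2 * ν.re ≤ N) {M Mi : L2Neg →L[ℂ] L2Neg}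
    (hM : ∀ f, M f =ᵐ[volNeg] fun z => (weight N z₀ z : ℂ) * f z)
    (hMi : ∀ f, Mi f =ᵐ[volNeg] fun z => (weight N z₀ z : ℂ)⁻¹ * f z) :
    ∃ S : L2Neg →L[ℂ] L2Neg, ‖S‖ ≤ 2 / |ν.re| ∧
      ∀ f, ∃ F, HasWeakDeriv (Mi (S (M f))) (ν • Mi (S (M f)) + f) F := by
  rcases hν.lt_or_gt with h | h
  · obtain ⟨S, h1, h2, -⟩ := exists_solver_neg h hN0 hM hMi
    exact ⟨S, h1, h2⟩
  · exact exists_solver_pos h hz₀ hN hM hMi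

/-- The weighted norm makes `1 + 2 S₁ S₂ Q` invertible, where `S₁ S₂` solves the equation with
constant coefficients. This gives a bounded right inverse `R` of the full differential operator on
`H²`. It also gives an `L²` solution of the homogeneous equation if `Re ν₁ > 0`, and shows that
there is none if `Re ν₁ < 0`. -/
theorem exists_rightInverse {c : ℝ} {lam ν₁ ν₂ : ℂ} (hsum : ν₁ + ν₂ = -c)
    (hprod : ν₁ * ν₂ = -(1 + lam)) (h1 : ν₁.re ≠ 0) (h2 : ν₂.re < 0) {y : ℝ → ℝ}
    (hym : AEStronglyMeasurable (fun z => (y z : ℂ)) volNeg) (hy0 : ∀ z < 0, 0 ≤ y z)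
    (hy1 : ∀ z < 0, y z ≤ 1) (hylim : Tendsto y atBot (𝓝 0)) {Q : L2Neg →L[ℂ] L2Neg}
    (hQ : ∀ f, Q f =ᵐ[volNeg] fun z => (y z : ℂ) * f z) :
    (∃ R R₁ : L2Neg →L[ℂ] L2Neg, ∀ g, ∃ P P₁, IsSolution c lam Q (R g) (R₁ g) g P P₁) ∧
    (0 < ν₁.re → ∃ p p₁ P P₁, p ≠ 0 ∧ IsSolution c lam Q p p₁ 0 P P₁) ∧
    (ν₁.re < 0 → ∀ p p₁ P P₁, IsSolution c lam Q p p₁ 0 P P₁ → p = 0) := by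
  set C₁ : ℝ := 2 / |ν₁.re| with hC1
  set C₂ : ℝ := 2 / |ν₂.re| with hC2
  have hC1p : 0 < C₁ := div_pos two_pos (abs_pos.2 h1)
  have hC2p : 0 < C₂ := div_pos two_pos (abs_pos.2 h2.ne)
  -- `ε` and `N` are chosen such that `2 C₁ (C₂ ε + 2 / N) ≤ 1 / 2`, and `N ≥ 2 Re ν₁`
  set ε : ℝ := 1 / (8 * C₁ * C₂) with hε
  have hεp : 0 < ε := by positivity
  obtain ⟨z₁, hz₁⟩ := (hylim.eventually (gt_mem_nhds hεp)).exists_forall_of_atBot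
  set z₀ := min z₁ 0 with hz₀
  have hz0 : z₀ ≤ 0 := min_le_right _ _
  set N : ℝ := max (2 * ν₁.re) (16 * C₁) with hN
  have hN0 : 0 < N := lt_of_lt_of_le (by positivity) (le_max_right _ _)
  have hcw := continuous_weight N z₀
  have hw1 : ∀ z < 0, ‖(weight N z₀ z : ℂ)‖ ≤ Real.exp (-N * z₀) := by
    intro z hz
    rw [Complex.norm_real, Real.norm_of_nonneg (weight_pos _ _ _).le, weight, Real.exp_le_exp]
    nlinarith [le_max_right z z₀]
  have hw2 : ∀ z < 0, ‖(weight N z₀ z : ℂ)⁻¹‖ ≤ 1 := by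
    intro z hz
    rw [norm_inv, Complex.norm_real, Real.norm_of_nonneg (weight_pos _ _ _).le, weight,
      ← Real.exp_neg, Real.exp_le_one_iff]
    have : max z z₀ ≤ 0 := max_le hz.le hz0
    nlinarith
  obtain ⟨M, -, hM⟩ := exists_mulOp (m := fun z => (weight N z₀ z : ℂ))
    (by fun_prop) (Real.exp_pos _).le hw1
  obtain ⟨Mi, -, hMi⟩ := exists_mulOp (m := fun z => (weight N z₀ z : ℂ)⁻¹)
    ((Complex.continuous_ofReal.comp hcw).inv₀ (fun z => by
      simpa using (weight_pos N z₀ z).ne')).aestronglyMeasurable zero_le_one hw2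
  have hwne : ∀ z, (weight N z₀ z : ℂ) ≠ 0 := fun z => by exact_mod_cast (weight_pos N z₀ z).ne'
  have hMMi : ∀ f, M (Mi f) = f := fun f => by
    refine Lp.ext ?_
    filter_upwards [hM (Mi f), hMi f] with z e1 e2
    rw [e1, e2, mul_inv_cancel_left₀ (hwne z)]
  have hMiM : ∀ f, Mi (M f) = f := fun f => by
    refine Lp.ext ?_
    filter_upwards [hMi (M f), hM f] with z e1 e2
    rw [e1, e2, inv_mul_cancel_left₀ (hwne z)]
  have hMQ : ∀ f, M (Q f) = Q (M f) := fun f => by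
    refine Lp.ext ?_
    filter_upwards [hM (Q f), hM f, hQ f, hQ (M f)] with z e1 e2 e3 e4
    rw [e1, e3, e4, e2]; ring
  obtain ⟨S₁, hS1, hS1f⟩ := exists_solver h1 hz0 hN0 (le_max_left _ _) hM hMi
  obtain ⟨S₂, hS2, hS2f, hS2s⟩ := exists_solver_neg h2 hN0 hM hMi
  -- splitting of `Q` into the far field, where `y ≤ ε`, and the rest
  have hQnorm : ∀ f, ‖S₂ (Q f)‖ ≤ (C₂ * ε + 2 / N) * ‖f‖ := by
    intro f
    have hms : AEStronglyMeasurable (fun z => (Iic z₀).indicator (fun z => (y z : ℂ)) z) volNeg :=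
      hym.indicator measurableSet_Iic
    obtain ⟨Q₁, hQ1, hQ1f⟩ := exists_mulOp hms hεp.le (fun z hz => by
      by_cases h : z ∈ Iic z₀
      · rw [indicator_of_mem h, Complex.norm_real, Real.norm_of_nonneg (hy0 z hz)]
        exact (hz₁ z (le_trans h (min_le_left _ _))).le
      · rw [indicator_of_notMem h, norm_zero]; exact hεp.le)
    have hQ2 : ‖Q f - Q₁ f‖ ≤ ‖f‖ := by
      refine Lp.norm_le_norm_of_ae_le ?_
      filter_upwards [Lp.coeFn_sub (Q f) (Q₁ f), hQ f, hQ1f f,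
        ae_volNeg_of_forall (fun z hz => hz)] with z e1 e2 e3 hz
      rw [e1, Pi.sub_apply, e2, e3]
      by_cases h : z ∈ Iic z₀
      · rw [indicator_of_mem h, sub_self, norm_zero]; exact norm_nonneg _
      · rw [indicator_of_notMem h, zero_mul, sub_zero, norm_mul, Complex.norm_real,
          Real.norm_of_nonneg (hy0 z hz)]
        exact mul_le_of_le_one_left (norm_nonneg _) (hy1 z hz)
    have hQ3 : ‖S₂ (Q f - Q₁ f)‖ ≤ 2 / N * ‖Q f - Q₁ f‖ := by
      refine hS2s _ ?_
      filter_upwards [Lp.coeFn_sub (Q f) (Q₁ f), hQ f, hQ1f f] with z e1 e2 e3 hz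
      rw [e1, Pi.sub_apply, e2, e3, indicator_of_mem (show z ∈ Iic z₀ from hz), sub_self]
    calc ‖S₂ (Q f)‖ = ‖S₂ (Q₁ f) + S₂ (Q f - Q₁ f)‖ := by rw [← map_add]; congr 2; abel
      _ ≤ C₂ * (ε * ‖f‖) + 2 / N * ‖f‖ := by
        refine (norm_add_le _ _).trans (add_le_add ?_ (hQ3.trans (by gcongr)))
        refine (S₂.le_of_opNorm_le hS2 _).trans ?_
        gcongr
        exact Q₁.le_of_opNorm_le hQ1 f
      _ = _ := by ring
  set T : L2Neg →L[ℂ] L2Neg := -((2 : ℂ) • (S₁.comp (S₂.comp Q))) with hT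
  have hTnorm : ‖T‖ < 1 := by
    have : ‖T‖ ≤ 1 / 2 := by
      refine ContinuousLinearMap.opNorm_le_bound _ (by norm_num) fun f => ?_
      have e : ‖T f‖ = 2 * ‖S₁ (S₂ (Q f))‖ := by simp [hT, norm_smul]
      rw [e]
      have e1 := S₁.le_of_opNorm_le hS1 (S₂ (Q f))
      have e2 : C₁ * ‖S₂ (Q f)‖ ≤ C₁ * ((C₂ * ε + 2 / N) * ‖f‖) :=
        mul_le_mul_of_nonneg_left (hQnorm f) hC1p.le
      have e3 : C₁ * (C₂ * ε) = 1 / 8 := by rw [hε]; field_simp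
      have e4 : C₁ * (2 / N) ≤ 1 / 8 := by
        rw [mul_div_assoc', div_le_iff₀ hN0]
        have := le_max_right (2 * ν₁.re) (16 * C₁)
        rw [← hN] at this
        linarith
      have e5 : C₁ * ((C₂ * ε + 2 / N) * ‖f‖) = (C₁ * (C₂ * ε) + C₁ * (2 / N)) * ‖f‖ := by ring
      rw [e5, e3] at e2
      nlinarith [norm_nonneg f]
    linarith
  obtain ⟨U, hU⟩ := isUnit_one_sub_of_norm_lt_one hTnorm
  set R₀ : L2Neg →L[ℂ] L2Neg := Mi.comp (S₁.comp (S₂.comp M)) with hR0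
  set R₂ : L2Neg →L[ℂ] L2Neg := Mi.comp (S₂.comp M) with hR2
  set J : L2Neg →L[ℂ] L2Neg := Mi.comp ((↑U⁻¹ : L2Neg →L[ℂ] L2Neg).comp M) with hJ
  have hUf : ∀ f, (U : L2Neg →L[ℂ] L2Neg) f = f + (2 : ℂ) • S₁ (S₂ (Q f)) := by
    intro f; rw [hU]; simp [hT]
  have hUU : ∀ f, (U : L2Neg →L[ℂ] L2Neg) ((↑U⁻¹ : L2Neg →L[ℂ] L2Neg) f) = f := fun f => by
    rw [← mul_apply_eq_comp, Units.mul_inv]; rfl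
  have hUU' : ∀ f, (↑U⁻¹ : L2Neg →L[ℂ] L2Neg) ((U : L2Neg →L[ℂ] L2Neg) f) = f := fun f => by
    rw [← mul_apply_eq_comp, Units.inv_mul]; rfl
  have hJ1 : ∀ f, J f + (2 : ℂ) • R₀ (Q (J f)) = f := by
    intro f
    have e1 : M (Q (J f)) = Q ((↑U⁻¹ : L2Neg →L[ℂ] L2Neg) (M f)) := by
      rw [hMQ]; simp only [hJ, ContinuousLinearMap.comp_apply, hMMi]
    have e2 := congrArg Mi (hUU (M f))
    rw [hUf, map_add, map_smul, hMiM] at e2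
    change J f + (2 : ℂ) • Mi (S₁ (S₂ (M (Q (J f))))) = f
    rw [e1]
    exact e2
  have hJ2 : ∀ f, J (f + (2 : ℂ) • R₀ (Q f)) = f := by
    intro f
    have e1 : M (f + (2 : ℂ) • R₀ (Q f)) = (U : L2Neg →L[ℂ] L2Neg) (M f) := by
      rw [hUf, map_add, map_smul]
      simp only [hR0, ContinuousLinearMap.comp_apply, hMMi, hMQ]
    simp only [hJ, ContinuousLinearMap.comp_apply, e1, hUU', hMiM]
  -- `R₀` solves the equation with constant coefficients
  have hsol : ∀ g, ∃ P P₁ p₂, HasWeakDeriv (R₀ g) (ν₁ • R₀ g + R₂ g) P ∧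
      HasWeakDeriv (ν₁ • R₀ g + R₂ g) p₂ P₁ ∧
      p₂ + (c : ℂ) • (ν₁ • R₀ g + R₂ g) - (1 + lam) • R₀ g = g := by
    intro g
    obtain ⟨H, hH⟩ := hS2f g
    obtain ⟨F, hF⟩ := hS1f (Mi (S₂ (M g)))
    have hR : R₀ g = Mi (S₁ (M (Mi (S₂ (M g))))) := by
      rw [hMMi]; rfl
    rw [← hR] at hF
    refine ⟨_, _, _, hF, (hF.smul ν₁).add hH, ?_⟩
    change ν₁ • (ν₁ • R₀ g + R₂ g) + (ν₂ • R₂ g + g) + _ - _ = g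
    have e1 : (c : ℂ) = -(ν₁ + ν₂) := by rw [hsum]; ring
    have e2 : 1 + lam = -(ν₁ * ν₂) := by rw [hprod]; ring
    rw [e1, e2]
    module
  refine ⟨⟨J.comp R₀, ν₁ • J.comp R₀ + R₂.comp (1 - (2 : ℂ) • Q.comp (J.comp R₀)), fun g => ?_⟩,
    fun hpos => ?_, fun hneg p p₁ P P₁ hp => ?_⟩
  · set g' : L2Neg := g - (2 : ℂ) • Q (J (R₀ g)) with hg'
    have e1 : J (R₀ g) = R₀ g' := by
      have := hJ1 (R₀ g)
      rw [hg', map_sub, map_smul]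
      exact eq_sub_of_add_eq this
    obtain ⟨P, P₁, p₂, k1, k2, k3⟩ := hsol g'
    refine ⟨P, P₁, ?_⟩
    change IsSolution c lam Q (J (R₀ g)) (ν₁ • J (R₀ g) + R₂ g') g P P₁
    have e2 : g = g' + (2 : ℂ) • Q (R₀ g') := by rw [← e1, hg', sub_add_cancel]
    rw [e1]
    exact ⟨k1, p₂, k2, by rw [k3]; exact e2⟩
  · -- correct `e^{ν₁ z}` by a solution of the inhomogeneous equation
    have hcexp : Continuous (fun z : ℝ => Complex.exp (ν₁ * z)) := by fun_prop
    have hmem : MemLp (fun z : ℝ => Complex.exp (ν₁ * z)) 2 volNeg := by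
      rw [memLp_two_iff_integrable_sq_norm hcexp.aestronglyMeasurable]
      refine ((integrableOn_exp_mul_Iic (a := 2 * ν₁.re) (by linarith) 0).mono_set
        Iio_subset_Iic_self).congr (Eventually.of_forall fun t => ?_)
      simp only [Complex.norm_exp, Complex.mul_re, Complex.ofReal_re,
        Complex.ofReal_im, mul_zero, sub_zero]
      rw [← Real.exp_nat_mul]
      congr 1; push_cast; ring
    set e : L2Neg := hmem.toLp with he
    have hew : HasWeakDeriv e (ν₁ • e) (fun z : ℝ => Complex.exp (ν₁ * z) * 1) := by
      have := hasWeakDeriv_of_primitive (ν := ν₁) (f := 0) (s := e) (G := fun _ => 1)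
        (fun a ha b hb => by
          rw [intervalIntegral_congr_neg (g := fun _ => 0) (by
            filter_upwards [Lp.coeFn_zero ℂ 2 volNeg] with t ht
            rw [ht]; simp) ha hb]
          simp) (by
        filter_upwards [hmem.coeFn_toLp] with z hz
        rw [he, hz, mul_one])
      rwa [add_zero] at this
    have hene : e ≠ 0 := by
      intro h0
      obtain ⟨h3, -⟩ := hew.2.eq_zero (by
        have := hew.1
        rw [h0] at this
        exact this.symm.trans (Lp.coeFn_zero ℂ 2 volNeg))
      have := h3 (show (0:ℝ) ∈ Iic 0 by simp)
      simp at this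
    set p : L2Neg := J e with hp
    set g' : L2Neg := -((2 : ℂ) • Q p) with hg'
    have e1 : p = e + R₀ g' := by
      have := hJ1 e
      rw [hg', map_neg, map_smul, ← sub_eq_add_neg]
      exact eq_sub_of_add_eq this
    obtain ⟨P, P₁, p₂, k1, k2, k3⟩ := hsol g'
    refine ⟨p, _, fun z : ℝ => Complex.exp (ν₁ * z) * 1 + P z, _, fun h0 => hene ?_, ?_, _,
      (hew.smul ν₁).add k2, ?_⟩
    · have := hJ1 e
      rw [← hp, h0, map_zero, map_zero, smul_zero, add_zero] at this
      exact this.symm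
    · rw [e1]; exact hew.add k1
    · have e2 : (c : ℂ) = -(ν₁ + ν₂) := by rw [hsum]; ring
      have e3 : 1 + lam = -(ν₁ * ν₂) := by rw [hprod]; ring
      have e4 : (2 : ℂ) • Q p = -g' := by rw [hg', neg_neg]
      rw [e4]
      rw [e1]
      have : ν₁ • ν₁ • e + p₂ + (c : ℂ) • (ν₁ • e + (ν₁ • R₀ g' + R₂ g'))
          - (1 + lam) • (e + R₀ g') + -g'
          = (ν₁ * ν₁ + c * ν₁ - (1 + lam)) • e
            + ((p₂ + (c : ℂ) • (ν₁ • R₀ g' + R₂ g') - (1 + lam) • R₀ g') - g') := by module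
      rw [this, k3, sub_self, add_zero, e2, e3,
        show ν₁ * ν₁ + -(ν₁ + ν₂) * ν₁ - -(ν₁ * ν₂) = 0 by ring, zero_smul]
  · -- both exponents decay to the right, so `R₀` also inverts the operator from the left
    obtain ⟨k1, p₂, k2, k3⟩ := hp
    obtain ⟨D, D₁, d₂, l1, l2, l3⟩ := hsol (-((2 : ℂ) • Q p))
    set r := R₀ (-((2 : ℂ) • Q p)) with hr
    set r₁ := ν₁ • r + R₂ (-((2 : ℂ) • Q p)) with hr1
    have d1 := k1.add (l1.smul (-1))
    have d2 := k2.add (l2.smul (-1))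
    set d := p + (-1 : ℂ) • r with hd
    set dd := p₁ + (-1 : ℂ) • r₁ with hdd
    have hfirst : dd + (-ν₁) • d = 0 := by
      have h3 := d2.add (d1.smul (-ν₁))
      have : p₂ + (-1 : ℂ) • d₂ + -ν₁ • dd = ν₂ • (dd + -ν₁ • d) := by
        have a1 : p₂ = -((c : ℂ) • p₁) + (1 + lam) • p - (2 : ℂ) • Q p := by
          refine sub_eq_zero.1 (Eq.trans ?_ k3.symm)
          module
        have a2 : d₂ = -((c : ℂ) • r₁) + (1 + lam) • r - (2 : ℂ) • Q p := by
          refine sub_eq_zero.1 (Eq.trans ?_ (sub_eq_zero.2 l3))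
          module
        have e2 : (c : ℂ) = -(ν₁ + ν₂) := by rw [hsum]; ring
        have e3 : 1 + lam = -(ν₁ * ν₂) := by rw [hprod]; ring
        rw [a1, a2, e2, e3, hd, hdd]
        module
      rw [this] at h3
      exact eq_zero_of_deriv_eq_smul h2.le h3
    have hd0 : d = 0 := by
      have : dd = ν₁ • d := by
        rw [neg_smul] at hfirst
        exact eq_of_sub_eq_zero (by rw [sub_eq_add_neg]; exact hfirst)
      have d3 : HasWeakDeriv d dd _ := d1
      rw [this] at d3
      exact eq_zero_of_deriv_eq_smul hneg.le d3
    have e1 : p + (2 : ℂ) • R₀ (Q p) = 0 := by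
      rw [hd, hr, map_neg, map_smul] at hd0
      rw [← hd0]; module
    have := hJ2 p
    rw [e1, map_zero] at this
    exact this.symm

/-! ### Solutions of the homogeneous equation -/

lemma HasL2Deriv.hasDerivWithinAt {F G : ℝ → ℂ} {g : L2Neg} (h : HasL2Deriv F g)
    (hg : g =ᵐ[volNeg] G) (hG : ContinuousOn G (Iic 0)) {z : ℝ} (hz : z ≤ 0) :
    HasDerivWithinAt F (G z) (Iic 0) z := by
  have hc : Continuous (fun z => G (min z 0)) :=
    hG.comp_continuous (by fun_prop) (fun x => mem_Iic.2 (min_le_right x 0))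
  have hd : HasDerivAt (fun b => F 0 + ∫ t in (0:ℝ)..b, G (min t 0)) (G (min z 0)) z :=
    (intervalIntegral.integral_hasDerivAt_right (hc.intervalIntegrable _ _)
      (hc.stronglyMeasurableAtFilter _ _) hc.continuousAt).const_add _
  rw [min_eq_left hz] at hd
  have hF : ∀ b ≤ 0, F b = F 0 + ∫ t in (0:ℝ)..b, G (min t 0) := by
    intro b hb
    rw [← intervalIntegral_congr_neg (f := g) ?_ le_rfl hb, ← h 0 le_rfl b hb]
    · ring
    · filter_upwards [hg, ae_volNeg_of_forall (fun z hz => hz)] with t ht h0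
      rw [ht, min_eq_left h0.le]
  exact hd.hasDerivWithinAt.congr (fun b hb => hF b hb) (hF z hz)

/-- `P` is a classical solution on `(-∞, 0]` of `P'' + c P' + (1 - lam - 2 (1 - y)) P = 0`, i.e. of
`P'' + c P' + (1 - 2 u - lam) P = 0` with `y = 1 - u`, and `P₁ = P'`. -/
structure ClassicalSol (c : ℝ) (lam : ℂ) (y : ℝ → ℝ) (P P₁ : ℝ → ℂ) : Prop where
  deriv : ∀ z : ℝ, z ≤ 0 → HasDerivWithinAt P (P₁ z) (Iic 0) z
  deriv_deriv : ∀ z : ℝ, z ≤ 0 →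
    HasDerivWithinAt P₁ (-(c * P₁ z) + (1 + lam - 2 * (y z : ℂ)) * P z) (Iic 0) z

lemma IsSolution.classical {c : ℝ} {lam : ℂ} {Q : L2Neg →L[ℂ] L2Neg} {y : ℝ → ℝ}
    (hyc : ContinuousOn y (Iic 0)) (hQ : ∀ f, Q f =ᵐ[volNeg] fun z => (y z : ℂ) * f z)
    {p p₁ : L2Neg} {P P₁ : ℝ → ℂ} (h : IsSolution c lam Q p p₁ 0 P P₁) :
    ClassicalSol c lam y P P₁ := by
  obtain ⟨h1, p₂, h2, h3⟩ := h
  have hPc := h1.2.continuousOn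
  have hP1c := h2.2.continuousOn
  refine ⟨fun z hz => h1.2.hasDerivWithinAt h2.1 hP1c hz, fun z hz =>
    h2.2.hasDerivWithinAt (G := fun z => -(c * P₁ z) + (1 + lam - 2 * (y z : ℂ)) * P z) ?_ ?_ hz⟩
  · have e : p₂ = (-(c : ℂ)) • p₁ + ((1 + lam) • p + (-2 : ℂ) • Q p) := by
      refine sub_eq_zero.1 (Eq.trans ?_ h3.symm)
      module
    rw [e]
    filter_upwards [Lp.coeFn_add ((-(c : ℂ)) • p₁) ((1 + lam) • p + (-2 : ℂ) • Q p),
      Lp.coeFn_add ((1 + lam) • p) ((-2 : ℂ) • Q p), Lp.coeFn_smul (-(c : ℂ)) p₁,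
      Lp.coeFn_smul (1 + lam) p, Lp.coeFn_smul (-2 : ℂ) (Q p), hQ p, h1.1, h2.1]
      with z e1 e2 e3 e4 e5 e6 e7 e8
    rw [e1, Pi.add_apply, e2, Pi.add_apply, e3, e4, e5, Pi.smul_apply, Pi.smul_apply, Pi.smul_apply,
      e6, e7, e8]
    simp only [smul_eq_mul]
    ring
  · have hyc' : ContinuousOn (fun z => (y z : ℂ)) (Iic 0) :=
      Complex.continuous_ofReal.comp_continuousOn hyc
    fun_prop

/-- A solution with vanishing Cauchy data at `0` vanishes: `e^{Kz} (|P|² + |P'|²)` is nondecreasing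
for a suitable constant `K`. -/
lemma ClassicalSol.eq_zero {c : ℝ} {lam : ℂ} {y : ℝ → ℝ} {P P₁ : ℝ → ℂ}
    (h : ClassicalSol c lam y P P₁) (hc : 0 ≤ c) (hy0 : ∀ z < 0, 0 ≤ y z) (hy1 : ∀ z < 0, y z ≤ 1)
    (h0 : P 0 = 0) (h1 : P₁ 0 = 0) : ∀ z ≤ 0, P z = 0 := by
  set B : ℝ := ‖1 + lam‖ + 2 with hB
  set K : ℝ := 1 + B + 2 * c with hK
  have hd : ∀ z ≤ 0, HasDerivWithinAt (fun z => Real.exp (K * z) * (‖P z‖ ^ 2 + ‖P₁ z‖ ^ 2)) _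
      (Iic 0) z := fun z hz =>
    WaveData.hasDerivWithinAt_exp_mul ((h.deriv z hz).norm_sq.add (h.deriv_deriv z hz).norm_sq)
  have hm := monotoneOn_Iic hd (fun z hz => by
    refine mul_nonneg (Real.exp_pos _).le ?_
    set a := ‖P z‖ with ha
    set b := ‖P₁ z‖ with hb
    have ha0 : 0 ≤ a := norm_nonneg _
    have hb0 : 0 ≤ b := norm_nonneg _
    have i1 : -(a * b) ≤ inner ℝ (P z) (P₁ z) :=
      neg_le_of_abs_le (abs_real_inner_le_norm _ _)
    have hq : ‖1 + lam - 2 * (y z : ℂ)‖ ≤ B := by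
      refine (norm_sub_le _ _).trans ?_
      rw [hB, norm_mul, Complex.norm_real, Real.norm_of_nonneg (hy0 z hz)]
      have := hy1 z hz
      norm_num
      linarith
    have hn : ‖-(c * P₁ z) + (1 + lam - 2 * (y z : ℂ)) * P z‖ ≤ c * b + B * a := by
      refine (norm_add_le _ _).trans (add_le_add ?_ ?_)
      · rw [norm_neg, norm_mul, Complex.norm_real, Real.norm_of_nonneg hc]
      · rw [norm_mul]
        exact mul_le_mul_of_nonneg_right hq ha0
    have i2 : -(b * (c * b + B * a)) ≤
        inner ℝ (P₁ z) (-(c * P₁ z) + (1 + lam - 2 * (y z : ℂ)) * P z) :=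
      neg_le_of_abs_le ((abs_real_inner_le_norm _ _).trans (mul_le_mul_of_nonneg_left hn hb0))
    have hB0 : 0 ≤ B := by positivity
    rw [hK]
    nlinarith [mul_nonneg hB0 (sq_nonneg (a - b)), sq_nonneg (a - b), mul_nonneg hc (sq_nonneg a)])
  intro z hz
  have := hm (show z ∈ Iic (0:ℝ) from hz) (show (0:ℝ) ∈ Iic (0:ℝ) by simp) hz
  simp only [h0, h1, norm_zero] at this
  have h2 := nonpos_of_mul_nonpos_right (this.trans_eq (by simp)) (Real.exp_pos _)
  have : ‖P z‖ ^ 2 ≤ 0 := by nlinarith [sq_nonneg ‖P₁ z‖]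
  simpa using this

lemma HasWeakDeriv.memLp {p p₁ : L2Neg} {P : ℝ → ℂ} (h : HasWeakDeriv p p₁ P) :
    MemLp P 2 volNeg := (Lp.memLp p).ae_eq h.1

lemma eq_zero_of_integrable_bound {k : ℝ} {g : ℝ → ℝ} {b : ℝ} (hg : IntegrableOn g (Iic b))
    (hk : ∀ z ≤ b, |k| ≤ g z) : k = 0 := by
  have h1 : IntegrableOn (fun _ : ℝ => k) (Iic b) :=
    Integrable.mono' hg aestronglyMeasurable_const
      ((ae_restrict_iff' measurableSet_Iic).2 (Eventually.of_forall fun z hz => hk z hz))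
  rcases (integrableOn_const_iff (by simp)).1 h1 with h2 | h2
  · simpa using h2
  · simp at h2

/-- The Wronskian of two solutions is `W(0) e^{-cz}`, which is integrable only if `W(0) = 0`. -/
lemma ClassicalSol.wronskian_eq_zero {c : ℝ} {lam : ℂ} {y : ℝ → ℝ} {P P₁ R R₁ : ℝ → ℂ}
    (h : ClassicalSol c lam y P P₁) (k : ClassicalSol c lam y R R₁) (hc : 0 ≤ c)
    (hP : MemLp P 2 volNeg) (hP1 : MemLp P₁ 2 volNeg) (hR : MemLp R 2 volNeg)
    (hR1 : MemLp R₁ 2 volNeg) : P 0 * R₁ 0 - P₁ 0 * R 0 = 0 := by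
  have hE := hasDerivAt_cexp_mul (c)
  have hd : ∀ z ∈ Iic (0:ℝ), HasDerivWithinAt
      (fun z : ℝ => Complex.exp (c * z) * (P z * R₁ z - P₁ z * R z)) 0 (Iic 0) z := by
    intro z hz
    refine ((hE z).hasDerivWithinAt.mul (((h.deriv z hz).mul (k.deriv_deriv z hz)).sub
      ((h.deriv_deriv z hz).mul (k.deriv z hz)))).congr_deriv ?_
    simp only [Pi.sub_apply, Pi.mul_apply]
    ring
  have hint : IntegrableOn (fun z => ‖P z * R₁ z - P₁ z * R z‖) (Iic 0) := by
    rw [integrableOn_Iic_iff_integrableOn_Iio]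
    exact ((hP.integrable_mul hR1).sub (hP1.integrable_mul hR)).norm
  have := eq_zero_of_integrable_bound (k := ‖P 0 * R₁ 0 - P₁ 0 * R 0‖) hint (fun z hz => by
    have h1 := (convex_Iic (0:ℝ)).norm_image_sub_le_of_norm_hasDerivWithin_le (C := 0) hd
      (by simp) (show z ∈ Iic (0:ℝ) from hz) (show (0:ℝ) ∈ Iic (0:ℝ) by simp)
    rw [zero_mul] at h1
    have h2 := sub_eq_zero.1 (norm_le_zero_iff.1 h1)
    simp only [Complex.ofReal_zero, mul_zero, Complex.exp_zero, one_mul] at h2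
    rw [abs_norm, h2, norm_mul, Complex.norm_exp]
    refine mul_le_of_le_one_left (norm_nonneg _) (Real.exp_le_one_iff.2 ?_)
    simp only [Complex.mul_re, Complex.ofReal_re, Complex.ofReal_im, mul_zero, sub_zero]
    exact mul_nonpos_of_nonneg_of_nonpos hc hz)
  simpa using this

/-- The derivative `v = u'` is a negative solution for `lam = 0`. With `P = v r` and
`B = e^{cz} (P' v - P v') conj r` one has `B' = e^{cz} (lam |P|² + v² |r'|²)`. So for `Re lam ≥ 0`
the real part of `B` is nondecreasing, and it vanishes at `0`. As it is integrable at `-∞`, it is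
identically `0`, which forces `r' = 0`. -/
lemma ClassicalSol.eq_zero_of_re_nonneg {c : ℝ} {lam : ℂ} {u v : ℝ → ℝ} {P P₁ : ℝ → ℂ}
    (h : ClassicalSol c lam (fun z => 1 - u z) P P₁) (hw : WaveData c u v) (hc : 0 ≤ c)
    (hc2 : c < 2) (hlam : 0 ≤ lam.re) (hP : MemLp P 2 volNeg) (hP1 : MemLp P₁ 2 volNeg)
    (h0 : P 0 = 0) : ∀ z ≤ 0, P z = 0 := by
  set w : ℝ → ℝ := fun z => -(c * v z) - u z * (1 - u z) with hwdef
  have hv : ∀ z : ℝ, z ≤ 0 → v z < 0 := fun z hz => hw.deriv_neg hc hz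
  have hvne : ∀ z : ℝ, z ≤ 0 → (v z : ℂ) ≠ 0 := fun z hz => by exact_mod_cast (hv z hz).ne
  have dv : ∀ z : ℝ, z ≤ 0 → HasDerivWithinAt (fun z => (v z : ℂ)) (w z : ℂ) (Iic 0) z :=
    fun z hz => (hw.dv z hz).ofReal_comp
  have dw : ∀ z : ℝ, z ≤ 0 → HasDerivWithinAt (fun z => (w z : ℂ))
      ((-(c * w z) - (1 - 2 * u z) * v z : ℝ) : ℂ) (Iic 0) z := fun z hz => by
    have := (((hw.dv z hz).const_mul c).neg.sub
      ((hw.du z hz).mul ((hw.du z hz).const_sub 1))).ofReal_comp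
    refine this.congr_deriv ?_
    congr 1
    simp only [hwdef]
    ring
  have dE := hasDerivAt_cexp_mul (c)
  set D : ℝ → ℂ := fun z => Complex.exp (c * z) * (P₁ z * v z - P z * w z) with hD
  have dD : ∀ z : ℝ, z ≤ 0 → HasDerivWithinAt D
      (Complex.exp (c * z) * (lam * P z * v z)) (Iic 0) z := by
    intro z hz
    refine ((dE z).hasDerivWithinAt.mul (((h.deriv_deriv z hz).mul (dv z hz)).sub
      ((h.deriv z hz).mul (dw z hz)))).congr_deriv ?_
    simp only [Pi.sub_apply, Pi.mul_apply]
    push_cast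
    ring
  set r : ℝ → ℂ := fun z => P z / v z with hr
  have dr : ∀ z : ℝ, z ≤ 0 → HasDerivWithinAt r
      ((P₁ z * v z - P z * w z) / (v z : ℂ) ^ 2) (Iic 0) z :=
    fun z hz => (h.deriv z hz).div (dv z hz) (hvne z hz)
  set b : ℝ → ℝ := fun z => (D z * (starRingEnd ℂ) (r z)).re with hb
  have db : ∀ z : ℝ, z ≤ 0 → HasDerivWithinAt b
      (Real.exp (c * z) * (lam.re * ‖P z‖ ^ 2 + ‖P₁ z * v z - P z * w z‖ ^ 2 / v z ^ 2))
      (Iic 0) z := by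
    intro z hz
    have hstar : HasDerivWithinAt (fun z => (starRingEnd ℂ) (r z))
        ((starRingEnd ℂ) ((P₁ z * v z - P z * w z) / (v z : ℂ) ^ 2)) (Iic 0) z := (dr z hz).star
    have h1 := (dD z hz).mul hstar
    have h2 : HasDerivWithinAt b _ (Iic 0) z :=
      (Complex.reCLM.hasFDerivAt
        (x := (D * fun z => (starRingEnd ℂ) (r z)) z)).comp_hasDerivWithinAt
        z h1
    refine h2.congr_deriv ?_
    have e1 : Complex.exp (c * z) * (lam * P z * v z) * (starRingEnd ℂ) (r z) +
        D z * (starRingEnd ℂ) ((P₁ z * v z - P z * w z) / (v z : ℂ) ^ 2)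
        = ((Real.exp (c * z) : ℝ) : ℂ) * (lam * ((‖P z‖ ^ 2 : ℝ) : ℂ) +
          ((‖P₁ z * v z - P z * w z‖ ^ 2 / v z ^ 2 : ℝ) : ℂ)) := by
      have hvz := hvne z hz
      push_cast
      rw [← Complex.mul_conj', ← Complex.mul_conj']
      simp only [hD, hr, map_div₀, map_pow, Complex.conj_ofReal]
      field_simp
    have e2 : Complex.reCLM (Complex.exp (c * z) * (lam * P z * v z) * (starRingEnd ℂ) (r z) +
        D z * (starRingEnd ℂ) ((P₁ z * v z - P z * w z) / (v z : ℂ) ^ 2)) = _ :=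
      congrArg Complex.re e1
    rw [e2, Complex.re_ofReal_mul, Complex.add_re, Complex.re_mul_ofReal, Complex.ofReal_re]
  have hmono : MonotoneOn b (Iic 0) := monotoneOn_Iic db (fun z hz => by positivity)
  have hb0 : b 0 = 0 := by simp [hb, hr, h0]
  obtain ⟨z₁, hz₁, hle⟩ := hw.exists_one_sub_le hc hc2
  have hbound : ∀ z : ℝ, z ≤ z₁ → |b z| ≤ ‖P₁ z‖ * ‖P z‖ + (c + 5) * ‖P z‖ ^ 2 := by
    intro z hz
    have hz0 : z ≤ 0 := hz.trans hz₁.le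
    have hvz := hv z hz0
    have hwz : |w z| ≤ (c + 5) * |v z| := by
      have h1 := hle z hz
      have h2 := hw.nonneg hz0
      have h3 := hw.lt_one hc hz0
      rw [abs_of_neg hvz, abs_le]
      simp only [hwdef]
      constructor <;> nlinarith [mul_nonneg hc (neg_nonneg.2 hvz.le)]
    refine (Complex.abs_re_le_norm _).trans ?_
    rw [norm_mul, Complex.norm_conj]
    simp only [hD, hr, norm_mul, norm_div, Complex.norm_real, Real.norm_eq_abs, Complex.norm_exp]
    have hexp : Real.exp ((c : ℂ) * (z : ℂ)).re ≤ 1 := by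
      rw [Real.exp_le_one_iff]
      simp only [Complex.mul_re, Complex.ofReal_re, Complex.ofReal_im, mul_zero, sub_zero]
      exact mul_nonpos_of_nonneg_of_nonpos hc hz0
    have hva : 0 < |v z| := abs_pos.2 hvz.ne
    have hnum : ‖P₁ z * v z - P z * w z‖ ≤ (‖P₁ z‖ + (c + 5) * ‖P z‖) * |v z| := by
      refine (norm_sub_le _ _).trans ?_
      rw [norm_mul, norm_mul, Complex.norm_real, Complex.norm_real, Real.norm_eq_abs,
        Real.norm_eq_abs]
      have := mul_le_mul_of_nonneg_left hwz (norm_nonneg (P z))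
      linarith
    calc Real.exp ((c : ℂ) * (z : ℂ)).re * ‖P₁ z * v z - P z * w z‖ * (‖P z‖ / |v z|)
        ≤ 1 * ((‖P₁ z‖ + (c + 5) * ‖P z‖) * |v z|) * (‖P z‖ / |v z|) := by gcongr
      _ = _ := by field_simp
  have hbz : ∀ z : ℝ, z ≤ 0 → b z = 0 := by
    intro z hz
    have hb1 : b z ≤ 0 := hb0 ▸ hmono hz (show (0:ℝ) ∈ Iic (0:ℝ) by simp) hz
    have hint : IntegrableOn (fun z => ‖P₁ z‖ * ‖P z‖ + (c + 5) * ‖P z‖ ^ 2) (Iic (min z z₁)) := by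
      have : IntegrableOn (fun z => ‖P₁ z‖ * ‖P z‖ + (c + 5) * ‖P z‖ ^ 2) (Iic 0) := by
        rw [integrableOn_Iic_iff_integrableOn_Iio]
        exact (hP1.norm.integrable_mul hP.norm).add
          (((memLp_two_iff_integrable_sq_norm hP.1).1 hP).const_mul _)
      exact this.mono_set (Iic_subset_Iic.2 ((min_le_left _ _).trans hz))
    refine eq_zero_of_integrable_bound hint (fun t ht => ?_)
    refine le_trans ?_ (hbound t (ht.trans (min_le_right _ _)))
    have h1 : b t ≤ b z :=
      hmono ((ht.trans (min_le_left _ _)).trans hz) hz (ht.trans (min_le_left _ _))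
    rw [abs_of_nonpos hb1, abs_of_nonpos (h1.trans hb1)]
    linarith
  have hNum : EqOn (fun z => P₁ z * v z - P z * w z) (fun _ => 0) (Iio 0) := by
    intro z hz
    have hz' : z < 0 := hz
    have hd := (db z hz'.le).hasDerivAt (Iic_mem_nhds hz')
    have hd0 : HasDerivAt b 0 z := (hasDerivAt_const z (0:ℝ)).congr_of_eventuallyEq (by
      filter_upwards [Iio_mem_nhds hz'] with t ht using hbz t (le_of_lt ht))
    have h1 := hd.unique hd0
    have h2 := (mul_eq_zero.1 h1).resolve_left (Real.exp_pos _).ne'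
    have hvz := hv z hz'.le
    have h3 : 0 ≤ lam.re * ‖P z‖ ^ 2 := by positivity
    have h4 : 0 ≤ ‖P₁ z * v z - P z * w z‖ ^ 2 / v z ^ 2 := by positivity
    have h5 : ‖P₁ z * v z - P z * w z‖ ^ 2 / v z ^ 2 = 0 := by linarith
    rw [div_eq_zero_iff] at h5
    rcases h5 with h5 | h5
    · simpa using h5
    · exact absurd (pow_eq_zero_iff two_ne_zero |>.1 h5) hvz.ne
  have hNumc : ContinuousOn (fun z => P₁ z * v z - P z * w z) (Iic 0) := fun z hz =>
    (((h.deriv_deriv z hz).continuousWithinAt.mul (dv z hz).continuousWithinAt).sub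
      ((h.deriv z hz).continuousWithinAt.mul (dw z hz).continuousWithinAt))
  have hNum0 := hNum.of_subset_closure hNumc continuousOn_const Iio_subset_Iic_self
    (by rw [closure_Iio]) (show (0:ℝ) ∈ Iic (0:ℝ) by simp)
  simp only [h0, zero_mul, sub_zero] at hNum0
  have h10 : P₁ 0 = 0 := (mul_eq_zero.1 hNum0).resolve_right (hvne 0 le_rfl)
  exact h.eq_zero hc (fun z hz => by linarith [hw.lt_one hc hz.le])
    (fun z hz => by linarith [hw.nonneg hz.le]) h0 h10

end FisherStefan

namespace UnboundedOp

/-! ### Fredholm operators given by their graphs -/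

section Abstract

variable {E : Type*} [NormedAddCommGroup E] [InnerProductSpace ℂ E]

lemma mem_graph_shift {T : E →ₗ.[ℂ] E} {lam : ℂ} {p f : E} :
    (p, f) ∈ (shift T lam).graph ↔ (p, f + lam • p) ∈ T.graph := by
  rw [LinearPMap.mem_graph_iff, LinearPMap.mem_graph_iff]
  have hs : ∀ x : T.domain, (shift T lam) x = T x - lam • (x : E) := fun x => rfl
  constructor
  · rintro ⟨x, hx, hf⟩
    refine ⟨x, hx, ?_⟩
    replace hf : T x - lam • (x : E) = f := (hs x).symm.trans hf
    change (x : E) = p at hx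
    rw [← hf, ← hx, sub_add_cancel]
  · rintro ⟨x, hx, hf⟩
    refine ⟨x, hx, (hs x).trans ?_⟩
    change (x : E) = p at hx
    change T x = f + lam • p at hf
    rw [hf, hx, add_sub_cancel_right]

lemma map_ker_eq {S : E →ₗ.[ℂ] E} {K : Submodule ℂ E} (hK : ∀ p, p ∈ K ↔ (p, (0 : E)) ∈ S.graph) :
    (LinearMap.ker S.toFun).map S.domain.subtype = K := by
  ext p
  rw [hK, LinearPMap.mem_graph_iff, Submodule.mem_map]
  constructor
  · rintro ⟨x, hx, rfl⟩
    exact ⟨x, rfl, hx⟩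
  · rintro ⟨x, hx, h0⟩
    exact ⟨x, h0, hx⟩

/-- The kernel of `S`, regarded as a subspace of `E`. -/
noncomputable def kerEquiv {S : E →ₗ.[ℂ] E} {K : Submodule ℂ E}
    (hK : ∀ p, p ∈ K ↔ (p, (0 : E)) ∈ S.graph) : LinearMap.ker S.toFun ≃ₗ[ℂ] K :=
  (Submodule.equivMapOfInjective S.domain.subtype (Submodule.injective_subtype _) _).trans
    (LinearEquiv.ofEq _ _ (map_ker_eq hK))

lemma mem_range_iff {S : E →ₗ.[ℂ] E} {f : E} :
    f ∈ LinearMap.range S.toFun ↔ ∃ p, (p, f) ∈ S.graph := by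
  constructor
  · rintro ⟨x, rfl⟩
    exact ⟨x, S.mem_graph x⟩
  · rintro ⟨p, hp⟩
    obtain ⟨x, -, hf⟩ := (LinearPMap.mem_graph_iff _).1 hp
    exact ⟨x, hf⟩

/-- A bijective operator with a bounded inverse `R`. -/
lemma mem_resolventSet_of_graph {T : E →ₗ.[ℂ] E} {lam : ℂ}
    (hker : ∀ p, (p, (0 : E)) ∈ (shift T lam).graph → p = 0) (R : E →L[ℂ] E)
    (hR : ∀ f, (R f, f) ∈ (shift T lam).graph) : lam ∈ resolventSet T := by
  refine ⟨R, fun x => ?_, fun f => ?_⟩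
  · have h := Submodule.sub_mem _ (hR (shift T lam x)) ((shift T lam).mem_graph x)
    rw [Prod.mk_sub_mk, sub_self] at h
    exact sub_eq_zero.1 (hker _ h)
  · obtain ⟨x, hx, hf⟩ := (LinearPMap.mem_graph_iff _).1 (hR f)
    exact ⟨x, hx, hf⟩

lemma isClosed_graph_of_mem_resolventSet {T : E →ₗ.[ℂ] E} {lam : ℂ} (h : lam ∈ resolventSet T)
    (mu : ℂ) : IsClosed ((shift T mu).graph : Set (E × E)) := by
  obtain ⟨R, h1, h2⟩ := h
  have : ((shift T mu).graph : Set (E × E)) = {x | R (x.2 + (mu - lam) • x.1) = x.1} := by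
    ext ⟨p, f⟩
    have e : (p, f) ∈ (shift T mu).graph ↔ (p, f + (mu - lam) • p) ∈ (shift T lam).graph := by
      rw [mem_graph_shift, mem_graph_shift]
      have : f + (mu - lam) • p + lam • p = f + mu • p := by module
      rw [this]
    change (p, f) ∈ (shift T mu).graph ↔ R (f + (mu - lam) • p) = p
    rw [e, LinearPMap.mem_graph_iff]
    constructor
    · rintro ⟨x, hx, hf⟩
      simp only at hx hf
      rw [← hf, h1, hx]
    · intro hp
      obtain ⟨x, hx, hf⟩ := h2 (f + (mu - lam) • p)
      exact ⟨x, hx.trans hp, hf⟩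
  rw [this]
  exact isClosed_eq (by fun_prop) (by fun_prop)

variable [CompleteSpace E]

/-- The kernel of the adjoint is the orthogonal complement of the range. -/
lemma mem_orthogonal_range_iff {S : E →ₗ.[ℂ] E} (hd : Dense (S.domain : Set E)) (w : E) :
    w ∈ (LinearMap.range S.toFun)ᗮ ↔ (w, (0 : E)) ∈ S.adjoint.graph := by
  rw [Submodule.mem_orthogonal', LinearPMap.mem_graph_iff]
  constructor
  · intro h
    have hx : ∀ x : S.domain, inner ℂ (0 : E) (x : E) = inner ℂ w (S x) := fun x => by
      rw [inner_zero_left]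
      exact (h (S x) ⟨x, rfl⟩).symm
    exact ⟨⟨w, LinearPMap.mem_adjoint_domain_of_exists w ⟨0, hx⟩⟩, rfl,
      LinearPMap.adjoint_apply_eq hd _ hx⟩
  · rintro ⟨x, hx, h0⟩ f ⟨y, rfl⟩
    have := LinearPMap.adjoint_isFormalAdjoint hd x y
    simp only at hx h0
    rw [h0, inner_zero_left, hx] at this
    exact this.symm

lemma index_eq {S : E →ₗ.[ℂ] E} (hd : Dense (S.domain : Set E)) {K : Submodule ℂ E}
    (hK : ∀ p, p ∈ K ↔ (p, (0 : E)) ∈ S.graph) :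
    index S = (Module.finrank ℂ K : ℤ) - Module.finrank ℂ (LinearMap.range S.toFun)ᗮ := by
  rw [index, (kerEquiv hK).finrank_eq, (kerEquiv (mem_orthogonal_range_iff hd)).finrank_eq]

/-- If the range is the kernel of a nonzero bounded functional, the adjoint has a one-dimensional
kernel. -/
lemma isFredholm_of_range_eq_ker {S : E →ₗ.[ℂ] E} (hd : Dense (S.domain : Set E))
    {K : Submodule ℂ E} [FiniteDimensional ℂ K] (hK : ∀ p, p ∈ K ↔ (p, (0 : E)) ∈ S.graph)
    {ℓ : E →L[ℂ] ℂ} (hℓ : ℓ ≠ 0) (hr : ∀ f, (∃ p, (p, f) ∈ S.graph) ↔ ℓ f = 0) :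
    IsFredholm S ∧ index S = (Module.finrank ℂ K : ℤ) - 1 := by
  have hrange : LinearMap.range S.toFun = LinearMap.ker (ℓ : E →ₗ[ℂ] ℂ) := by
    ext f
    rw [mem_range_iff, hr, LinearMap.mem_ker]
    rfl
  refine ⟨⟨(kerEquiv hK).symm.finiteDimensional, ?_, ?_⟩, ?_⟩
  · rw [hrange]
    exact ℓ.isClosed_ker
  · rw [hrange]
    exact (LinearMap.quotKerEquivRange (ℓ : E →ₗ[ℂ] ℂ)).symm.finiteDimensional
  · rw [index_eq hd hK, hrange]
    set w := (InnerProductSpace.toDual ℂ E).symm ℓ with hw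
    have hw0 : w ≠ 0 := by simpa [hw] using hℓ
    have hker : LinearMap.ker (ℓ : E →ₗ[ℂ] ℂ) = (ℂ ∙ w)ᗮ := by
      ext f
      rw [LinearMap.mem_ker, Submodule.mem_orthogonal_singleton_iff_inner_right, hw,
        InnerProductSpace.toDual_symm_apply]
      rfl
    rw [hker, Submodule.orthogonal_orthogonal, finrank_span_singleton hw0]
    rfl

lemma isFredholm_of_mem_resolventSet {T : E →ₗ.[ℂ] E} (hd : Dense (T.domain : Set E)) {lam : ℂ}
    (h : lam ∈ resolventSet T) : IsFredholm (shift T lam) ∧ index (shift T lam) = 0 := by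
  obtain ⟨R, h1, h2⟩ := h
  have hK : ∀ p, p ∈ (⊥ : Submodule ℂ E) ↔ (p, (0 : E)) ∈ (shift T lam).graph := by
    intro p
    rw [Submodule.mem_bot, LinearPMap.mem_graph_iff]
    constructor
    · rintro rfl
      exact ⟨0, rfl, (shift T lam).map_zero⟩
    · rintro ⟨x, hx, h0⟩
      simp only at hx h0
      rw [← hx, ← h1, h0, map_zero]
  have hrange : LinearMap.range (shift T lam).toFun = ⊤ := by
    rw [LinearMap.range_eq_top]
    intro f
    obtain ⟨x, -, hx⟩ := h2 f
    exact ⟨x, hx⟩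
  refine ⟨⟨(kerEquiv hK).symm.finiteDimensional, ?_, ?_⟩, ?_⟩
  · rw [hrange]
    exact isClosed_univ
  · rw [hrange]
    infer_instance
  · rw [index_eq (S := shift T lam) hd hK, hrange, Submodule.top_orthogonal_eq_bot, finrank_bot]
    rfl

/-- Weyl's criterion: a closed operator with a singular sequence is not Fredholm. On a closed range
the open mapping theorem gives preimages bounded by their images; the remainder of the sequence lies
in a finite-dimensional kernel, where bounded sequences have convergent subsequences. -/
lemma not_isFredholm_of_singular_sequence {S : E →ₗ.[ℂ] E}
    (hS : IsClosed (S.graph : Set (E × E))) {p f : ℕ → E} (hpf : ∀ n, (p n, f n) ∈ S.graph)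
    {M δ : ℝ} (hδ : 0 < δ) (hM : ∀ n, ‖p n‖ ≤ M) (hsep : ∀ m n, m ≠ n → δ ≤ ‖p m - p n‖)
    (hf : Tendsto f atTop (𝓝 0)) : ¬ IsFredholm S := by
  rintro ⟨h1, h2, -⟩
  have : CompleteSpace S.graph := hS.completeSpace_coe
  have : CompleteSpace (LinearMap.range S.toFun) := h2.completeSpace_coe
  let A : S.graph →L[ℂ] LinearMap.range S.toFun :=
    ((ContinuousLinearMap.snd ℂ E E).comp S.graph.subtypeL).codRestrict _
      (fun x => mem_range_iff.2 ⟨x.1.1, x.2⟩)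
  have hA : Function.Surjective A := fun y => by
    obtain ⟨q, hq⟩ := mem_range_iff.1 y.2
    exact ⟨⟨(q, y), hq⟩, rfl⟩
  obtain ⟨C, hC, hA⟩ := A.exists_preimage_norm_le hA
  have hx : ∀ n, ∃ x, (x, f n) ∈ S.graph ∧ ‖x‖ ≤ C * ‖f n‖ := by
    intro n
    obtain ⟨g, hg, hn⟩ := hA ⟨f n, mem_range_iff.2 ⟨p n, hpf n⟩⟩
    refine ⟨g.1.1, ?_, (norm_fst_le g.1).trans hn⟩
    have : g.1.2 = f n := congrArg Subtype.val hg
    rw [← this]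
    exact g.2
  choose x hx hxn using hx
  have hx0 : Tendsto x atTop (𝓝 0) :=
    squeeze_zero_norm hxn (by simpa using hf.norm.const_mul C)
  let K : Submodule ℂ E := (LinearMap.ker S.toFun).map S.domain.subtype
  have : FiniteDimensional ℂ K := inferInstanceAs
    (FiniteDimensional ℂ ((LinearMap.ker S.toFun).map S.domain.subtype))
  have : ProperSpace K := FiniteDimensional.proper ℂ K
  have hk : ∀ n, p n - x n ∈ K := fun n => by
    have h := Submodule.sub_mem _ (hpf n) (hx n)
    rw [Prod.mk_sub_mk, sub_self] at h
    obtain ⟨y, hy, h0⟩ := (LinearPMap.mem_graph_iff _).1 h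
    exact ⟨y, h0, hy⟩
  obtain ⟨B, hB⟩ := hx0.norm.bddAbove_range
  have hb : ∀ n, (⟨p n - x n, hk n⟩ : K) ∈ Metric.closedBall (0 : K) (M + B) := fun n => by
    rw [mem_closedBall_zero_iff]
    exact (norm_sub_le _ _).trans (add_le_add (hM n) (hB ⟨n, rfl⟩))
  obtain ⟨a, -, φ, hφ, ha⟩ := tendsto_subseq_of_bounded Metric.isBounded_closedBall hb
  have hp : Tendsto (fun n => p (φ n)) atTop (𝓝 ((a : E) + 0)) := by
    have h3 : Tendsto (fun n => p (φ n) - x (φ n)) atTop (𝓝 (a : E)) :=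
      (continuous_subtype_val.tendsto a).comp ha
    refine (h3.add (hx0.comp hφ.tendsto_atTop)).congr fun n => ?_
    simp
  obtain ⟨n, hn⟩ := Metric.cauchySeq_iff'.1 hp.cauchySeq δ hδ
  have h4 := hn (n + 1) n.le_succ
  rw [dist_eq_norm] at h4
  exact absurd (hsep _ _ (hφ.injective.ne n.succ_ne_self)) (not_le.2 h4)

end Abstract

end UnboundedOp

namespace FisherStefan

open UnboundedOp

/-! ### The graph of the linearisation -/

lemma WaveData.exists_mulOp {c : ℝ} {u v : ℝ → ℝ} (h : WaveData c u v) (hc : 0 ≤ c) :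
    AEStronglyMeasurable (fun z => ((1 - u z : ℝ) : ℂ)) volNeg ∧
    ∃ Q : L2Neg →L[ℂ] L2Neg, ∀ f : L2Neg, Q f =ᵐ[volNeg] fun z => ((1 - u z : ℝ) : ℂ) * f z := by
  have hm : AEStronglyMeasurable (fun z => ((1 - u z : ℝ) : ℂ)) volNeg := by
    refine ContinuousOn.aestronglyMeasurable ?_ measurableSet_Iio
    have := h.continuousOn.mono Iio_subset_Iic_self
    fun_prop
  refine ⟨hm, ?_⟩
  obtain ⟨Q, -, hQ⟩ := FisherStefan.exists_mulOp hm zero_le_one (fun z hz => by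
    have h1 := h.nonneg hz.le
    have h2 := h.lt_one hc hz.le
    rw [Complex.norm_real, Real.norm_of_nonneg (by linarith)]
    linarith)
  exact ⟨Q, hQ⟩

lemma mem_graph_iff {c : ℝ} {u : ℝ → ℝ} {lam : ℂ} {Q : L2Neg →L[ℂ] L2Neg}
    (hQ : ∀ f : L2Neg, Q f =ᵐ[volNeg] fun z => ((1 - u z : ℝ) : ℂ) * f z) {p f : L2Neg} :
    (p, f) ∈ (shift (linearisation c u) lam).graph ↔
      ∃ p₁ P P₁, IsSolution c lam Q p p₁ f P P₁ ∧ P 0 = 0 := by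
  rw [mem_graph_shift, linearisation_graph]
  have key : ∀ p₁ p₂ : L2Neg, (f + lam • p =ᵐ[volNeg]
      fun z => p₂ z + (c : ℂ) * p₁ z + (1 - 2 * (u z : ℂ)) * p z) ↔
      f = p₂ + (c : ℂ) • p₁ - (1 + lam) • p + (2 : ℂ) • Q p := by
    intro p₁ p₂
    have e : f = p₂ + (c : ℂ) • p₁ - (1 + lam) • p + (2 : ℂ) • Q p ↔
        f + lam • p = p₂ + ((c : ℂ) • p₁ + ((-1 : ℂ) • p + (2 : ℂ) • Q p)) := by
      constructor
      · rintro rfl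
        module
      · intro h
        rw [← eq_sub_iff_add_eq] at h
        rw [h]
        module
    have h2 : (p₂ + ((c : ℂ) • p₁ + ((-1 : ℂ) • p + (2 : ℂ) • Q p)) : L2Neg) =ᵐ[volNeg]
        fun z => p₂ z + (c : ℂ) * p₁ z + (1 - 2 * (u z : ℂ)) * p z := by
      filter_upwards [Lp.coeFn_add p₂ ((c : ℂ) • p₁ + ((-1 : ℂ) • p + (2 : ℂ) • Q p)),
        Lp.coeFn_add ((c : ℂ) • p₁) ((-1 : ℂ) • p + (2 : ℂ) • Q p),
        Lp.coeFn_add ((-1 : ℂ) • p) ((2 : ℂ) • Q p), Lp.coeFn_smul (c : ℂ) p₁,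
        Lp.coeFn_smul (-1 : ℂ) p, Lp.coeFn_smul (2 : ℂ) (Q p), hQ p] with z e1 e2 e3 e4 e5 e6 e7
      rw [e1, Pi.add_apply, e2, Pi.add_apply, e3, Pi.add_apply, e4, e5, e6]
      simp only [Pi.smul_apply, smul_eq_mul, e7]
      push_cast
      ring
    rw [e]
    exact ⟨fun h => Lp.ext (h.trans h2.symm), fun h => h ▸ h2⟩
  constructor
  · rintro ⟨p₁, p₂, ⟨P, P₁, h1, h2, h3, h4, h5⟩, h⟩
    exact ⟨p₁, P, P₁, ⟨⟨h1, h2⟩, p₂, ⟨h3, h4⟩, (key p₁ p₂).1 h⟩, h5⟩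
  · rintro ⟨p₁, P, P₁, ⟨⟨h1, h2⟩, p₂, ⟨h3, h4⟩, h⟩, h5⟩
    exact ⟨p₁, p₂, ⟨P, P₁, h1, h2, h3, h4, h5⟩, (key p₁ p₂).2 h⟩

lemma exists_integral_functional {m : ℝ → ℝ} (hm : Continuous m) :
    ∃ ℓ : L2Neg →L[ℂ] ℂ, ∀ f : L2Neg, ℓ f = ∫ t in (-1 : ℝ)..0, (m t : ℂ) * f t := by
  have hmem : MemLp ((Ico (-1 : ℝ) 0).indicator fun t => (m t : ℂ)) 2 volNeg := by
    rw [memLp_indicator_iff_restrict measurableSet_Ico]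
    obtain ⟨C, hC⟩ := (isCompact_Icc (a := (-1 : ℝ)) (b := 0)).exists_bound_of_continuousOn
      hm.continuousOn
    have : IsFiniteMeasure (volNeg.restrict (Ico (-1 : ℝ) 0)) := by
      rw [Measure.restrict_restrict measurableSet_Ico]
      exact ⟨by
        rw [Measure.restrict_apply_univ]
        exact (measure_mono inter_subset_left).trans_lt (by simp)⟩
    refine MemLp.of_bound (by fun_prop) C ?_
    rw [ae_restrict_iff' measurableSet_Ico]
    refine Eventually.of_forall fun t ht => ?_
    rw [Complex.norm_real]
    exact hC t ⟨ht.1, ht.2.le⟩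
  refine ⟨innerSL ℂ hmem.toLp, fun f => ?_⟩
  have h1 : ∫ t, inner ℂ ((hmem.toLp _ : L2Neg) t) (f t) ∂volNeg =
      ∫ t in Iio 0, (Ico (-1 : ℝ) 0).indicator (fun t => (m t : ℂ) * f t) t := by
    refine integral_congr_ae ?_
    filter_upwards [hmem.coeFn_toLp] with t ht
    rw [ht]
    by_cases h : t ∈ Ico (-1 : ℝ) 0
    · simp [h, mul_comm]
    · simp [h]
  rw [innerSL_apply_apply, L2.inner_def, h1, setIntegral_indicator measurableSet_Ico,
    inter_eq_right.2 (fun t ht => ht.2), intervalIntegral.integral_of_le (by norm_num),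
    integral_Ioc_eq_integral_Ioo, integral_Ico_eq_integral_Ioo]

/-- Point evaluation at `0` is a bounded functional on `H¹`. -/
lemma exists_eval_zero : ∃ ℓ₀ ℓ₁ : L2Neg →L[ℂ] ℂ, ∀ p p₁ P, HasWeakDeriv p p₁ P →
    P 0 = ℓ₀ p + ℓ₁ p₁ := by
  obtain ⟨ℓ₀, h0⟩ := exists_integral_functional (m := fun _ => 1) continuous_const
  obtain ⟨ℓ₁, h1⟩ := exists_integral_functional (m := fun t => 1 + t) (by fun_prop)
  refine ⟨ℓ₀, ℓ₁, fun p p₁ P h => ?_⟩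
  have hd : ∀ z : ℝ, HasDerivAt (fun t : ℝ => ((1 + t : ℝ) : ℂ)) 1 z := fun z => by
    simpa using ((hasDerivAt_id z).const_add 1).ofReal_comp
  have h2 := h.2.mul_sub_mul hd continuous_const (a := -1) (b := 0) (by norm_num) le_rfl
  simp only [add_zero, Complex.ofReal_one, one_mul, add_neg_cancel, Complex.ofReal_zero, zero_mul,
    sub_zero] at h2
  have hm1 : (-1 : ℝ) ≤ 0 := by norm_num
  have hi : IntervalIntegrable (fun t : ℝ => ((1 + t : ℝ) : ℂ) * p₁ t) volume (-1) 0 :=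
    (HasL2Deriv.intervalIntegrable p₁ hm1 le_rfl).continuousOn_mul (by fun_prop)
  rw [h2, h0, h1, ← intervalIntegral.integral_add (by
    simpa using HasL2Deriv.intervalIntegrable p hm1 le_rfl) hi]
  refine intervalIntegral_congr_neg ?_ hm1 le_rfl
  filter_upwards [h.1] with t ht
  simp [ht]

/-- Compactly supported `C²` functions belong to `H²(ℝ⁻)`. -/
lemma exists_isSolution_of_hasDerivAt (c : ℝ) (lam : ℂ) (Q : L2Neg →L[ℂ] L2Neg) {g g₁ g₂ : ℝ → ℂ}
    (h1 : ∀ z, HasDerivAt g (g₁ z) z) (h2 : ∀ z, HasDerivAt g₁ (g₂ z) z) (hc : Continuous g₂)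
    (hs : HasCompactSupport g) :
    ∃ p p₁ p₂ f : L2Neg, IsSolution c lam Q p p₁ f g g₁ ∧ p =ᵐ[volNeg] g ∧ p₁ =ᵐ[volNeg] g₁ ∧
      p₂ =ᵐ[volNeg] g₂ ∧ f = p₂ + (c : ℂ) • p₁ - (1 + lam) • p + (2 : ℂ) • Q p := by
  have hc1 : Continuous g₁ := continuous_iff_continuousAt.2 fun z => (h2 z).continuousAt
  have hc0 : Continuous g := continuous_iff_continuousAt.2 fun z => (h1 z).continuousAt
  have e1 : deriv g = g₁ := funext fun z => (h1 z).deriv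
  have e2 : deriv g₁ = g₂ := funext fun z => (h2 z).deriv
  have hs1 : HasCompactSupport g₁ := e1 ▸ hs.deriv
  have hs2 : HasCompactSupport g₂ := e2 ▸ hs1.deriv
  have m0 : MemLp g 2 volNeg := hc0.memLp_of_hasCompactSupport hs
  have m1 : MemLp g₁ 2 volNeg := hc1.memLp_of_hasCompactSupport hs1
  have m2 : MemLp g₂ 2 volNeg := hc.memLp_of_hasCompactSupport hs2
  refine ⟨m0.toLp, m1.toLp, m2.toLp, _, ⟨⟨m0.coeFn_toLp, fun a ha b hb => ?_⟩, m2.toLp,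
    ⟨m1.coeFn_toLp, fun a ha b hb => ?_⟩, rfl⟩, m0.coeFn_toLp, m1.coeFn_toLp, m2.coeFn_toLp, rfl⟩
  · rw [intervalIntegral_congr_neg m1.coeFn_toLp ha hb,
      intervalIntegral.integral_eq_sub_of_hasDerivAt (fun z _ => h1 z) (hc1.intervalIntegrable _ _)]
  · rw [intervalIntegral_congr_neg m2.coeFn_toLp ha hb,
      intervalIntegral.integral_eq_sub_of_hasDerivAt (fun z _ => h2 z) (hc.intervalIntegrable _ _)]

lemma exists_isSolution_of_contDiff (c : ℝ) (lam : ℂ) (Q : L2Neg →L[ℂ] L2Neg) {g : ℝ → ℝ}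
    (hg : ContDiff ℝ 2 g) (hs : HasCompactSupport g) :
    ∃ (p p₁ f : L2Neg) (P₁ : ℝ → ℂ), IsSolution c lam Q p p₁ f (fun z => (g z : ℂ)) P₁ := by
  have hg1 : ContDiff ℝ 1 (deriv g) := (contDiff_succ_iff_deriv.1 hg).2.2
  have d1 : ∀ z, HasDerivAt (fun z => (g z : ℂ)) ((deriv g z : ℝ) : ℂ) z := fun z =>
    (hg.differentiable two_ne_zero z).hasDerivAt.ofReal_comp
  have d2 : ∀ z, HasDerivAt (fun z => ((deriv g z : ℝ) : ℂ)) ((deriv (deriv g) z : ℝ) : ℂ) z :=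
    fun z => (hg1.differentiable one_ne_zero z).hasDerivAt.ofReal_comp
  obtain ⟨p, p₁, -, f, h, -⟩ := exists_isSolution_of_hasDerivAt c lam Q d1 d2
    (Complex.continuous_ofReal.comp (hg1.continuous_deriv le_rfl))
    (hs.comp_left (g := fun x : ℝ => (x : ℂ)) Complex.ofReal_zero)
  exact ⟨p, p₁, f, _, h⟩

lemma WaveData.dense_domain {c : ℝ} {u v : ℝ → ℝ} (h : WaveData c u v) (hc : 0 ≤ c) :
    Dense ((linearisation c u).domain : Set L2Neg) := by
  obtain ⟨-, Q, hQ⟩ := h.exists_mulOp hc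
  rw [Submodule.dense_iff_topologicalClosure_eq_top, Submodule.topologicalClosure_eq_top_iff,
    Submodule.eq_bot_iff]
  intro w hw
  rw [Lp.eq_zero_iff_ae_eq_zero]
  have hloc : LocallyIntegrable w volNeg := (Lp.memLp w).locallyIntegrable (by norm_num)
  have := isOpen_Iio.ae_eq_zero_of_integral_contDiff_smul_eq_zero (U := Iio (0 : ℝ))
    (hloc.locallyIntegrableOn _) (fun g hg hs hsub => by
      obtain ⟨p, p₁, f, P₁, hp⟩ := exists_isSolution_of_contDiff c 0 Q
        (by exact_mod_cast contDiff_infty.1 hg 2) hs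
      have h0 : g 0 = 0 := image_eq_zero_of_notMem_tsupport fun h => lt_irrefl (0 : ℝ) (hsub h)
      obtain ⟨x, hx, -⟩ := (LinearPMap.mem_graph_iff _).1
        ((mem_graph_iff hQ).2 ⟨p₁, _, P₁, hp, by simp [h0]⟩)
      have hin := (Submodule.mem_orthogonal _ _).1 hw x x.2
      simp only at hx
      rw [hx, L2.inner_def] at hin
      rw [← hin]
      refine integral_congr_ae ?_
      filter_upwards [hp.1.1] with t ht
      rw [ht]
      simp [mul_comm])
  filter_upwards [this, ae_volNeg_of_forall (fun z hz => hz)] with z h1 h2 using h1 h2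

/-- If all solutions of the homogeneous equation vanish at `0`, the inhomogeneous Dirichlet problem
is solvable precisely for the kernel of a nonzero bounded functional, the value at `0` of `R f`. -/
lemma exists_functional {c : ℝ} {lam : ℂ} {u : ℝ → ℝ} {Q : L2Neg →L[ℂ] L2Neg}
    (hQ : ∀ f : L2Neg, Q f =ᵐ[volNeg] fun z => ((1 - u z : ℝ) : ℂ) * f z)
    {R R₁ : L2Neg →L[ℂ] L2Neg} (hR : ∀ g, ∃ P P₁, IsSolution c lam Q (R g) (R₁ g) g P P₁)
    (hk : ∀ p p₁ P P₁, IsSolution c lam Q p p₁ 0 P P₁ → P 0 = 0) :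
    ∃ ℓ : L2Neg →L[ℂ] ℂ, ℓ ≠ 0 ∧
      ∀ f, (∃ p, (p, f) ∈ (shift (linearisation c u) lam).graph) ↔ ℓ f = 0 := by
  obtain ⟨ℓ₀, ℓ₁, hev⟩ := exists_eval_zero
  have key : ∀ p p₁ f P P₁, IsSolution c lam Q p p₁ f P P₁ →
      P 0 = (ℓ₀.comp R + ℓ₁.comp R₁) f := by
    intro p p₁ f P P₁ hp
    obtain ⟨S, S₁, hS⟩ := hR f
    have h1 := hp.add (hS.smul (-1))
    rw [show f + (-1 : ℂ) • f = 0 by module] at h1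
    have h2 := hk _ _ _ _ h1
    have h3 := hev _ _ _ hS.1
    change P 0 = ℓ₀ (R f) + ℓ₁ (R₁ f)
    rw [← h3]
    linear_combination h2
  refine ⟨ℓ₀.comp R + ℓ₁.comp R₁, fun h0 => ?_, fun f => ⟨?_, fun hf => ?_⟩⟩
  · let χ : ContDiffBump (0 : ℝ) := ⟨1, 2, one_pos, one_lt_two⟩
    obtain ⟨p, p₁, f, P₁, hp⟩ := exists_isSolution_of_contDiff c lam Q (g := χ) χ.contDiff
      χ.hasCompactSupport
    have := key _ _ _ _ _ hp
    rw [h0, χ.one_of_mem_closedBall (by simp [χ])] at this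
    simp at this
  · rintro ⟨p, hp⟩
    obtain ⟨p₁, P, P₁, h, h0⟩ := (mem_graph_iff hQ).1 hp
    rw [← key _ _ _ _ _ h, h0]
  · obtain ⟨S, S₁, hS⟩ := hR f
    exact ⟨R f, (mem_graph_iff hQ).2 ⟨_, S, S₁, hS, (key _ _ _ _ _ hS).trans hf⟩⟩

/-! ### The two sides of the parabola -/

section Sides

variable {c : ℝ} {u v : ℝ → ℝ} {lam ν₁ ν₂ : ℂ}

lemma WaveData.continuousOn_one_sub (h : WaveData c u v) :
    ContinuousOn (fun z => 1 - u z) (Iic 0) :=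
  continuousOn_const.sub h.continuousOn

lemma WaveData.exists_rightInverse (h : WaveData c u v) (hc : 0 ≤ c)
    (hsum : ν₁ + ν₂ = -c) (hprod : ν₁ * ν₂ = -(1 + lam)) (h1 : ν₁.re ≠ 0) (h2 : ν₂.re < 0)
    {Q : L2Neg →L[ℂ] L2Neg}
    (hQ : ∀ f : L2Neg, Q f =ᵐ[volNeg] fun z => ((1 - u z : ℝ) : ℂ) * f z) :
    (∃ R R₁ : L2Neg →L[ℂ] L2Neg, ∀ g, ∃ P P₁, IsSolution c lam Q (R g) (R₁ g) g P P₁) ∧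
    (0 < ν₁.re → ∃ p p₁ P P₁, p ≠ 0 ∧ IsSolution c lam Q p p₁ 0 P P₁) ∧
    (ν₁.re < 0 → ∀ p p₁ P P₁, IsSolution c lam Q p p₁ 0 P P₁ → p = 0) :=
  FisherStefan.exists_rightInverse hsum hprod h1 h2 (y := fun z => 1 - u z) (h.exists_mulOp hc).1
    (fun z hz => by linarith [h.lt_one hc hz.le]) (fun z hz => by linarith [h.nonneg hz.le])
    (by simpa using (h.tendsto_one hc).const_sub 1) hQ

/-- The `L²` solutions of the homogeneous equation form a space of dimension at most one. -/
lemma WaveData.exists_eq_smul (h : WaveData c u v) (hc : 0 ≤ c) {Q : L2Neg →L[ℂ] L2Neg}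
    (hQ : ∀ f : L2Neg, Q f =ᵐ[volNeg] fun z => ((1 - u z : ℝ) : ℂ) * f z)
    {φ φ₁ p p₁ : L2Neg} {Φ Φ₁ P P₁ : ℝ → ℂ} (hφ : IsSolution c lam Q φ φ₁ 0 Φ Φ₁) (hφ0 : φ ≠ 0)
    (hp : IsSolution c lam Q p p₁ 0 P P₁) : ∃ a : ℂ, p = a • φ ∧ P 0 = a * Φ 0 := by
  have kφ := hφ.classical (y := fun z => 1 - u z) h.continuousOn_one_sub hQ
  have kp := hp.classical (y := fun z => 1 - u z) h.continuousOn_one_sub hQ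
  have hy0 : ∀ z < 0, 0 ≤ 1 - u z := fun z hz => by linarith [h.lt_one hc hz.le]
  have hy1 : ∀ z < 0, 1 - u z ≤ 1 := fun z hz => by linarith [h.nonneg hz.le]
  have eq_zero : ∀ {q q₁ : L2Neg} {S S₁ : ℝ → ℂ}, IsSolution c lam Q q q₁ 0 S S₁ →
      (∀ z ≤ 0, S z = 0) → q = 0 := by
    intro q q₁ S S₁ hq hS
    rw [Lp.eq_zero_iff_ae_eq_zero]
    filter_upwards [hq.1.1, ae_volNeg_of_forall (fun z hz => hS z hz.le)] with z e1 e2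
    rw [e1, e2]
    rfl
  have hW : P 0 * Φ₁ 0 - P₁ 0 * Φ 0 = 0 :=
    kp.wronskian_eq_zero kφ hc hp.1.memLp hp.2.choose_spec.1.memLp hφ.1.memLp
      hφ.2.choose_spec.1.memLp
  obtain ⟨a, ha, ha1⟩ : ∃ a : ℂ, P 0 = a * Φ 0 ∧ P₁ 0 = a * Φ₁ 0 := by
    by_cases hΦ : Φ 0 = 0
    · have hΦ₁ : Φ₁ 0 ≠ 0 := fun h0 => hφ0 (eq_zero hφ (kφ.eq_zero hc hy0 hy1 hΦ h0))
      refine ⟨P₁ 0 / Φ₁ 0, ?_, by field_simp⟩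
      rw [hΦ, mul_zero, sub_zero] at hW
      rw [hΦ, mul_zero]
      exact (mul_eq_zero.1 hW).resolve_right hΦ₁
    · refine ⟨P 0 / Φ 0, by field_simp, ?_⟩
      field_simp
      linear_combination -hW
  refine ⟨a, ?_, ha⟩
  have hd := hp.add (hφ.smul (-a))
  rw [smul_zero, add_zero] at hd
  have h0 := eq_zero hd ((hd.classical (y := fun z => 1 - u z) h.continuousOn_one_sub hQ).eq_zero hc
    hy0 hy1 (by rw [ha]; ring) (by rw [ha1]; ring))
  rw [neg_smul] at h0
  exact add_neg_eq_zero.1 h0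

/-- To the right of the parabola the homogeneous equation has exactly one `L²` solution `φ`, up to
multiples. If `φ(0) ≠ 0`, it can be used to correct the boundary value of `R f`. If `φ(0) = 0`, the
kernel and the cokernel are both one-dimensional. -/
theorem WaveData.fredholm_right (h : WaveData c u v) (hc : 0 ≤ c) (hc2 : c < 2)
    (hsum : ν₁ + ν₂ = -c) (hprod : ν₁ * ν₂ = -(1 + lam)) (h1 : 0 < ν₁.re) (h2 : ν₂.re < 0) :
    (IsFredholm (shift (linearisation c u) lam) ∧ index (shift (linearisation c u) lam) = 0) ∧
    (0 ≤ lam.re → lam ∈ resolventSet (linearisation c u)) := by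
  obtain ⟨-, Q, hQ⟩ := h.exists_mulOp hc
  obtain ⟨⟨R, R₁, hR⟩, hφ, -⟩ := h.exists_rightInverse hc hsum hprod h1.ne' h2 hQ
  obtain ⟨φ, φ₁, Φ, Φ₁, hφ0, hφ⟩ := hφ h1
  have hd := h.dense_domain hc
  have kφ := hφ.classical (y := fun z => 1 - u z) h.continuousOn_one_sub hQ
  by_cases hΦ : Φ 0 = 0
  · refine ⟨?_, fun hlam => absurd ?_ hφ0⟩
    · have hK : ∀ p, p ∈ (ℂ ∙ φ) ↔ (p, (0 : L2Neg)) ∈ (shift (linearisation c u) lam).graph := by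
        intro p
        rw [mem_graph_iff hQ, Submodule.mem_span_singleton]
        constructor
        · rintro ⟨a, rfl⟩
          have := hφ.smul a
          rw [smul_zero] at this
          exact ⟨_, _, _, this, by rw [hΦ, mul_zero]⟩
        · rintro ⟨p₁, P, P₁, hp, -⟩
          obtain ⟨a, ha, -⟩ := h.exists_eq_smul hc hQ hφ hφ0 hp
          exact ⟨a, ha.symm⟩
      obtain ⟨ℓ, hℓ, hr⟩ := exists_functional hQ hR (fun p p₁ P P₁ hp => by
        obtain ⟨a, -, ha⟩ := h.exists_eq_smul hc hQ hφ hφ0 hp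
        rw [ha, hΦ, mul_zero])
      have := isFredholm_of_range_eq_ker (S := shift (linearisation c u) lam) hd hK hℓ hr
      rw [finrank_span_singleton hφ0] at this
      simpa using this
    · have h0 := kφ.eq_zero_of_re_nonneg h hc hc2 hlam hφ.1.memLp hφ.2.choose_spec.1.memLp hΦ
      rw [Lp.eq_zero_iff_ae_eq_zero]
      filter_upwards [hφ.1.1, ae_volNeg_of_forall (fun z hz => h0 z hz.le)] with z e1 e2
      rw [e1, e2]
      rfl
  · have hres : lam ∈ resolventSet (linearisation c u) := by
      obtain ⟨ℓ₀, ℓ₁, hev⟩ := exists_eval_zero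
      refine mem_resolventSet_of_graph (fun p hp => ?_)
        (R + (-(Φ 0)⁻¹ • (ℓ₀.comp R + ℓ₁.comp R₁)).smulRight φ) (fun f => ?_)
      · obtain ⟨p₁, P, P₁, hp, hp0⟩ := (mem_graph_iff hQ).1 hp
        obtain ⟨a, rfl, ha⟩ := h.exists_eq_smul hc hQ hφ hφ0 hp
        rw [hp0, eq_comm, mul_eq_zero, or_iff_left hΦ] at ha
        rw [ha, zero_smul]
      · obtain ⟨S, S₁, hS⟩ := hR f
        have hs := hS.add (hφ.smul (-(Φ 0)⁻¹ * (ℓ₀ (R f) + ℓ₁ (R₁ f))))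
        rw [smul_zero, add_zero] at hs
        refine (mem_graph_iff hQ).2 ⟨_, _, _, hs, ?_⟩
        rw [hev _ _ _ hS.1]
        field_simp
        ring
    exact ⟨isFredholm_of_mem_resolventSet hd hres, fun _ => hres⟩

/-- To the left of the parabola the homogeneous equation has no nontrivial `L²` solution, whereas
the boundary condition still costs one dimension of the range. -/
theorem WaveData.fredholm_left (h : WaveData c u v) (hc : 0 ≤ c)
    (hsum : ν₁ + ν₂ = -c) (hprod : ν₁ * ν₂ = -(1 + lam)) (h1 : ν₁.re < 0) (h2 : ν₂.re < 0) :
    IsFredholm (shift (linearisation c u) lam) ∧ index (shift (linearisation c u) lam) = -1 := by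
  obtain ⟨-, Q, hQ⟩ := h.exists_mulOp hc
  obtain ⟨⟨R, R₁, hR⟩, -, hker⟩ := h.exists_rightInverse hc hsum hprod h1.ne h2 hQ
  have hK : ∀ p, p ∈ (⊥ : Submodule ℂ L2Neg) ↔
      (p, (0 : L2Neg)) ∈ (shift (linearisation c u) lam).graph := by
    intro p
    rw [Submodule.mem_bot]
    constructor
    · rintro rfl
      exact Submodule.zero_mem _
    · intro hp
      obtain ⟨p₁, P, P₁, hp, -⟩ := (mem_graph_iff hQ).1 hp
      exact hker h1 _ _ _ _ hp
  obtain ⟨ℓ, hℓ, hr⟩ := exists_functional hQ hR (fun p p₁ P P₁ hp => by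
    have h0 := hker h1 _ _ _ _ hp
    exact (hp.1.2.eq_zero (hp.1.1.symm.trans (by
      rw [h0]; exact Lp.coeFn_zero ℂ 2 volNeg))).1 (show (0 : ℝ) ∈ Iic 0 by simp))
  have := isFredholm_of_range_eq_ker (S := shift (linearisation c u) lam) (h.dense_domain hc) hK
    hℓ hr
  simpa using this

end Sides

/-! ### The parabola -/

/-- Parametrisation of the plane by the characteristic root `ν₁ = a + i b` of larger real part. -/
lemma exists_roots (c : ℝ) (lam : ℂ) : ∃ a b : ℝ, -c / 2 ≤ a ∧
    lam.re = a ^ 2 + c * a - 1 - b ^ 2 ∧ lam.im = b * (2 * a + c) := by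
  obtain ⟨s, hs0, hs⟩ : ∃ s : ℂ, 0 ≤ s.re ∧ s ^ 2 = 1 + lam + ((c ^ 2 / 4 : ℝ) : ℂ) := by
    obtain ⟨s, hs⟩ := IsAlgClosed.exists_pow_nat_eq (1 + lam + ((c ^ 2 / 4 : ℝ) : ℂ)) two_pos
    rcases le_total 0 s.re with h | h
    · exact ⟨s, h, hs⟩
    · exact ⟨-s, by simpa using h, by rw [neg_sq, hs]⟩
  refine ⟨s.re - c / 2, s.im, by linarith, ?_, ?_⟩
  · have := congrArg Complex.re hs
    simp only [pow_two, Complex.mul_re, Complex.add_re, Complex.one_re, Complex.ofReal_re] at this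
    linear_combination -this
  · have := congrArg Complex.im hs
    simp only [pow_two, Complex.mul_im, Complex.add_im, Complex.one_im, Complex.ofReal_im] at this
    linear_combination -this

lemma mem_farFieldParabola {c : ℝ} {lam : ℂ} :
    lam ∈ farFieldParabola c ↔ ∃ k : ℝ, lam.re = -k ^ 2 - 1 ∧ lam.im = c * k := by
  have hre : ∀ k : ℝ, (-(k : ℂ) ^ 2 - 1 + Complex.I * c * k).re = -k ^ 2 - 1 := fun k => by
    simp [pow_two]
  have him : ∀ k : ℝ, (-(k : ℂ) ^ 2 - 1 + Complex.I * c * k).im = c * k := fun k => by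
    simp [pow_two]
  constructor
  · rintro ⟨k, rfl⟩
    exact ⟨k, hre k, him k⟩
  · rintro ⟨k, h1, h2⟩
    exact ⟨k, Complex.ext ((hre k).trans h1.symm) ((him k).trans h2.symm)⟩

lemma mem_farFieldRegion {c : ℝ} {lam : ℂ} :
    lam ∈ farFieldRegion c ↔ ∃ k : ℝ, lam.re ≤ -k ^ 2 - 1 ∧ lam.im = c * k := by
  constructor
  · rintro ⟨w, hw, h1, h2⟩
    obtain ⟨k, h3, h4⟩ := mem_farFieldParabola.1 hw
    exact ⟨k, h3 ▸ h2, h1.trans h4⟩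
  · rintro ⟨k, h1, h2⟩
    exact ⟨⟨-k ^ 2 - 1, c * k⟩, mem_farFieldParabola.2 ⟨k, rfl, rfl⟩, h2, h1⟩

section Roots

variable {c a b : ℝ} {lam : ℂ}

lemma mem_farFieldRegion_iff_root (hc : 0 ≤ c) (ha : -c / 2 ≤ a)
    (h1 : lam.re = a ^ 2 + c * a - 1 - b ^ 2) (h2 : lam.im = b * (2 * a + c)) :
    lam ∈ farFieldRegion c ↔ a ≤ 0 := by
  rw [mem_farFieldRegion, h1, h2]
  constructor
  · rintro ⟨k, h3, h4⟩
    by_contra! hpos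
    have h5 : a * (a + c) * (c ^ 2 + 4 * b ^ 2) ≤ 0 := by
      have h6 := mul_le_mul_of_nonneg_left h3 (sq_nonneg c)
      have h7 : b ^ 2 * (2 * a + c) ^ 2 = c ^ 2 * k ^ 2 := by rw [← mul_pow, h4, mul_pow]
      nlinarith
    have h8 : 0 < a * (a + c) := by positivity
    have h9 : c ^ 2 + 4 * b ^ 2 ≤ 0 := nonpos_of_mul_nonpos_right h5 h8
    have hb : b ^ 2 = 0 := by nlinarith [sq_nonneg b, sq_nonneg c]
    nlinarith [sq_nonneg k, mul_nonneg hc hpos.le]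
  · intro h3
    rcases hc.eq_or_lt with rfl | hc
    · have : a = 0 := le_antisymm h3 (by linarith)
      subst this
      exact ⟨b, by linarith, by ring⟩
    · refine ⟨b * (2 * a + c) / c, ?_, by field_simp⟩
      have h4 : a ^ 2 + c * a - b ^ 2 + (b * (2 * a + c) / c) ^ 2
          = a * (a + c) * (1 + 4 * (b / c) ^ 2) := by
        field_simp
        ring
      have h5 : a * (a + c) * (1 + 4 * (b / c) ^ 2) ≤ 0 :=
        mul_nonpos_of_nonpos_of_nonneg (mul_nonpos_of_nonpos_of_nonneg h3 (by linarith))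
          (by positivity)
      linarith

lemma mem_farFieldParabola_iff_root (hc : 0 ≤ c) (ha : -c / 2 ≤ a)
    (h1 : lam.re = a ^ 2 + c * a - 1 - b ^ 2) (h2 : lam.im = b * (2 * a + c)) :
    lam ∈ farFieldParabola c ↔ a = 0 := by
  rw [mem_farFieldParabola, h1, h2]
  constructor
  · rintro ⟨k, h3, h4⟩
    have h5 : a * (a + c) * (c ^ 2 + 4 * b ^ 2) = 0 := by
      have h7 : b ^ 2 * (2 * a + c) ^ 2 = c ^ 2 * k ^ 2 := by rw [← mul_pow, h4, mul_pow]
      linear_combination c ^ 2 * h3 + h7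
    rcases mul_eq_zero.1 h5 with h6 | h6
    · rcases mul_eq_zero.1 h6 with h7 | h7 <;> linarith
    · have hb : b ^ 2 = 0 := by nlinarith [sq_nonneg b, sq_nonneg c]
      have hc : c = 0 := by
        have : c ^ 2 = 0 := by nlinarith [sq_nonneg b, sq_nonneg c]
        exact pow_eq_zero_iff two_ne_zero |>.1 this
      subst hc
      have : a ^ 2 = 0 := by nlinarith [sq_nonneg k, sq_nonneg a]
      exact pow_eq_zero_iff two_ne_zero |>.1 this
  · rintro rfl
    exact ⟨b, by ring, by ring⟩

end Roots

lemma mem_farFieldRegion_of_pos {c : ℝ} (hc : 0 < c) {lam : ℂ} :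
    lam ∈ farFieldRegion c ↔ lam.im ^ 2 + c ^ 2 * (lam.re + 1) ≤ 0 := by
  rw [mem_farFieldRegion]
  constructor
  · rintro ⟨k, h1, h2⟩
    rw [h2]
    nlinarith [mul_le_mul_of_nonneg_left h1 (sq_nonneg c)]
  · intro h
    refine ⟨lam.im / c, ?_, by field_simp⟩
    have h1 : (lam.im / c) ^ 2 * c ^ 2 = lam.im ^ 2 := by field_simp
    have h2 : 0 < c ^ 2 := by positivity
    nlinarith

lemma mem_farFieldParabola_of_pos {c : ℝ} (hc : 0 < c) {lam : ℂ} :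
    lam ∈ farFieldParabola c ↔ lam.im ^ 2 + c ^ 2 * (lam.re + 1) = 0 := by
  rw [mem_farFieldParabola]
  constructor
  · rintro ⟨k, h1, h2⟩
    rw [h2, h1]
    ring
  · intro h
    refine ⟨lam.im / c, ?_, by field_simp⟩
    field_simp
    linear_combination h

lemma mem_farFieldRegion_zero {lam : ℂ} : lam ∈ farFieldRegion 0 ↔ lam ∈ farFieldParabola 0 := by
  rw [mem_farFieldRegion, mem_farFieldParabola]
  constructor
  · rintro ⟨k, h1, h2⟩
    refine ⟨√(-1 - lam.re), ?_, by simpa using h2⟩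
    rw [Real.sq_sqrt (by nlinarith [sq_nonneg k])]
    ring
  · rintro ⟨k, h1, h2⟩
    exact ⟨k, h1.le, h2⟩

lemma isClosed_farFieldRegion {c : ℝ} (hc : 0 ≤ c) : IsClosed (farFieldRegion c) := by
  rcases hc.eq_or_lt with rfl | hc
  · have : farFieldRegion 0 = {lam : ℂ | lam.im = 0 ∧ lam.re ≤ -1} := by
      ext lam
      rw [mem_farFieldRegion]
      constructor
      · rintro ⟨k, h1, h2⟩
        exact ⟨by simpa using h2, by nlinarith [sq_nonneg k]⟩
      · rintro ⟨h1, h2⟩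
        exact ⟨0, by simpa using h2, by simpa using h1⟩
    rw [this]
    exact (isClosed_eq Complex.continuous_im continuous_const).inter
      (isClosed_le Complex.continuous_re continuous_const)
  · have : farFieldRegion c = {lam : ℂ | lam.im ^ 2 + c ^ 2 * (lam.re + 1) ≤ 0} :=
      Set.ext fun lam => mem_farFieldRegion_of_pos hc
    rw [this]
    exact isClosed_le (by fun_prop) continuous_const

theorem frontier_farFieldRegion {c : ℝ} (hc : 0 ≤ c) :
    frontier (farFieldRegion c) = farFieldParabola c := by
  rw [(isClosed_farFieldRegion hc).frontier_eq]
  -- A boundary point leaves the region in the direction `1` if `c > 0`, and `i` if `c = 0`.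
  have not_interior : ∀ (d lam : ℂ), (∀ t : ℝ, 0 < t → lam + t * d ∉ farFieldRegion c) →
      lam ∉ interior (farFieldRegion c) := by
    intro d lam hd hlam
    have hcont : Tendsto (fun t : ℝ => lam + t * d) (𝓝[>] 0) (𝓝 lam) := by
      have : ContinuousAt (fun t : ℝ => lam + t * d) 0 := by fun_prop
      have h2 : Tendsto (fun t : ℝ => lam + t * d) (𝓝 0) (𝓝 (lam + (0 : ℝ) * d)) := this
      rw [Complex.ofReal_zero, zero_mul, add_zero] at h2
      exact h2.mono_left nhdsWithin_le_nhds
    obtain ⟨t, ht, ht0⟩ := ((hcont.eventually (mem_interior_iff_mem_nhds.1 hlam)).and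
      (self_mem_nhdsWithin : Ioi (0 : ℝ) ∈ 𝓝[>] 0)).exists
    exact hd t ht0 ht
  ext lam
  rcases hc.eq_or_lt with rfl | hc
  · refine ⟨fun h => mem_farFieldRegion_zero.1 h.1, fun h => ⟨mem_farFieldRegion_zero.2 h,
      not_interior Complex.I lam fun t ht ht' => ?_⟩⟩
    obtain ⟨k, -, h2⟩ := mem_farFieldParabola.1 h
    obtain ⟨l, -, h4⟩ := mem_farFieldRegion.1 ht'
    simp at h2 h4
    linarith
  · rw [mem_farFieldParabola_of_pos hc]
    constructor
    · rintro ⟨h1, h2⟩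
      by_contra h3
      refine h2 (mem_interior.2 ⟨{lam | lam.im ^ 2 + c ^ 2 * (lam.re + 1) < 0}, fun w hw =>
        (mem_farFieldRegion_of_pos hc).2 (le_of_lt hw), isOpen_lt (by fun_prop) continuous_const,
        lt_of_le_of_ne ((mem_farFieldRegion_of_pos hc).1 h1) h3⟩)
    · intro h
      refine ⟨(mem_farFieldRegion_of_pos hc).2 h.le, not_interior 1 lam fun t ht ht' => ?_⟩
      rw [mem_farFieldRegion_of_pos hc] at ht'
      simp at ht'
      nlinarith [mul_pos (pow_pos hc 2) ht]

/-! ### Singular sequences on the parabola -/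

lemma eLpNorm_indicator_Ioo {a b A : ℝ} (hab : a ≤ b) (hb : b ≤ 0) (hA : 0 ≤ A) :
    eLpNorm ((Ioo a b).indicator fun _ => A) 2 volNeg = ENNReal.ofReal (A * √(b - a)) := by
  rw [eLpNorm_indicator_const measurableSet_Ioo two_ne_zero (by simp),
    Measure.restrict_apply measurableSet_Ioo,
    inter_eq_left.2 (show Ioo a b ⊆ Iio 0 from fun x hx => lt_of_lt_of_le hx.2 hb), Real.volume_Ioo,
    ENNReal.ofReal_mul hA, Real.enorm_eq_ofReal hA,
    ENNReal.ofReal_rpow_of_nonneg (by linarith) (by simp), Real.sqrt_eq_rpow]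
  norm_num

lemma norm_le_of_ae_le {p : L2Neg} {L A : ℝ} (hL : 0 ≤ L) (hA : 0 ≤ A)
    (h : ∀ᵐ z ∂volNeg, ‖p z‖ ≤ (Ioo (-L) 0).indicator (fun _ => A) z) : ‖p‖ ≤ A * √L := by
  have h1 := eLpNorm_mono_ae_real (p := 2) h
  rw [eLpNorm_indicator_Ioo (by linarith) le_rfl hA, zero_sub, neg_neg] at h1
  rw [Lp.norm_def]
  exact ENNReal.toReal_le_of_le_ofReal (by positivity) h1

lemma le_norm_of_le_ae {p : L2Neg} {a b A : ℝ} (hab : a ≤ b) (hb : b ≤ 0) (hA : 0 ≤ A)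
    (h : ∀ᵐ z ∂volNeg, z ∈ Ioo a b → A ≤ ‖p z‖) : A * √(b - a) ≤ ‖p‖ := by
  have h1 : eLpNorm ((Ioo a b).indicator fun _ => A) 2 volNeg ≤ eLpNorm p 2 volNeg := by
    refine eLpNorm_mono_ae ?_
    filter_upwards [h] with z hz
    by_cases h0 : z ∈ Ioo a b
    · rw [indicator_of_mem h0, Real.norm_of_nonneg hA]
      exact hz h0
    · rw [indicator_of_notMem h0, norm_zero]
      exact norm_nonneg _
  rw [eLpNorm_indicator_Ioo hab hb hA] at h1
  rw [Lp.norm_def]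
  exact (ENNReal.ofReal_le_iff_le_toReal (Lp.eLpNorm_ne_top p)).1 h1

/-- A `C²` bump on `(-4, -1)` that equals `1` on `[-3, -2]`. -/
lemma exists_bump : ∃ (χ χ₁ χ₂ : ℝ → ℝ) (B : ℝ), (∀ z, HasDerivAt χ (χ₁ z) z) ∧
    (∀ z, HasDerivAt χ₁ (χ₂ z) z) ∧ Continuous χ₂ ∧
    (∀ z, z ∉ Ioo (-4 : ℝ) (-1) → χ z = 0 ∧ χ₁ z = 0 ∧ χ₂ z = 0) ∧
    (∀ z ∈ Ioo (-3 : ℝ) (-2), χ z = 1) ∧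
    ∀ z, |χ z| ≤ 1 ∧ |χ₁ z| ≤ B ∧ |χ₂ z| ≤ B := by
  let χ : ContDiffBump (-5 / 2 : ℝ) := ⟨1 / 2, 1, by norm_num, by norm_num⟩
  have hχ : ContDiff ℝ 2 χ := χ.contDiff
  have hχ1 : ContDiff ℝ 1 (deriv χ) := (contDiff_succ_iff_deriv.1 hχ).2.2
  have hχ2 : Continuous (deriv (deriv χ)) := hχ1.continuous_deriv le_rfl
  have hs := χ.hasCompactSupport
  obtain ⟨B₁, hB1⟩ := hχ1.continuous.bounded_above_of_compact_support hs.deriv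
  obtain ⟨B₂, hB2⟩ := hχ2.bounded_above_of_compact_support hs.deriv.deriv
  have hsub : tsupport χ ⊆ Ioo (-4 : ℝ) (-1) := by
    rw [χ.tsupport_eq, Real.closedBall_eq_Icc]
    intro z hz
    have : χ.rOut = 1 := rfl
    rw [this] at hz
    constructor <;> linarith [hz.1, hz.2]
  refine ⟨χ, deriv χ, deriv (deriv χ), max B₁ B₂,
    fun z => (hχ.differentiable two_ne_zero z).hasDerivAt,
    fun z => (hχ1.differentiable one_ne_zero z).hasDerivAt, hχ2, fun z hz => ⟨?_, ?_, ?_⟩,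
    fun z hz => χ.one_of_mem_closedBall ?_, fun z => ⟨?_, ?_, ?_⟩⟩
  · exact image_eq_zero_of_notMem_tsupport fun h => hz (hsub h)
  · exact image_eq_zero_of_notMem_tsupport fun h => hz (hsub (tsupport_deriv_subset h))
  · exact image_eq_zero_of_notMem_tsupport fun h =>
      hz (hsub (tsupport_deriv_subset (tsupport_deriv_subset h)))
  · rw [Real.closedBall_eq_Icc]
    have : χ.rIn = 1 / 2 := rfl
    rw [this]
    constructor <;> linarith [hz.1, hz.2]
  · rw [abs_of_nonneg χ.nonneg]
    exact χ.le_one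
  · exact (hB1 z).trans (le_max_left _ _)
  · exact (hB2 z).trans (le_max_right _ _)

/-- The wave packet `L^{-1/2} χ(z / L) e^{ikz}` at the point `lam = -k² - 1 + i c k`. Since
`e^{ikz}` solves the limiting equation at `-∞`, the operator only sees the derivatives of
`χ(z / L)` and the tail of `1 - u`. -/
lemma WaveData.exists_wavePacket {c : ℝ} {u v : ℝ → ℝ} (h : WaveData c u v) (hc : 0 ≤ c) (k : ℝ)
    {lam : ℂ} (hlam : lam = -(k : ℂ) ^ 2 - 1 + Complex.I * c * k) :
    ∃ C : ℝ, ∀ L : ℝ, 1 ≤ L → ∃ p f : L2Neg, (p, f) ∈ (shift (linearisation c u) lam).graph ∧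
      ‖p‖ ≤ 2 ∧ 1 ≤ ‖p‖ ∧ ‖f‖ ≤ C * L⁻¹ + 4 * (1 - u (-L)) ∧
      ∀ᵐ z ∂volNeg, z ∉ Ioo (-(4 * L)) (-L) → p z = 0 := by
  obtain ⟨-, Q, hQ⟩ := h.exists_mulOp hc
  obtain ⟨χ, χ₁, χ₂, B, d0, d1, hχ2, hz, hone, hb⟩ := exists_bump
  refine ⟨2 * (B + (2 * |k| + c) * B), fun L hL => ?_⟩
  have hL0 : 0 < L := by linarith
  have hLC : (L : ℂ) ≠ 0 := by exact_mod_cast hL0.ne'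
  have hB : 0 ≤ B := (abs_nonneg _).trans (hb 0).2.1
  set s : ℝ := (√L)⁻¹ with hs
  have hs0 : 0 < s := by positivity
  have hs4 : s * √(4 * L) = 2 := by
    rw [Real.sqrt_mul (by norm_num), hs, show (4 : ℝ) = 2 ^ 2 by norm_num,
      Real.sqrt_sq (by norm_num)]
    field_simp
  set e : ℝ → ℂ := fun z => Complex.exp (Complex.I * k * z) with he
  have hde : ∀ z : ℝ, HasDerivAt e (Complex.I * k * e z) z := by
    intro z
    have h1 : HasDerivAt (fun z : ℝ => Complex.I * k * (z : ℂ)) (Complex.I * k * 1) z :=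
      (Complex.ofRealCLM.hasDerivAt (x := z)).const_mul (Complex.I * k)
    exact (h1.cexp).congr_deriv (by simp only [he]; ring)
  have hne : ∀ z : ℝ, ‖e z‖ = 1 := fun z => by
    simp only [he]
    rw [Complex.norm_exp]
    simp
  have hdiv : ∀ z : ℝ, HasDerivAt (fun z : ℝ => z / L) (1 / L) z := fun z =>
    (hasDerivAt_id z).div_const L
  have hd0 : ∀ z : ℝ, HasDerivAt (fun z : ℝ => (χ (z / L) : ℂ)) ((χ₁ (z / L) : ℂ) / L) z := fun z =>
    ((d0 (z / L)).comp z (hdiv z)).ofReal_comp.congr_deriv (by push_cast; ring)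
  have hd1 : ∀ z : ℝ, HasDerivAt (fun z : ℝ => (χ₁ (z / L) : ℂ)) ((χ₂ (z / L) : ℂ) / L) z :=
    fun z => ((d1 (z / L)).comp z (hdiv z)).ofReal_comp.congr_deriv (by push_cast; ring)
  set g : ℝ → ℂ := fun z => s * ((χ (z / L) : ℂ) * e z) with hg
  set g₁ : ℝ → ℂ := fun z => s * (((χ₁ (z / L) : ℂ) / L + Complex.I * k * χ (z / L)) * e z) with hg1
  set g₂ : ℝ → ℂ := fun z => s * (((χ₂ (z / L) : ℂ) / L / L + 2 * (Complex.I * k) * (χ₁ (z / L) / L)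
    - k ^ 2 * χ (z / L)) * e z) with hg2
  have hout : ∀ z : ℝ, z ∉ Ioo (-(4 * L)) (-L) → z / L ∉ Ioo (-4 : ℝ) (-1) := by
    intro z hz hz'
    refine hz ⟨?_, ?_⟩
    · have := (lt_div_iff₀ hL0).1 hz'.1
      linarith
    · have := (div_lt_iff₀ hL0).1 hz'.2
      linarith
  have hcont : Continuous g₂ := by
    have c0 : Continuous χ := continuous_iff_continuousAt.2 fun z => (d0 z).continuousAt
    have c1 : Continuous χ₁ := continuous_iff_continuousAt.2 fun z => (d1 z).continuousAt
    have : Continuous e := continuous_iff_continuousAt.2 fun z => (hde z).continuousAt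
    fun_prop
  obtain ⟨p, p₁, p₂, f, hsol, hp, hp1, hp2, hf⟩ := exists_isSolution_of_hasDerivAt c lam Q
    (g := g) (g₁ := g₁) (g₂ := g₂)
    (fun z => (((hd0 z).mul (hde z)).const_mul (s : ℂ)).congr_deriv (by simp only [hg1]; ring))
    (fun z => (((((hd1 z).div_const (L : ℂ)).add ((hd0 z).const_mul (Complex.I * k))).mul
      (hde z)).const_mul (s : ℂ)).congr_deriv (by
        simp only [hg2, Pi.add_apply]
        linear_combination (s : ℂ) * k ^ 2 * χ (z / L) * e z * Complex.I_sq))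
    hcont (HasCompactSupport.intro (isCompact_Icc (a := -(4 * L)) (b := -L)) fun z hz' => by
      simp only [hg, (hz _ (hout z fun h => hz' (Ioo_subset_Icc_self h))).1, Complex.ofReal_zero,
        zero_mul, mul_zero])
  have hp0 : ∀ᵐ z ∂volNeg, z ∉ Ioo (-(4 * L)) (-L) → p z = 0 := by
    filter_upwards [hp] with z e1 hz'
    rw [e1]
    simp only [hg, (hz _ (hout z hz')).1, Complex.ofReal_zero, zero_mul, mul_zero]
  have hlt := h.lt_one hc (show -L ≤ 0 by linarith)
  refine ⟨p, f, (mem_graph_iff hQ).2 ⟨p₁, g, g₁, hsol, ?_⟩, ?_, ?_, ?_, hp0⟩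
  · simp only [hg, zero_div, (hz 0 (by simp)).1, Complex.ofReal_zero, zero_mul, mul_zero]
  · rw [← hs4]
    refine norm_le_of_ae_le (by positivity) hs0.le ?_
    filter_upwards [hp, hp0, ae_volNeg_of_forall (fun z hz => hz)] with z e1 e2 e3
    by_cases h0 : z ∈ Ioo (-(4 * L)) 0
    · rw [indicator_of_mem h0, e1]
      simp only [hg, norm_mul, hne, Complex.norm_real, mul_one, Real.norm_eq_abs]
      rw [abs_of_pos hs0]
      exact mul_le_of_le_one_right hs0.le (hb _).1
    · rw [indicator_of_notMem h0, e2 fun h => h0 ⟨h.1, e3⟩, norm_zero]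
  · have h1 : s * √(-(2 * L) - -(3 * L)) = 1 := by
      rw [show -(2 * L) - -(3 * L) = L by ring, hs]
      field_simp
    rw [← h1]
    refine le_norm_of_le_ae (by linarith) (by linarith) hs0.le ?_
    filter_upwards [hp] with z e1 hz'
    rw [e1]
    simp only [hg, norm_mul, hne, Complex.norm_real, mul_one, Real.norm_eq_abs]
    rw [abs_of_pos hs0, hone (z / L) ⟨by rw [lt_div_iff₀ hL0]; linarith [hz'.1],
      by rw [div_lt_iff₀ hL0]; linarith [hz'.2]⟩, abs_one, mul_one]
  · set A : ℝ := B * L⁻¹ + (2 * |k| + c) * B * L⁻¹ + 2 * (1 - u (-L)) with hA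
    have hA0 : 0 ≤ A := by
      have : 0 ≤ 1 - u (-L) := by linarith
      positivity
    have h2 : ‖f‖ ≤ s * A * √(4 * L) := by
      refine norm_le_of_ae_le (by positivity) (by positivity) ?_
      filter_upwards [Lp.coeFn_add (p₂ + (c : ℂ) • p₁ - (1 + lam) • p) ((2 : ℂ) • Q p),
        Lp.coeFn_sub (p₂ + (c : ℂ) • p₁) ((1 + lam) • p), Lp.coeFn_add p₂ ((c : ℂ) • p₁),
        Lp.coeFn_smul (c : ℂ) p₁, Lp.coeFn_smul (1 + lam) p, Lp.coeFn_smul (2 : ℂ) (Q p), hQ p,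
        hp, hp1, hp2, ae_volNeg_of_forall (fun z hz => hz)]
        with z e1 e2 e3 e4 e5 e6 e7 e8 e9 e10 e11
      have hfz : f z = s * ((χ₂ (z / L) / L / L + (2 * (Complex.I * k) + c) * (χ₁ (z / L) / L) +
          2 * (((1 - u z : ℝ) : ℂ) * χ (z / L))) * e z) := by
        rw [hf, e1, Pi.add_apply, e2, Pi.sub_apply, e3, Pi.add_apply, e4, e5, e6]
        simp only [Pi.smul_apply, smul_eq_mul, e7, e8, e9, e10, hg, hg1, hg2, hlam]
        ring
      by_cases h0 : z ∈ Ioo (-(4 * L)) (-L)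
      · rw [indicator_of_mem (show z ∈ Ioo (-(4 * L)) 0 from ⟨h0.1, e11⟩), hfz,
          norm_mul, norm_mul, hne, mul_one,
          Complex.norm_real,
          Real.norm_of_nonneg hs0.le]
        refine mul_le_mul_of_nonneg_left ?_ hs0.le
        have hinv : L⁻¹ ≤ 1 := inv_le_one_of_one_le₀ hL
        have hinv0 : 0 ≤ L⁻¹ := by positivity
        have i1 : ‖(χ₂ (z / L) : ℂ) / L / L‖ ≤ B * L⁻¹ := by
          rw [norm_div, norm_div, Complex.norm_real, Complex.norm_real, Real.norm_of_nonneg hL0.le,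
            Real.norm_eq_abs, div_eq_mul_inv, div_eq_mul_inv]
          have := mul_le_mul_of_nonneg_right (hb (z / L)).2.2 hinv0
          exact (mul_le_of_le_one_right (by positivity) hinv).trans this
        have i2 : ‖(2 * (Complex.I * k) + c) * ((χ₁ (z / L) : ℂ) / L)‖
            ≤ (2 * |k| + c) * B * L⁻¹ := by
          rw [norm_mul, norm_div, Complex.norm_real, Complex.norm_real, Real.norm_of_nonneg hL0.le,
            Real.norm_eq_abs, div_eq_mul_inv, ← mul_assoc]
          refine mul_le_mul_of_nonneg_right (mul_le_mul ?_ (hb _).2.1 (abs_nonneg _)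
            (by positivity)) hinv0
          refine (norm_add_le _ _).trans (le_of_eq ?_)
          rw [norm_mul, norm_mul, Complex.norm_I, Complex.norm_real, Complex.norm_real,
            Real.norm_of_nonneg hc, Real.norm_eq_abs]
          norm_num
        have i3 : ‖2 * (((1 - u z : ℝ) : ℂ) * χ (z / L))‖ ≤ 2 * (1 - u (-L)) := by
          have hanti := h.anti.antitoneOn (show z ∈ Iic 0 from e11.le)
            (show -L ∈ Iic 0 by simp [hL0.le]) h0.2.le
          have := h.lt_one hc e11.le
          rw [norm_mul, norm_mul, Complex.norm_real, Complex.norm_real,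
            Real.norm_of_nonneg (by linarith : 0 ≤ 1 - u z), Real.norm_eq_abs, Complex.norm_two]
          have := mul_le_of_le_one_right (by linarith : 0 ≤ 1 - u z) (hb (z / L)).1
          linarith
        exact (norm_add₃_le).trans (add_le_add (add_le_add i1 i2) i3)
      · obtain ⟨z0, z1, z2⟩ := hz _ (hout z h0)
        rw [hfz, z0, z1, z2]
        simpa using indicator_nonneg (fun _ _ => by positivity) z
    calc ‖f‖ ≤ s * A * √(4 * L) := h2
      _ = A * (s * √(4 * L)) := by ring
      _ = _ := by rw [hs4, hA]; ring

theorem WaveData.not_isFredholm {c : ℝ} {u v : ℝ → ℝ} (h : WaveData c u v) (hc : 0 ≤ c)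
    {lam : ℂ} (hlam : lam ∈ farFieldParabola c)
    (hres : (resolventSet (linearisation c u)).Nonempty) :
    ¬ IsFredholm (shift (linearisation c u) lam) := by
  obtain ⟨k, rfl⟩ := hlam
  obtain ⟨C, hC⟩ := h.exists_wavePacket hc k rfl
  have hone : ∀ n : ℕ, (1 : ℝ) ≤ 4 ^ n := fun n => one_le_pow₀ (by norm_num)
  choose p f hpf hp2 hp1 hf hp0 using fun n : ℕ => hC (4 ^ n) (hone n)
  obtain ⟨mu, hmu⟩ := hres
  have horth : ∀ m n, m < n → inner ℂ (p m) (p n) = (0 : ℂ) := by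
    intro m n hmn
    rw [L2.inner_def]
    refine integral_eq_zero_of_ae ?_
    filter_upwards [hp0 m, hp0 n] with z e1 e2
    by_cases h0 : z ∈ Ioo (-(4 * 4 ^ m)) (-4 ^ m : ℝ)
    · rw [e2 fun h1 => ?_, inner_zero_right]
      · rfl
      · have : (4 : ℝ) ^ (m + 1) ≤ 4 ^ n := pow_le_pow_right₀ (by norm_num) hmn
        rw [pow_succ] at this
        linarith [h0.1, h1.2]
    · rw [e1 h0, inner_zero_left]
      rfl
  have hsep : ∀ m n, m ≠ n → 1 ≤ ‖p m - p n‖ := by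
    intro m n hmn
    have h0 : inner ℂ (p m) (p n) = (0 : ℂ) := by
      rcases hmn.lt_or_gt with h1 | h1
      · exact horth m n h1
      · exact inner_eq_zero_symm.1 (horth n m h1)
    have h1 := norm_sub_sq (𝕜 := ℂ) (p m) (p n)
    rw [h0] at h1
    simp only [map_zero, mul_zero, sub_zero] at h1
    have h2 := hp1 m
    nlinarith [norm_nonneg (p m - p n), sq_nonneg ‖p n‖]
  refine not_isFredholm_of_singular_sequence (isClosed_graph_of_mem_resolventSet hmu _) hpf one_pos
    hp2 hsep (squeeze_zero_norm hf ?_)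
  have h4 : Tendsto (fun n : ℕ => (4 : ℝ) ^ n) atTop atTop :=
    tendsto_pow_atTop_atTop_of_one_lt (by norm_num)
  have hu := (h.tendsto_one hc).comp (tendsto_neg_atTop_atBot.comp h4)
  simpa using ((tendsto_inv_atTop_zero.comp h4).const_mul C).add ((hu.const_sub 1).const_mul 4)

/-! ### The spectrum -/

/-- The trichotomy by the sign of the real part `a` of the larger characteristic root. -/
lemma WaveData.spectral_trichotomy {c : ℝ} {u v : ℝ → ℝ} (h : WaveData c u v) (hc : 0 ≤ c)
    (hc2 : c < 2) (lam : ℂ) :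
    (lam ∉ farFieldRegion c ∧ IsFredholm (shift (linearisation c u) lam) ∧
      index (shift (linearisation c u) lam) = 0 ∧
      (0 ≤ lam.re → lam ∈ resolventSet (linearisation c u))) ∨
    lam ∈ farFieldParabola c ∨
    (lam ∈ farFieldRegion c ∧ IsFredholm (shift (linearisation c u) lam) ∧
      index (shift (linearisation c u) lam) = -1) := by
  obtain ⟨a, b, ha, h1, h2⟩ := exists_roots c lam
  have hsum : (⟨a, b⟩ + ⟨-c - a, -b⟩ : ℂ) = -c := by
    apply Complex.ext <;> simp
  have hprod : (⟨a, b⟩ * ⟨-c - a, -b⟩ : ℂ) = -(1 + lam) := by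
    apply Complex.ext
    · simp only [Complex.mul_re, Complex.neg_re, Complex.add_re, Complex.one_re, h1]
      ring
    · simp only [Complex.mul_im, Complex.neg_im, Complex.add_im, Complex.one_im, h2]
      ring
  rcases lt_trichotomy a 0 with h0 | h0 | h0
  · exact Or.inr (Or.inr ⟨(mem_farFieldRegion_iff_root hc ha h1 h2).2 h0.le,
      h.fredholm_left hc hsum hprod h0 (show -c - a < 0 by linarith)⟩)
  · exact Or.inr (Or.inl ((mem_farFieldParabola_iff_root hc ha h1 h2).2 h0))
  · obtain ⟨⟨h3, h4⟩, h5⟩ := h.fredholm_right hc hc2 hsum hprod h0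
      (show -c - a < 0 by linarith)
    exact Or.inl ⟨fun h6 => absurd ((mem_farFieldRegion_iff_root hc ha h1 h2).1 h6) h0.not_ge,
      h3, h4, h5⟩

lemma farFieldParabola_subset (c : ℝ) : farFieldParabola c ⊆ farFieldRegion c :=
  fun lam h => ⟨lam, h, rfl, le_rfl⟩

lemma re_lt_zero_of_mem_farFieldRegion {c : ℝ} {lam : ℂ} (h : lam ∈ farFieldRegion c) :
    lam.re < 0 := by
  obtain ⟨k, h1, -⟩ := mem_farFieldRegion.1 h
  nlinarith [sq_nonneg k]

lemma WaveData.mem_resolventSet {c : ℝ} {u v : ℝ → ℝ} (h : WaveData c u v) (hc : 0 ≤ c)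
    (hc2 : c < 2) {lam : ℂ} (hlam : 0 ≤ lam.re) : lam ∈ resolventSet (linearisation c u) := by
  have hnot : lam ∉ farFieldRegion c := fun h1 =>
    absurd hlam (re_lt_zero_of_mem_farFieldRegion h1).not_ge
  rcases h.spectral_trichotomy hc hc2 lam with h1 | h1 | h1
  · exact h1.2.2.2 hlam
  · exact absurd (farFieldParabola_subset c h1) hnot
  · exact absurd h1.1 hnot

theorem WaveData.essentialSpectrum_eq {c : ℝ} {u v : ℝ → ℝ} (h : WaveData c u v) (hc : 0 ≤ c)
    (hc2 : c < 2) : essentialSpectrum (linearisation c u) = farFieldRegion c := by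
  ext lam
  rcases h.spectral_trichotomy hc hc2 lam with ⟨h1, h2, h3, -⟩ | h1 | ⟨h1, h2, h3⟩
  · refine iff_of_false ?_ h1
    rintro (h4 | h4)
    · exact h4 h2
    · exact h4.2 h3
  · exact iff_of_true (Or.inl (h.not_isFredholm hc h1 ⟨0, h.mem_resolventSet hc hc2 (by simp)⟩))
      (farFieldParabola_subset c h1)
  · exact iff_of_true (Or.inr ⟨h2, by rw [h3]; decide⟩) h1

end FisherStefan

open UnboundedOp FisherStefan in
theorem mainTheorem1 (c : ℝ) (hc0 : 0 ≤ c) (hc2 : c < 2) :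
    (∃ u, IsSpreadingWave c u) ∧
    (∀ u₁ u₂, IsSpreadingWave c u₁ → IsSpreadingWave c u₂ → EqOn u₁ u₂ (Iic 0)) ∧
    ∀ u, IsSpreadingWave c u →
      spectrum (linearisation c u) ⊆ {lam : ℂ | lam.re < 0} ∧
      essentialSpectrum (linearisation c u) = farFieldRegion c ∧
      frontier (essentialSpectrum (linearisation c u)) = farFieldParabola c ∧
      (∀ lam ∈ farFieldParabola c, ¬ IsFredholm (shift (linearisation c u) lam)) ∧
      pointSpectrum (linearisation c u) ∩ {lam : ℂ | 0 ≤ lam.re} = ∅ := by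
  refine ⟨exists_isSpreadingWave hc0 hc2, fun u₁ u₂ h₁ h₂ => h₁.eqOn hc0 h₂, fun u hu => ?_⟩
  obtain ⟨v, h⟩ := hu.exists_data
  have hess := h.essentialSpectrum_eq hc0 hc2
  refine ⟨fun lam hlam => ?_, hess, ?_, fun lam hlam => ?_, ?_⟩
  · by_contra! h0
    exact hlam (h.mem_resolventSet hc0 hc2 (not_lt.1 h0))
  · rw [hess, frontier_farFieldRegion hc0]
  · exact h.not_isFredholm hc0 hlam ⟨0, h.mem_resolventSet hc0 hc2 (by simp)⟩
  · ext lam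
    exact iff_of_false (fun h0 => h0.1.2.2 (h.mem_resolventSet hc0 hc2 h0.2)) (notMem_empty _)
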